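/- Let $n\ge 0$ and let $(\mathcal M,G)$ be one of the following seven pairs, where $\mathcal M$ is a real vector space of square matrices over $\mathbb K\in\{\mathbb R,\mathbb C,\mathbb H\}$, $N$ is the size of the matrices in $\mathcal M$, and $G$ is a group of invertible $(N+N)\times(N+N)$ block matrices $g=\begin{pmatrix}a&b\\c&d\end{pmatrix}$ over $\mathbb K$: 1. $\mathcal M=\mathrm{Mat}_n(\mathbb K)$, $N=n$, $G=\mathrm{GL}(2n,\mathbb K)$, for $\mathbb K=\mathbb R$, $\mathbb C$ and $\mathbb H$ (three pairs); 2. $\mathcal M$ = complex symmetric $n\times n$ matrices, $N=n$, $G=\mathrm{Sp}(2n,\mathbb C)=\{g: gJg^{t}=J\}$, $J=\begin{pmatrix}0&-1\\1&0\end{pmatrix}$; 3. $\mathcal M$ = skew-symmetric $2n\times 2n$ matrices over $\mathbb K=\mathbb C$ or $\mathbb R$, $N=2n$, $G=\{g: gSg^{t}=S,\ \det g=1\}$, $S=\begin{pmatrix}0&1\\1&0\end{pmatrix}$, i.e. $G=\mathrm{SO}(4n,\mathbb C)$, respectively $G=\mathrm{SO}(2n,2n)$ (two pairs); 4. $\mathcal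 M$ = quaternionic anti-Hermitian $n\times n$ matrices ($x^*=-x$), $N=n$, $G=\mathrm{Sp}(n,n)=\{g: gSg^{*}=S\}$. (These are the classical groups acting by linear-fractional maps $x\mapsto x^{[g]}=(a+xc)^{-1}(b+xd)$ on a flat matrix space, other than $\mathrm U(n,n)$, $\mathrm{Sp}(2n,\mathbb R)$ and $\mathrm{SO}^*(4n)$.) Write $|\det z|=|\det_{\mathbb R} z|^{1/\dim_{\mathbb R}\mathbb K}$, where $\det_{\mathbb R}z$ is the determinant of the real-linear operator $v\mapsto zv$ on columns over $\mathbb K$. (It is the usual $|\det z|$ for $\mathbb K=\mathbb R,\mathbb C$ and the Dieudonné determinant for $\mathbb K=\mathbb H$.) Put $h=\frac 2N\dim_{\mathbb R}\mathcal M$ (and $h=0$ if $N=0$) and $\beta=N\dim_{\mathbb R}\mathbb K$. Let $L^2(\mathcal M)$ be taken with respect to any Lebesgue (Haar) measure on $\mathcal M$, and let $\omega:\mathrm{GL}(N,\mathbb K)\to\{|z|=1\}$ be any continuous character, for instance $\omega=1$. Then the formula $$\rho(g)F(x)=F\bigl((a+xc)^{-1}(b+xd)\bigr)\,\omega(a+xc)\,|\det(a+xc)|^{-h/2}\,|\det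 g|^{\beta/2}$$ (in which $a+xc$ is invertible and $(a+xc)^{-1}(b+xd)\in\mathcal M$ for almost all $x\in\mathcal M$) defines a strongly continuous unitary representation $\rho$ of $G$ in $L^2(\mathcal M)$, the degenerate unitary principal series. Here $|\det g|=1$ unless $G$ is a general linear group. Moreover: (i) the restriction of $\rho$ to the maximal parabolic $P=\left\{\begin{pmatrix}a&b\\0&d\end{pmatrix}\in G\right\}$ is given by $F(x)\mapsto F(a^{-1}(b+xd))\,\omega(a)\,|\det a|^{(\beta-h)/2}\,|\det d|^{\beta/2}$, and it is irreducible: the only closed $P$-invariant subspaces of $L^2(\mathcal M)\neq 0$ are $0$ and $L^2(\mathcal M)$; (ii) consequently, the representation $\rho$ of $G$ is irreducible. -/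

import Mathlib

open MeasureTheory Matrix Filter

namespace SteinSahi

noncomputable section

/-! ### Determinants over `ℝ`, `ℂ` and `ℍ` -/

/-- The `ℝ`-linear operator `v ↦ a v` on columns of size `ι` over `K`. -/
def mulVecReal {K : Type} [DivisionRing K] [Algebra ℝ K] {ι : Type} [Fintype ι]
    (a : Matrix ι ι K) : (ι → K) →ₗ[ℝ] (ι → K) where
  toFun v := a *ᵥ v
  map_add' v w := Matrix.mulVec_add a v w
  map_smul' r v := Matrix.mulVec_smul a r v

/-- The modulus of the determinant of a square matrix over `K = ℝ, ℂ, ℍ`: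
`|det a| = |det_ℝ a| ^ (1 / dim_ℝ K)`. It is the usual `|det a|` for `K = ℝ` and `K = ℂ`, and the
(positive) Dieudonné determinant for `K = ℍ`. -/
def absDet {K : Type} [DivisionRing K] [Algebra ℝ K] {ι : Type} [Fintype ι]
    (a : Matrix ι ι K) : ℝ :=
  |LinearMap.det (mulVecReal a)| ^ ((Module.finrank ℝ K : ℝ)⁻¹)

/-! ### Flat matrix spaces -/

/-- Symmetric `n × n` matrices over `K`. -/
def symMatrices (n : ℕ) (K : Type) [Field K] [Algebra ℝ K] :
    Submodule ℝ (Matrix (Fin n) (Fin n) K) where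
  carrier := {x | xᵀ = x}
  add_mem' {x y} hx hy := by
    simp only [Set.mem_ofPred_eq, Matrix.transpose_add] at *
    rw [hx, hy]
  zero_mem' := by simp
  smul_mem' r x hx := by
    simp only [Set.mem_ofPred_eq, Matrix.transpose_smul] at *
    rw [hx]

/-- Skew-symmetric `n × n` matrices over `K`. -/
def skewMatrices (n : ℕ) (K : Type) [Field K] [Algebra ℝ K] :
    Submodule ℝ (Matrix (Fin n) (Fin n) K) where
  carrier := {x | xᵀ = -x}
  add_mem' {x y} hx hy := by
    simp only [Set.mem_ofPred_eq, Matrix.transpose_add] at *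
    rw [hx, hy, neg_add]
  zero_mem' := by simp
  smul_mem' r x hx := by
    simp only [Set.mem_ofPred_eq, Matrix.transpose_smul] at *
    rw [hx, smul_neg]

/-- Anti-Hermitian `n × n` matrices over the quaternions. -/
def antiHermMatrices (n : ℕ) : Submodule ℝ (Matrix (Fin n) (Fin n) (Quaternion ℝ)) where
  carrier := {x | xᴴ = -x}
  add_mem' {x y} hx hy := by
    simp only [Set.mem_ofPred_eq, Matrix.conjTranspose_add] at *
    rw [hx, hy, neg_add]
  zero_mem' := by simp
  smul_mem' r x hx := by
    simp only [Set.mem_ofPred_eq] at *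
    have h : (r • x)ᴴ = r • xᴴ := by
      ext1 i j
      simp [Matrix.conjTranspose_apply]
    rw [h, hx, smul_neg]

/-! ### The groups

All groups consist of invertible `(n + n) × (n + n)` matrices, written in blocks
`g = (a b; c d)`. -/

/-- `GL(2n, K)`. -/
abbrev GL2 (n : ℕ) (K : Type) [DivisionRing K] : Type :=
  (Matrix (Fin n ⊕ Fin n) (Fin n ⊕ Fin n) K)ˣ

/-- The symmetric matrix `(0 1; 1 0)`. -/
def splitForm (n : ℕ) (K : Type) [DivisionRing K] :
    Matrix (Fin n ⊕ Fin n) (Fin n ⊕ Fin n) K :=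
  Matrix.fromBlocks 0 1 1 0

/-- `Sp(2n, K)`. -/
def Sp2 (n : ℕ) (K : Type) [Field K] : Subgroup (GL2 n K) where
  carrier := {g | (g : Matrix (Fin n ⊕ Fin n) (Fin n ⊕ Fin n) K) ∈ symplecticGroup (Fin n) K}
  mul_mem' {g h} hg hh := by
    simpa using mul_mem hg hh
  one_mem' := by simp
  inv_mem' {g} hg := by
    simp only [Set.mem_ofPred_eq, SymplecticGroup.mem_iff] at *
    calc (↑g⁻¹ : Matrix _ _ K) * J (Fin n) K * (↑g⁻¹ : Matrix _ _ K)ᵀ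
        = ↑g⁻¹ * (↑g * J (Fin n) K * (↑g : Matrix _ _ K)ᵀ) * (↑g⁻¹ : Matrix _ _ K)ᵀ := by rw [hg]
      _ = (↑g⁻¹ * ↑g) * J (Fin n) K * (↑g⁻¹ * ↑g)ᵀ := by
          rw [Matrix.transpose_mul]; simp only [Matrix.mul_assoc]
      _ = J (Fin n) K := by rw [← Units.val_mul]; simp

/-- The special orthogonal group of the form `(0 1; 1 0)` on `K ^ (n + n)`: it is `SO(2n, ℂ)` for
`K = ℂ` and (the full, non-connected) `SO(n, n)` for `K = ℝ`. -/
def SO2 (n : ℕ) (K : Type) [Field K] : Subgroup (GL2 n K) where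
  carrier := {g | (g : Matrix (Fin n ⊕ Fin n) (Fin n ⊕ Fin n) K) * splitForm n K *
      (g : Matrix (Fin n ⊕ Fin n) (Fin n ⊕ Fin n) K)ᵀ = splitForm n K ∧
    (g : Matrix (Fin n ⊕ Fin n) (Fin n ⊕ Fin n) K).det = 1}
  mul_mem' {g h} hg hh := by
    refine ⟨?_, by rw [Units.val_mul, Matrix.det_mul, hg.2, hh.2, one_mul]⟩
    calc (↑(g * h) : Matrix _ _ K) * splitForm n K * (↑(g * h) : Matrix _ _ K)ᵀ
        = ↑g * (↑h * splitForm n K * (↑h : Matrix _ _ K)ᵀ) * (↑g : Matrix _ _ K)ᵀ := by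
          rw [Units.val_mul, Matrix.transpose_mul]; simp only [Matrix.mul_assoc]
      _ = splitForm n K := by rw [hh.1, hg.1]
  one_mem' := by simp
  inv_mem' {g} hg := by
    have h1 : (g⁻¹ : GL2 n K).val * g.val = 1 := g.inv_mul
    refine ⟨?_, ?_⟩
    · calc (↑g⁻¹ : Matrix _ _ K) * splitForm n K * (↑g⁻¹ : Matrix _ _ K)ᵀ
          = (↑g⁻¹ : Matrix _ _ K) * (↑g * splitForm n K * (↑g : Matrix _ _ K)ᵀ) *
              (↑g⁻¹ : Matrix _ _ K)ᵀ := by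
            rw [hg.1]
        _ = ((↑g⁻¹ : Matrix _ _ K) * ↑g) * splitForm n K * ((↑g⁻¹ : Matrix _ _ K) * ↑g)ᵀ := by
            rw [Matrix.transpose_mul]; simp only [Matrix.mul_assoc]
        _ = splitForm n K := by rw [h1]; simp
    · have h2 := congrArg Matrix.det h1
      rwa [Matrix.det_mul, hg.2, mul_one, Matrix.det_one] at h2

/-- `Sp(n, n)`: the quaternionic matrices that preserve the Hermitian form `(0 1; 1 0)`,
which has signature `(n, n)`. -/
def SpSplit (n : ℕ) : Subgroup (GL2 n (Quaternion ℝ)) where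
  carrier := {g | (g : Matrix (Fin n ⊕ Fin n) (Fin n ⊕ Fin n) (Quaternion ℝ)) *
      splitForm n (Quaternion ℝ) *
      (g : Matrix (Fin n ⊕ Fin n) (Fin n ⊕ Fin n) (Quaternion ℝ))ᴴ = splitForm n (Quaternion ℝ)}
  mul_mem' {g h} hg hh := by
    simp only [Set.mem_ofPred_eq] at *
    calc (↑(g * h) : Matrix _ _ (Quaternion ℝ)) * splitForm n _ *
          (↑(g * h) : Matrix _ _ (Quaternion ℝ))ᴴ
        = ↑g * (↑h * splitForm n _ * (↑h : Matrix _ _ (Quaternion ℝ))ᴴ) *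
          (↑g : Matrix _ _ (Quaternion ℝ))ᴴ := by
          rw [Units.val_mul, Matrix.conjTranspose_mul]; simp only [Matrix.mul_assoc]
      _ = splitForm n _ := by rw [hh, hg]
  one_mem' := by simp
  inv_mem' {g} hg := by
    simp only [Set.mem_ofPred_eq] at *
    have h1 : (g⁻¹ : GL2 n (Quaternion ℝ)).val * g.val = 1 := g.inv_mul
    calc (↑g⁻¹ : Matrix _ _ (Quaternion ℝ)) * splitForm n _ *
          (↑g⁻¹ : Matrix _ _ (Quaternion ℝ))ᴴ
        = (↑g⁻¹ : Matrix _ _ (Quaternion ℝ)) *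
            (↑g * splitForm n _ * (↑g : Matrix _ _ (Quaternion ℝ))ᴴ) *
          (↑g⁻¹ : Matrix _ _ (Quaternion ℝ))ᴴ := by rw [hg]
      _ = ((↑g⁻¹ : Matrix _ _ (Quaternion ℝ)) * ↑g) * splitForm n _ *
            ((↑g⁻¹ : Matrix _ _ (Quaternion ℝ)) * ↑g)ᴴ := by
          rw [Matrix.conjTranspose_mul]; simp only [Matrix.mul_assoc]
      _ = splitForm n _ := by rw [h1]; simp

/-- The parabolic subgroup `P` of `G`: the elements `(a b; 0 d)` of `G`. -/
def parabolic {n : ℕ} {K : Type} [DivisionRing K] (G : Subgroup (GL2 n K)) : Subgroup G where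
  carrier := {g | (g : GL2 n K).val.toBlocks₂₁ = 0}
  mul_mem' {g h} hg hh := by
    simp only [Set.mem_ofPred_eq] at *
    have key : ((g * h : G) : GL2 n K).val.toBlocks₂₁ =
        (g : GL2 n K).val.toBlocks₂₁ * (h : GL2 n K).val.toBlocks₁₁ +
        (g : GL2 n K).val.toBlocks₂₂ * (h : GL2 n K).val.toBlocks₂₁ := by
      ext i j
      simp [Matrix.toBlocks₂₁, Matrix.toBlocks₁₁, Matrix.toBlocks₂₂, Matrix.mul_apply]
    rw [key, hg, hh]; simp
  one_mem' := by
    simp only [Set.mem_ofPred_eq]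
    ext i j
    simp [Matrix.toBlocks₂₁]
  inv_mem' {g} hg := by
    simp only [Set.mem_ofPred_eq] at *
    set A := (g : GL2 n K).val
    set B := ((g⁻¹ : G) : GL2 n K).val
    have h : B * A = 1 := by
      change ((g : GL2 n K)⁻¹).val * (g : GL2 n K).val = 1
      rw [← Units.val_mul]; simp
    have h11 : B.toBlocks₁₁ * A.toBlocks₁₁ = 1 := by
      have := congrArg Matrix.toBlocks₁₁ h
      rw [← Matrix.fromBlocks_toBlocks A, ← Matrix.fromBlocks_toBlocks B,
        Matrix.fromBlocks_multiply, hg, ← Matrix.fromBlocks_one,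
        Matrix.toBlocks_fromBlocks₁₁, Matrix.toBlocks_fromBlocks₁₁] at this
      simpa using this
    have h21 : B.toBlocks₂₁ * A.toBlocks₁₁ = 0 := by
      have := congrArg Matrix.toBlocks₂₁ h
      rw [← Matrix.fromBlocks_toBlocks A, ← Matrix.fromBlocks_toBlocks B,
        Matrix.fromBlocks_multiply, hg, ← Matrix.fromBlocks_one,
        Matrix.toBlocks_fromBlocks₂₁, Matrix.toBlocks_fromBlocks₂₁] at this
      simpa using this
    have h11' : A.toBlocks₁₁ * B.toBlocks₁₁ = 1 := mul_eq_one_comm.mp h11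
    calc B.toBlocks₂₁ = B.toBlocks₂₁ * (A.toBlocks₁₁ * B.toBlocks₁₁) := by rw [h11', mul_one]
      _ = 0 := by rw [← mul_assoc, h21, zero_mul]

/-! ### Unitary representations -/

/-- A unitary representation (a homomorphism to the unitary group of a Hilbert space `H`) is
irreducible: `H ≠ 0` and the only closed invariant subspaces are `0` and `H`. -/
def IsIrreducibleRep {Γ : Type} [Group Γ] {H : Type} [NormedAddCommGroup H]
    [InnerProductSpace ℂ H] (π : Γ →* (H ≃ₗᵢ[ℂ] H)) : Prop :=
  Nontrivial H ∧ ∀ V : Submodule ℂ H, IsClosed (V : Set H) →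
    (∀ g : Γ, ∀ v ∈ V, π g v ∈ V) → V = ⊥ ∨ V = ⊤

/-- A homomorphism to the unitary group of `H` is strongly continuous. -/
def IsStronglyContinuous {Γ : Type} [Group Γ] [TopologicalSpace Γ] {H : Type}
    [NormedAddCommGroup H] [InnerProductSpace ℂ H] (π : Γ →* (H ≃ₗᵢ[ℂ] H)) : Prop :=
  ∀ v : H, Continuous fun g : Γ => π g v

section Series

variable {n : ℕ} {K : Type} [DivisionRing K] [Algebra ℝ K] [TopologicalSpace K]

/-- `h = (2 / n) dim_ℝ M`, where `n` is the size of the matrices. -/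
def hExp (M : Submodule ℝ (Matrix (Fin n) (Fin n) K)) : ℝ :=
  2 / (n : ℝ) * (Module.finrank ℝ M : ℝ)

/-- `β = n dim_ℝ K`. -/
def betaExp (n : ℕ) (K : Type) [DivisionRing K] [Algebra ℝ K] : ℝ :=
  (n : ℝ) * (Module.finrank ℝ K : ℝ)

/-- `ρ` is given by the linear-fractional formula
`(ρ(g) F)(x) = ω(a + xc) |det (a + xc)| ^ (-h/2) |det g| ^ (β/2) F((a + xc)⁻¹ (b + xd))`,
`g = (a b; c d)`: for every `F` in `L²(M)` and almost every `x`, the matrix `u = a + xc` is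
invertible, `y = u⁻¹ (b + xd)` lies in `M`, and the formula holds at `x`.
(`|det g| = 1` unless `G` is a general linear group.) -/
def IsPrincipalSeries (M : Submodule ℝ (Matrix (Fin n) (Fin n) K)) (G : Subgroup (GL2 n K))
    [MeasurableSpace M] (μ : Measure M) (ω : (Matrix (Fin n) (Fin n) K)ˣ →* Circle)
    (ρ : G →* (Lp ℂ 2 μ ≃ₗᵢ[ℂ] Lp ℂ 2 μ)) : Prop :=
  ∀ (g : G) (F : Lp ℂ 2 μ), ∀ᵐ x : M ∂μ,
    ∃ (u : (Matrix (Fin n) (Fin n) K)ˣ) (y : M),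
      (u : Matrix (Fin n) (Fin n) K) =
        (g : GL2 n K).val.toBlocks₁₁ + (x : Matrix (Fin n) (Fin n) K) *
          (g : GL2 n K).val.toBlocks₂₁ ∧
      (y : Matrix (Fin n) (Fin n) K) =
        (↑u⁻¹ : Matrix (Fin n) (Fin n) K) *
          ((g : GL2 n K).val.toBlocks₁₂ + (x : Matrix (Fin n) (Fin n) K) *
            (g : GL2 n K).val.toBlocks₂₂) ∧
      (ρ g F) x = (ω u : ℂ) *
        ((absDet (u : Matrix (Fin n) (Fin n) K) ^ (-(hExp M) / 2) *
          absDet (g : GL2 n K).val ^ (betaExp n K / 2) : ℝ) : ℂ) * F y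

/-- `π` is given by the affine formula
`(π(p) F)(x) = ω(a) |det a| ^ s |det d| ^ t F(a⁻¹ (b + xd))`, `p = (a b; 0 d)`. -/
def IsAffineRep (M : Submodule ℝ (Matrix (Fin n) (Fin n) K)) (G : Subgroup (GL2 n K))
    [MeasurableSpace M] (μ : Measure M) (ω : (Matrix (Fin n) (Fin n) K)ˣ →* Circle) (s t : ℝ)
    (π : parabolic G →* (Lp ℂ 2 μ ≃ₗᵢ[ℂ] Lp ℂ 2 μ)) : Prop :=
  ∀ (p : parabolic G) (F : Lp ℂ 2 μ), ∃ a : (Matrix (Fin n) (Fin n) K)ˣ,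
    (a : Matrix (Fin n) (Fin n) K) = (p : GL2 n K).val.toBlocks₁₁ ∧
    ∀ᵐ x : M ∂μ, ∃ y : M,
      (y : Matrix (Fin n) (Fin n) K) =
        (↑a⁻¹ : Matrix (Fin n) (Fin n) K) *
          ((p : GL2 n K).val.toBlocks₁₂ + (x : Matrix (Fin n) (Fin n) K) *
            (p : GL2 n K).val.toBlocks₂₂) ∧
      (π p F) x = (ω a : ℂ) *
        ((absDet (a : Matrix (Fin n) (Fin n) K) ^ s *
          absDet (p : GL2 n K).val.toBlocks₂₂ ^ t : ℝ) : ℂ) * F y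

/-- For every Lebesgue measure on `M` and every continuous unitary character `ω` of `GL(n, K)`,
the linear-fractional formula defines a (strongly continuous) unitary representation of `G` on
`L²(M)`; its restriction to `P` is the affine representation and is irreducible; and the
representation of `G` is irreducible. -/
def PrincipalSeriesIrreducible (M : Submodule ℝ (Matrix (Fin n) (Fin n) K))
    (G : Subgroup (GL2 n K)) : Prop :=
  ∀ [MeasurableSpace M] [BorelSpace M] (μ : Measure M) [μ.IsAddHaarMeasure]
    (ω : (Matrix (Fin n) (Fin n) K)ˣ →* Circle), Continuous ω →
    ∃ ρ : G →* (Lp ℂ 2 μ ≃ₗᵢ[ℂ] Lp ℂ 2 μ),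
      IsPrincipalSeries M G μ ω ρ ∧ IsStronglyContinuous ρ ∧
      IsAffineRep M G μ ω ((betaExp n K - hExp M) / 2) (betaExp n K / 2)
        (ρ.comp (parabolic G).subtype) ∧
      IsIrreducibleRep (ρ.comp (parabolic G).subtype) ∧
      IsIrreducibleRep ρ

end Series

end

end SteinSahi

/-! The group acts through block rows: `(1 x) g = u (1 y)` with `u = a + xc` and `y = u⁻¹(b + xd)`.
Hence `u` is a cocycle, and so is the multiplier. There is also the exact difference formula `y' - y
= u(x')⁻¹ (x' - x)(d - cy)`, so the derivative of the action is `δ ↦ u⁻¹ δ (d - cy)`. In the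
Hermitian-type cases `d - cy = (u⁻¹)ᴴ`. For general linear groups its determinant comes from the
factorization of `(1 x; 0 1) g`.

The Jacobian is evaluated by uniqueness of characters (`character_eq_of_eq_on_scalars`): a
non-negative continuous multiplicative function of an invertible matrix over ℝ, ℂ or ℍ is determined
by its values on positive scalars. Counting homogeneity degrees then gives `|det u|^(-h) |det g|^β`,
the squared modulus of the multiplier, and change of variables gives unitarity.

The action is defined almost everywhere as soon as `a + xc` is invertible at one point `x`, because
singularity is a polynomial condition. Such a point is built from the rank normal form of `a`. In
the orthogonal case this needs the corank of `a` to be even, which is what `det g = 1` ensures.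

Irreducibility on `P` is an argument with supports of Fourier transforms. Let `V` be closed and
invariant, `f ∈ V` and `h ⊥ V`. Then `h` is orthogonal to every `x ↦ f(T x + c)`, where `T x = a⁻¹ x
d`. Letting `c` vary and using Plancherel, the product of the transform of `f` at `S_a y` and the
conjugate transform of `h` at `y` vanishes almost everywhere, `S_a` being dual to `T` for the trace
pairing (`exists_fourier_of_pairing`). The invertible elements of the matrix space form a single
conull orbit of the maps `S_a`, so by Fubini one of the two supports is null
(`ae_notMem_or_ae_notMem`), and `f = 0` or `h = 0`. The single orbit is the point where signatures
of Hermitian or real symmetric forms would interfere. It is proved by normal forms: `1` for complex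
symmetric, `(0 1; -1 0)` for skew-symmetric, and the scalar matrix `i` for quaternionic
anti-Hermitian matrices.

The cases are tied together by `IsAdmissible`, which collects the algebra that the analysis needs.
-/

set_option linter.unusedSectionVars false

namespace SteinSahi

/-! ### Diagonalization by elementary operations, and characters -/

section Elimination

variable {K : Type} [DivisionRing K] {ι : Type} [DecidableEq ι]

/-- The square matrix whose only non-zero row is the `i`-th row `r`. -/
def rowMatrix (i : ι) (r : ι → K) : Matrix ι ι K := Matrix.of fun k j => if k = i then r j else 0

/-- The square matrix whose only non-zero column is the `i`-th column `c`. -/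
def colMatrix (i : ι) (c : ι → K) : Matrix ι ι K := Matrix.of fun k j => if j = i then c k else 0

lemma rowMatrix_apply (i : ι) (r : ι → K) (k j : ι) :
    rowMatrix i r k j = if k = i then r j else 0 := rfl

lemma colMatrix_apply (i : ι) (c : ι → K) (k j : ι) :
    colMatrix i c k j = if j = i then c k else 0 := rfl

variable [Fintype ι]

lemma mul_one_add_rowMatrix_apply (a : Matrix ι ι K) (i : ι) (r : ι → K) (k j : ι) :
    (a * (1 + rowMatrix i r)) k j = a k j + a k i * r j := by
  rw [mul_add, mul_one, Matrix.add_apply, Matrix.mul_apply]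
  simp [rowMatrix_apply]

lemma one_add_colMatrix_mul_apply (a : Matrix ι ι K) (i : ι) (c : ι → K) (k j : ι) :
    ((1 + colMatrix i c) * a) k j = a k j + c k * a i j := by
  rw [add_mul, one_mul, Matrix.add_apply, Matrix.mul_apply]
  simp [colMatrix_apply]

lemma rowMatrix_mul_self (i : ι) (r : ι → K) (hr : r i = 0) :
    rowMatrix i r * rowMatrix i r = 0 := by
  ext k j
  simp [Matrix.mul_apply, rowMatrix_apply, hr]

lemma colMatrix_mul_self (i : ι) (c : ι → K) (hc : c i = 0) :
    colMatrix i c * colMatrix i c = 0 := by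
  ext k j
  simp [Matrix.mul_apply, colMatrix_apply, hc]

lemma isUnit_one_add_of_mul_self {R : Type*} [Ring R] {z : R} (hz : z * z = 0) :
    IsUnit (1 + z) :=
  ⟨⟨1 + z, 1 - z, by noncomm_ring; simp [hz], by noncomm_ring; simp [hz]⟩, rfl⟩

/-- The submonoid `T` of square matrices contains the elementary matrices. -/
def ContainsElementary (T : Submonoid (Matrix ι ι K)) : Prop :=
  ∀ (i : ι) (r : ι → K), r i = 0 → 1 + rowMatrix i r ∈ T ∧ 1 + colMatrix i r ∈ T

/-- A pivot is created without permutations: a nonzero entry of row or column `i` is moved to the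
diagonal by adding its column to column `i`, or its row to row `i`. Only elementary matrices are
allowed because every character is `1` on them. Its index lies outside `D`, so the rows and columns
already cleared are undisturbed. -/
lemma exists_mul_mul_apply_self_ne_zero {T : Submonoid (Matrix ι ι K)} (hT : ContainsElementary T)
    {a : Matrix ι ι K} {D : Finset ι} (ha : ∀ k ∈ D, ∀ j, j ≠ k → a k j = 0 ∧ a j k = 0)
    {i : ι} (hi : i ∉ D) :
    ∃ s ∈ T, ∃ t ∈ T, (∀ k ∈ D, ∀ j, j ≠ k → (s * a * t) k j = 0 ∧ (s * a * t) j k = 0) ∧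
      ((s * a * t) i i ≠ 0 ∨ ∀ j, j ≠ i → (s * a * t) i j = 0 ∧ (s * a * t) j i = 0) := by
  by_cases h0 : a i i = 0
  · by_cases h1 : ∃ j, a i j ≠ 0
    · obtain ⟨j, hj⟩ := h1
      have hji : j ≠ i := by rintro rfl; exact hj h0
      have hjD : j ∉ D := fun h => hj (ha j h i hji.symm).2
      refine ⟨1, T.one_mem, 1 + rowMatrix j (Pi.single i 1), (hT j _ (by simp [hji])).1, ?_, ?_⟩
      · intro k hk l hl
        have hki : k ≠ i := by rintro rfl; exact hi hk
        have hkj : k ≠ j := by rintro rfl; exact hjD hk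
        rw [one_mul]
        simp [mul_one_add_rowMatrix_apply, ha k hk l hl, ha k hk j hkj.symm, hki]
      · left
        rw [one_mul]
        simpa [mul_one_add_rowMatrix_apply, h0] using hj
    · by_cases h2 : ∃ j, a j i ≠ 0
      · obtain ⟨j, hj⟩ := h2
        have hji : j ≠ i := by rintro rfl; exact hj h0
        have hjD : j ∉ D := fun h => hj (ha j h i hji.symm).1
        refine ⟨1 + colMatrix j (Pi.single i 1), (hT j _ (by simp [hji])).2, 1, T.one_mem, ?_, ?_⟩
        · intro k hk l hl
          have hki : k ≠ i := by rintro rfl; exact hi hk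
          have hkj : k ≠ j := by rintro rfl; exact hjD hk
          rw [mul_one]
          simp [one_add_colMatrix_mul_apply, ha k hk l hl, ha k hk j hkj.symm, hki]
        · left
          rw [mul_one]
          simpa [one_add_colMatrix_mul_apply, h0] using hj
      · push Not at h1 h2
        exact ⟨1, T.one_mem, 1, T.one_mem, by simpa using ha, Or.inr fun j _ => by simp [h1, h2]⟩
  · exact ⟨1, T.one_mem, 1, T.one_mem, by simpa using ha, Or.inl (by simpa using h0)⟩

lemma exists_mul_mul_cleared {T : Submonoid (Matrix ι ι K)} (hT : ContainsElementary T)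
    {a : Matrix ι ι K} {D : Finset ι} (ha : ∀ k ∈ D, ∀ j, j ≠ k → a k j = 0 ∧ a j k = 0)
    {i : ι} (hi : i ∉ D) (h0 : a i i ≠ 0) :
    ∃ s ∈ T, ∃ t ∈ T, ∀ k ∈ insert i D, ∀ j, j ≠ k →
      (s * a * t) k j = 0 ∧ (s * a * t) j k = 0 := by
  set r : ι → K := fun j => if j = i then 0 else -((a i i)⁻¹ * a i j) with hr
  set c : ι → K := fun j => if j = i then 0 else -(a j i * (a i i)⁻¹) with hc
  have hri : r i = 0 := by simp [hr]
  have hci : c i = 0 := by simp [hc]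
  refine ⟨1 + colMatrix i c, (hT i c hci).2, 1 + rowMatrix i r, (hT i r hri).1, ?_⟩
  intro k hk j hj
  simp only [mul_one_add_rowMatrix_apply, one_add_colMatrix_mul_apply]
  rcases Finset.mem_insert.mp hk with rfl | hk
  · simp only [hci, zero_mul, add_zero]
    constructor
    · simp [hr, hj, h0]
    · simp [hc, hj, h0, hri]
  · have hki : k ≠ i := fun h => hi (h ▸ hk)
    have h1 := ha k hk j hj
    have h2 := ha k hk i hki.symm
    have hrk : r k = 0 := by simp [hr, h2]
    have hck : c k = 0 := by simp [hc, h2]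
    simp [h1, h2, hrk, hck]

/-- Every square matrix over a division ring becomes diagonal by elementary operations. -/
theorem exists_mul_mul_eq_diagonal {T : Submonoid (Matrix ι ι K)} (hT : ContainsElementary T)
    (a : Matrix ι ι K) : ∃ s ∈ T, ∃ t ∈ T, ∃ δ : ι → K, s * a * t = diagonal δ := by
  suffices h : ∀ D : Finset ι, ∃ s ∈ T, ∃ t ∈ T, ∀ k ∈ D, ∀ j, j ≠ k →
      (s * a * t) k j = 0 ∧ (s * a * t) j k = 0 by
    obtain ⟨s, hs, t, ht, h⟩ := h Finset.univ
    refine ⟨s, hs, t, ht, fun i => (s * a * t) i i, ?_⟩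
    ext i j
    by_cases hij : i = j
    · subst hij; simp
    · rw [diagonal_apply_ne _ hij]
      exact (h i (Finset.mem_univ i) j (Ne.symm hij)).1
  intro D
  induction D using Finset.induction_on with
  | empty => exact ⟨1, T.one_mem, 1, T.one_mem, by simp⟩
  | insert i D hi ih =>
    obtain ⟨s, hs, t, ht, h⟩ := ih
    obtain ⟨s₁, hs₁, t₁, ht₁, h₁, h₂⟩ := exists_mul_mul_apply_self_ne_zero hT h hi
    have e₁ : s₁ * (s * a * t) * t₁ = (s₁ * s) * a * (t * t₁) := by simp only [Matrix.mul_assoc]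
    by_cases h₀ : (s₁ * (s * a * t) * t₁) i i = 0
    · refine ⟨s₁ * s, T.mul_mem hs₁ hs, t * t₁, T.mul_mem ht ht₁, ?_⟩
      rw [← e₁]
      intro k hk
      rcases Finset.mem_insert.mp hk with rfl | hk
      · exact h₂.resolve_left (not_not.mpr h₀)
      · exact h₁ k hk
    · obtain ⟨s₂, hs₂, t₂, ht₂, h₃⟩ := exists_mul_mul_cleared hT h₁ hi h₀
      refine ⟨s₂ * (s₁ * s), T.mul_mem hs₂ (T.mul_mem hs₁ hs), t * t₁ * t₂,
        T.mul_mem (T.mul_mem ht ht₁) ht₂, ?_⟩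
      have e₂ : s₂ * (s₁ * s) * a * (t * t₁ * t₂) = s₂ * (s₁ * (s * a * t) * t₁) * t₂ := by
        simp only [Matrix.mul_assoc]
      rw [e₂]
      exact h₃

lemma containsElementary_isUnit :
    ContainsElementary (IsUnit.submonoid (Matrix ι ι K)) := fun i r hr =>
  ⟨isUnit_one_add_of_mul_self (rowMatrix_mul_self i r hr),
    isUnit_one_add_of_mul_self (colMatrix_mul_self i r hr)⟩

/-- The coordinate projection of rank `#D`, for a finite set `D` of indices. -/
def coordProj (K : Type) [DivisionRing K] (D : Finset ι) : Matrix ι ι K :=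
  diagonal fun i => if i ∈ D then 1 else 0

lemma isUnit_diagonal {δ : ι → K} (h : ∀ i, δ i ≠ 0) : IsUnit (diagonal δ) :=
  ⟨⟨diagonal δ, diagonal fun i => (δ i)⁻¹, by simp [h], by simp [h]⟩, rfl⟩

lemma ne_zero_of_isUnit_diagonal {δ : ι → K} (h : IsUnit (diagonal δ)) (i : ι) : δ i ≠ 0 := by
  obtain ⟨u, hu⟩ := h
  intro h0
  have := congrFun (congrFun (u.mul_inv) i) i
  rw [hu, diagonal_mul, h0] at this
  simp at this

/-- The rank normal form of a square matrix over a division ring. -/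
theorem exists_units_mul_mul_eq_coordProj (a : Matrix ι ι K) :
    ∃ (l m : (Matrix ι ι K)ˣ) (D : Finset ι), (l : Matrix ι ι K) * a * m = coordProj K D := by
  classical
  obtain ⟨s, hs, t, ⟨m, rfl⟩, δ, h⟩ := exists_mul_mul_eq_diagonal containsElementary_isUnit a
  have hd : IsUnit (diagonal fun i => if δ i = 0 then (1 : K) else (δ i)⁻¹) :=
    isUnit_diagonal fun i => by split_ifs <;> simp_all
  obtain ⟨l, hl⟩ := hd.mul hs
  refine ⟨l, m, Finset.univ.filter fun i => δ i ≠ 0, ?_⟩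
  rw [hl, Matrix.mul_assoc, Matrix.mul_assoc, ← Matrix.mul_assoc s, h, coordProj,
    diagonal_mul_diagonal]
  congr 1
  ext i
  by_cases hi : δ i = 0 <;> simp [hi]

end Elimination

/-! ### Multiplicative functions on matrices over ℝ, ℂ and ℍ. -/

section Characters

variable {K : Type} [NormedDivisionRing K] {ι : Type} [Fintype ι] [DecidableEq ι]

lemma character_ne_zero (χ : Matrix ι ι K →* ℝ) {a : Matrix ι ι K} (ha : IsUnit a) : χ a ≠ 0 :=
  (ha.map χ).ne_zero

variable [NormedAlgebra ℝ K]

/-- For a row matrix `R` with `R² = 0`, conjugation by the diagonal matrix `d` with entry `2` at `i`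
turns `1 + R` into `1 + 2R = (1 + R)²`. So the value of `χ` is nonzero and equal to its square.
Columns are treated with `d⁻¹`. -/
lemma character_elementary (χ : Matrix ι ι K →* ℝ) (i : ι) (r : ι → K) (hr : r i = 0) :
    χ (1 + rowMatrix i r) = 1 ∧ χ (1 + colMatrix i r) = 1 := by
  have h20 : (2 : K) ≠ 0 := by
    have := (algebraMap ℝ K).injective.ne (two_ne_zero (α := ℝ))
    rwa [map_ofNat, map_zero] at this
  set d : Matrix ι ι K := diagonal (Function.update 1 i 2) with hd
  have hdu : χ d ≠ 0 := character_ne_zero χ (isUnit_diagonal fun j => by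
    by_cases h : j = i <;> simp [h, h20])
  have h1 := character_ne_zero χ (isUnit_one_add_of_mul_self (rowMatrix_mul_self i r hr))
  have h2 := character_ne_zero χ (isUnit_one_add_of_mul_self (colMatrix_mul_self i r hr))
  have e1 : d * (1 + rowMatrix i r) = (1 + rowMatrix i r) * (1 + rowMatrix i r) * d := by
    have : (1 + rowMatrix i r) * (1 + rowMatrix i r) = 1 + (rowMatrix i r + rowMatrix i r) := by
      rw [mul_add, add_mul, add_mul, rowMatrix_mul_self i r hr]; simp [add_assoc]
    rw [this, mul_add, add_mul, mul_one, one_mul]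
    congr 1
    ext k j
    rw [hd, diagonal_mul, mul_diagonal]
    by_cases hk : k = i
    · by_cases hj : j = i
      · subst hk; subst hj; simp [rowMatrix_apply, hr]
      · subst hk; simp [rowMatrix_apply, hj, two_mul]
    · simp [rowMatrix_apply, hk]
  have e2 : (1 + colMatrix i r) * d = d * ((1 + colMatrix i r) * (1 + colMatrix i r)) := by
    have : (1 + colMatrix i r) * (1 + colMatrix i r) = 1 + (colMatrix i r + colMatrix i r) := by
      rw [mul_add, add_mul, add_mul, colMatrix_mul_self i r hr]; simp [add_assoc]
    rw [this, mul_add, add_mul, mul_one, one_mul]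
    congr 1
    ext k j
    rw [hd, diagonal_mul, mul_diagonal]
    by_cases hj : j = i
    · by_cases hk : k = i
      · subst hk; subst hj; simp [colMatrix_apply, hr]
      · subst hj; simp [colMatrix_apply, hk, mul_two]
    · simp [colMatrix_apply, hj]
  have f1 := congrArg χ e1
  have f2 := congrArg χ e2
  simp only [map_mul] at f1 f2
  constructor
  · have : χ d * χ (1 + rowMatrix i r) * (χ (1 + rowMatrix i r) - 1) = 0 := by
      linear_combination -f1
    rcases mul_eq_zero.mp this with h | h
    · exact absurd h (mul_ne_zero hdu h1)
    · linarith
  · have : χ d * χ (1 + colMatrix i r) * (χ (1 + colMatrix i r) - 1) = 0 := by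
      linear_combination -f2
    rcases mul_eq_zero.mp this with h | h
    · exact absurd h (mul_ne_zero hdu h2)
    · linarith

/-- Diagonal matrices with entries of norm one form a compact set closed under powers and inverses.
A value above `1` would have unbounded powers, so the values at `k` and at `k⁻¹` are at most `1`,
and their product is `1`. -/
lemma character_diagonal_of_norm_eq_one [FiniteDimensional ℝ K] (χ : Matrix ι ι K →* ℝ)
    (hχ : Continuous χ) (hnn : ∀ a, 0 ≤ χ a) {k : ι → K} (hk : ∀ i, ‖k i‖ = 1) :
    χ (diagonal k) = 1 := by
  have : ProperSpace K := FiniteDimensional.proper ℝ K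
  have hS : IsCompact (Set.univ.pi fun _ : ι => Metric.sphere (0 : K) 1) :=
    isCompact_univ_pi fun _ => isCompact_sphere 0 1
  have hc : Continuous fun k : ι → K => χ (diagonal k) :=
    hχ.comp continuous_id.matrix_diagonal
  obtain ⟨C, hC⟩ := hS.bddAbove_image hc.continuousOn
  have key : ∀ k : ι → K, (∀ i, ‖k i‖ = 1) → χ (diagonal k) ≤ 1 := by
    intro k hk
    by_contra! h
    obtain ⟨n, hn⟩ := ((tendsto_pow_atTop_atTop_of_one_lt h).eventually (eventually_gt_atTop C)).exists
    have : χ (diagonal (k ^ n)) ≤ C := hC ⟨k ^ n, by simp [hk], rfl⟩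
    rw [← diagonal_pow, map_pow] at this
    linarith
  have h0 : ∀ i, k i ≠ 0 := fun i => norm_ne_zero_iff.mp (by rw [hk i]; exact one_ne_zero)
  have h1 := key k hk
  have h2 := key (fun i => (k i)⁻¹) (by simp [hk])
  have h3 : χ (diagonal k) * χ (diagonal fun i => (k i)⁻¹) = 1 := by
    rw [← map_mul, diagonal_mul_diagonal]
    simp [h0]
  have h4 := hnn (diagonal k)
  nlinarith [hnn (diagonal fun i => (k i)⁻¹)]

/-- The restriction of a character to real diagonal matrices. -/
noncomputable def realDiagonalCharacter (χ : Matrix ι ι K →* ℝ) : (ι → ℝ) →* ℝ :=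
  χ.comp (((Matrix.diagonalRingHom ι K).comp
    (RingHom.pi fun i => (algebraMap ℝ K).comp (Pi.evalRingHom _ i))).toMonoidHom)

lemma realDiagonalCharacter_apply (χ : Matrix ι ι K →* ℝ) (r : ι → ℝ) :
    realDiagonalCharacter χ r = χ (diagonal fun i => algebraMap ℝ K (r i)) := rfl

/-- Conjugation by the matrix of a transposition permutes the diagonal entries. -/
lemma realDiagonalCharacter_mulSingle (χ : Matrix ι ι K →* ℝ) (i j : ι) (s : ℝ) :
    realDiagonalCharacter χ (Pi.mulSingle i s) = realDiagonalCharacter χ (Pi.mulSingle j s) := by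
  set p : Matrix ι ι K := (1 : Matrix ι ι K).submatrix (Equiv.swap i j) id with hp
  have hpp : p * p = 1 := by
    ext k l
    rw [hp, Matrix.mul_apply, Finset.sum_eq_single (Equiv.swap i j k)]
    · simp [Matrix.one_apply]
    · intro m _ hm
      simp [Matrix.one_apply, Ne.symm hm]
    · simp
  have hpu : χ p ≠ 0 := character_ne_zero χ ⟨⟨p, p, hpp, hpp⟩, rfl⟩
  have e : p * diagonal (fun k => algebraMap ℝ K (Pi.mulSingle (M := fun _ => ℝ) i s k)) =
      diagonal (fun k => algebraMap ℝ K (Pi.mulSingle (M := fun _ => ℝ) j s k)) * p := by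
    ext k l
    rw [mul_diagonal, diagonal_mul]
    simp only [hp, submatrix_apply, id, Matrix.one_apply]
    by_cases h : Equiv.swap i j k = l
    · subst h
      have : (Pi.mulSingle (M := fun _ => ℝ) i s (Equiv.swap i j k)) =
          Pi.mulSingle (M := fun _ => ℝ) j s k := by
        simp only [Pi.mulSingle_apply, Equiv.swap_apply_eq_iff, Equiv.swap_apply_left]
      simp [this]
    · simp [h]
  have := congrArg χ e
  rw [map_mul, map_mul, mul_comm] at this
  exact mul_right_cancel₀ hpu this

/-- Two non-negative continuous multiplicative functions of a matrix over `ℝ`, `ℂ` or `ℍ` that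
agree on positive scalars agree on all invertible matrices. -/
theorem character_eq_of_eq_on_scalars [FiniteDimensional ℝ K] (χ₁ χ₂ : Matrix ι ι K →* ℝ)
    (h₁ : Continuous χ₁) (h₂ : Continuous χ₂) (n₁ : ∀ a, 0 ≤ χ₁ a) (n₂ : ∀ a, 0 ≤ χ₂ a)
    (h : ∀ r : ℝ, 0 < r → χ₁ (r • 1) = χ₂ (r • 1)) {a : Matrix ι ι K} (ha : IsUnit a) :
    χ₁ a = χ₂ a := by
  -- Diagonalizing inside the units on which both characters are `1` leaves both values unchanged.
  -- Norm-one factors of the diagonal then drop out as well.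
  set T : Submonoid (Matrix ι ι K) :=
    IsUnit.submonoid _ ⊓ (MonoidHom.mker χ₁ ⊓ MonoidHom.mker χ₂) with hT
  have hTE : ContainsElementary T := fun i r hr =>
    ⟨⟨(containsElementary_isUnit i r hr).1, (character_elementary χ₁ i r hr).1,
      (character_elementary χ₂ i r hr).1⟩,
     ⟨(containsElementary_isUnit i r hr).2, (character_elementary χ₁ i r hr).2,
      (character_elementary χ₂ i r hr).2⟩⟩
  obtain ⟨s, ⟨hs, hs₁, hs₂⟩, t, ⟨ht, ht₁, ht₂⟩, δ, hd⟩ := exists_mul_mul_eq_diagonal hTE a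
  have hδ := ne_zero_of_isUnit_diagonal (hd ▸ (hs.mul ha).mul ht)
  have red : ∀ χ : Matrix ι ι K →* ℝ, Continuous χ → (∀ a, 0 ≤ χ a) → χ s = 1 → χ t = 1 →
      χ a = ∏ i, realDiagonalCharacter χ (Pi.mulSingle i ‖δ i‖) := by
    intro χ hc hn hs ht
    have e : diagonal δ = diagonal (fun i => algebraMap ℝ K ‖δ i‖) *
        diagonal (fun i => (algebraMap ℝ K ‖δ i‖)⁻¹ * δ i) := by
      rw [diagonal_mul_diagonal]
      congr 1
      ext i
      rw [mul_inv_cancel_left₀]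
      simpa using hδ i
    have := congrArg χ hd
    rw [map_mul, map_mul, hs, ht, one_mul, mul_one, e, map_mul,
      character_diagonal_of_norm_eq_one χ hc hn (k := fun i => _ * δ i), mul_one] at this
    · rw [this, ← map_prod, Finset.univ_prod_mulSingle, realDiagonalCharacter_apply]
    · intro i
      have : ‖δ i‖ ≠ 0 := norm_ne_zero_iff.mpr (hδ i)
      simp [norm_algebraMap', this]
  rw [red χ₁ h₁ n₁ hs₁ ht₁, red χ₂ h₂ n₂ hs₂ ht₂]
  refine Finset.prod_congr rfl fun i _ => ?_
  -- All diagonal positions contribute equally, so a scalar matrix gives the `card ι`-th power of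
  -- one contribution. Non-negativity allows the root to be taken.
  have scal : ∀ χ : Matrix ι ι K →* ℝ, χ (‖δ i‖ • 1) =
      realDiagonalCharacter χ (Pi.mulSingle i ‖δ i‖) ^ Fintype.card ι := by
    intro χ
    have e : (‖δ i‖ • 1 : Matrix ι ι K) = diagonal fun _ => algebraMap ℝ K ‖δ i‖ := by
      ext k l
      by_cases hkl : k = l
      · subst hkl; simp [Algebra.algebraMap_eq_smul_one]
      · simp [hkl]
    rw [e, ← realDiagonalCharacter_apply χ (fun _ => ‖δ i‖),
      ← Finset.univ_prod_mulSingle (fun _ : ι => ‖δ i‖),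
      map_prod, Finset.prod_congr rfl fun j _ => realDiagonalCharacter_mulSingle χ j i _]
    simp
  have := h ‖δ i‖ (norm_pos_iff.mpr (hδ i))
  rw [scal, scal] at this
  have hι : Nonempty ι := ⟨i⟩
  exact (pow_left_inj₀ (by exact n₁ _) (by exact n₂ _) Fintype.card_ne_zero).mp this

end Characters

/-! ### The modulus of the determinant -/

section AbsDet

variable {K : Type} [DivisionRing K] [Algebra ℝ K] [FiniteDimensional ℝ K]
  {ι ι' : Type} [Fintype ι] [DecidableEq ι] [Fintype ι'] [DecidableEq ι']

/-- The real matrix of the operator `v ↦ a v`. -/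
noncomputable def realify (a : Matrix ι ι' K) :
    Matrix (ι × Fin (Module.finrank ℝ K)) (ι' × Fin (Module.finrank ℝ K)) ℝ :=
  Matrix.of fun p q => Algebra.leftMulMatrix (Module.finBasis ℝ K) (a p.1 q.1) p.2 q.2

lemma det_mulVecReal (a : Matrix ι ι K) : LinearMap.det (mulVecReal a) = (realify a).det := by
  rw [← LinearMap.det_toMatrix ((Pi.basis fun _ : ι => Module.finBasis ℝ K).reindex
    (Equiv.sigmaEquivProd ι (Fin (Module.finrank ℝ K))))]
  congr 1
  ext ⟨i, k⟩ ⟨j, l⟩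
  rw [LinearMap.toMatrix_apply]
  simp [realify, Algebra.leftMulMatrix_eq_repr_mul, mulVecReal, Pi.basis_repr]

lemma det_mulVecReal_mul (a b : Matrix ι ι K) : LinearMap.det (mulVecReal (a * b)) =
    LinearMap.det (mulVecReal a) * LinearMap.det (mulVecReal b) := by
  rw [← LinearMap.det_comp]
  congr 1
  refine LinearMap.ext fun v => ?_
  simp [mulVecReal]

lemma mulVecReal_one : mulVecReal (1 : Matrix ι ι K) = LinearMap.id := by
  ext v
  simp [mulVecReal]

lemma det_mulVecReal_ne_zero_iff (a : Matrix ι ι K) :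
    LinearMap.det (mulVecReal a) ≠ 0 ↔ IsUnit a := by
  constructor
  · intro h
    have hs : Function.Surjective a.mulVec :=
      (LinearMap.equivOfDetNeZero (mulVecReal a) h).surjective
    obtain ⟨b, hb⟩ := mulVec_surjective_iff_exists_right_inverse.mp hs
    exact ⟨⟨a, b, hb, mul_eq_one_comm.mp hb⟩, rfl⟩
  · rintro ⟨u, rfl⟩ h
    have := det_mulVecReal_mul (u : Matrix ι ι K) ↑u⁻¹
    rw [h, zero_mul, u.mul_inv, mulVecReal_one, LinearMap.det_id] at this
    exact one_ne_zero this

lemma absDet_nonneg (a : Matrix ι ι K) : 0 ≤ absDet a := Real.rpow_nonneg (abs_nonneg _) _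

lemma absDet_one : absDet (1 : Matrix ι ι K) = 1 := by
  simp [absDet, mulVecReal_one]

lemma absDet_mul (a b : Matrix ι ι K) : absDet (a * b) = absDet a * absDet b := by
  simp only [absDet]
  rw [det_mulVecReal_mul, abs_mul, Real.mul_rpow (abs_nonneg _) (abs_nonneg _)]

/-- The modulus of the determinant as a multiplicative map. -/
noncomputable def absDetHom : Matrix ι ι K →* ℝ where
  toFun := absDet
  map_one' := absDet_one
  map_mul' := absDet_mul

lemma absDet_pos {a : Matrix ι ι K} (ha : IsUnit a) : 0 < absDet a :=
  Real.rpow_pos_of_pos (abs_pos.mpr ((det_mulVecReal_ne_zero_iff a).mpr ha)) _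

lemma absDet_inv (u : (Matrix ι ι K)ˣ) :
    absDet (↑u⁻¹ : Matrix ι ι K) = (absDet (u : Matrix ι ι K))⁻¹ := by
  apply eq_inv_of_mul_eq_one_left
  rw [← absDet_mul, u.inv_mul, absDet_one]

lemma absDet_smul_one (r : ℝ) :
    absDet (r • (1 : Matrix ι ι K)) = |r| ^ Fintype.card ι := by
  have hK : (Module.finrank ℝ K) ≠ 0 := Module.finrank_pos.ne'
  have : mulVecReal (r • (1 : Matrix ι ι K)) = r • LinearMap.id := by
    refine LinearMap.ext fun v => ?_
    simp [mulVecReal, Matrix.smul_mulVec]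
  rw [absDet, this, LinearMap.det_smul, LinearMap.det_id, mul_one, abs_pow,
    Module.finrank_pi_fintype]
  simp only [Finset.sum_const, Finset.card_univ, smul_eq_mul]
  rw [pow_mul, Real.pow_rpow_inv_natCast (by positivity) hK]

lemma det_mulVecReal_fromBlocks_zero₂₁ (a : Matrix ι ι K) (b : Matrix ι ι' K)
    (d : Matrix ι' ι' K) : LinearMap.det (mulVecReal (fromBlocks a b 0 d)) =
      LinearMap.det (mulVecReal a) * LinearMap.det (mulVecReal d) := by
  simp only [det_mulVecReal]
  rw [← det_fromBlocks_zero₂₁ (realify a) (realify b),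
    ← det_submatrix_equiv_self (Equiv.sumProdDistrib ι ι' _)]
  congr 1
  ext ⟨i | i, k⟩ ⟨j | j, l⟩ <;> simp [realify]

lemma det_mulVecReal_fromBlocks_zero₁₂ (a : Matrix ι ι K) (c : Matrix ι' ι K)
    (d : Matrix ι' ι' K) : LinearMap.det (mulVecReal (fromBlocks a 0 c d)) =
      LinearMap.det (mulVecReal a) * LinearMap.det (mulVecReal d) := by
  simp only [det_mulVecReal]
  rw [← det_fromBlocks_zero₁₂ (realify a) (realify c),
    ← det_submatrix_equiv_self (Equiv.sumProdDistrib ι ι' _)]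
  congr 1
  ext ⟨i | i, k⟩ ⟨j | j, l⟩ <;> simp [realify]

lemma absDet_fromBlocks_zero₂₁ (a : Matrix ι ι K) (b : Matrix ι ι' K) (d : Matrix ι' ι' K) :
    absDet (fromBlocks a b 0 d) = absDet a * absDet d := by
  simp only [absDet]
  rw [det_mulVecReal_fromBlocks_zero₂₁, abs_mul, Real.mul_rpow (abs_nonneg _) (abs_nonneg _)]

lemma absDet_fromBlocks_zero₁₂ (a : Matrix ι ι K) (c : Matrix ι' ι K) (d : Matrix ι' ι' K) :
    absDet (fromBlocks a 0 c d) = absDet a * absDet d := by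
  simp only [absDet]
  rw [det_mulVecReal_fromBlocks_zero₁₂, abs_mul, Real.mul_rpow (abs_nonneg _) (abs_nonneg _)]

lemma realify_add_smul (a b : Matrix ι ι K) (t : ℝ) :
    realify (a + t • b) = realify a + t • realify b := by
  ext p q
  simp [realify]

-- The real determinant of `a + t b` is a polynomial in `t`, nonzero at `t = 0`.
open Polynomial in
lemma finite_setOf_not_isUnit_add_smul {a : Matrix ι ι K} (ha : IsUnit a) (b : Matrix ι ι K) :
    {t : ℝ | ¬ IsUnit (a + t • b)}.Finite := by
  set p : ℝ[X] := ((realify a).map C + (realify b).map fun r => C r * X).det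
  have hp : ∀ t : ℝ, p.eval t = LinearMap.det (mulVecReal (a + t • b)) := by
    intro t
    rw [det_mulVecReal, realify_add_smul, ← Polynomial.coe_evalRingHom, RingHom.map_det]
    congr 1
    ext i j
    simp only [RingHom.mapMatrix_apply, Matrix.map_apply, Matrix.add_apply, Matrix.smul_apply,
      Polynomial.coe_evalRingHom, eval_add, eval_mul, eval_C, eval_X, smul_eq_mul, mul_comm]
  have hp0 : p ≠ 0 := by
    intro h
    have := hp 0
    rw [h, eval_zero, zero_smul, add_zero] at this
    exact (det_mulVecReal_ne_zero_iff a).mpr ha this.symm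
  refine (p.roots.toFinset.finite_toSet).subset fun t ht => ?_
  have : LinearMap.det (mulVecReal (a + t • b)) = 0 := by
    by_contra h
    exact ht ((det_mulVecReal_ne_zero_iff _).mp h)
  simpa [hp0, hp t] using this

end AbsDet

/-! ### Continuity of the determinant and the inverse, and generic invertibility. -/

section Topology

variable {K : Type} [NormedDivisionRing K] [NormedAlgebra ℝ K] [FiniteDimensional ℝ K]
  {ι : Type} [Fintype ι] [DecidableEq ι]

lemma continuous_det_mulVecReal :
    Continuous fun a : Matrix ι ι K => LinearMap.det (mulVecReal a) := by
  simp only [det_mulVecReal]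
  refine Continuous.matrix_det (continuous_matrix fun p q => ?_)
  set f : K →ₗ[ℝ] ℝ :=
    { toFun := fun x => Algebra.leftMulMatrix (Module.finBasis ℝ K) x p.2 q.2
      map_add' := by simp
      map_smul' := by simp }
  exact f.continuous_of_finiteDimensional.comp (continuous_id.matrix_elem p.1 q.1)

lemma continuous_absDet : Continuous fun a : Matrix ι ι K => absDet a :=
  continuous_det_mulVecReal.abs.rpow_const fun _ => Or.inr (by positivity)

lemma isOpen_setOf_isUnit : IsOpen {a : Matrix ι ι K | IsUnit a} := by
  simp only [← det_mulVecReal_ne_zero_iff]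
  exact isOpen_ne_fun continuous_det_mulVecReal continuous_const

lemma isOpenEmbedding_unitsVal :
    Topology.IsOpenEmbedding (Units.val : (Matrix ι ι K)ˣ → Matrix ι ι K) := by
  let _ : NormedRing (Matrix ι ι K) := Matrix.linftyOpNormedRing
  let _ : NormedAlgebra ℝ (Matrix ι ι K) := Matrix.linftyOpNormedAlgebra
  have : CompleteSpace (Matrix ι ι K) := FiniteDimensional.complete ℝ (Matrix ι ι K)
  exact Units.isOpenEmbedding_val

lemma continuousAt_matrix_ringInverse {a : Matrix ι ι K} (ha : IsUnit a) :
    ContinuousAt (Ring.inverse : Matrix ι ι K → Matrix ι ι K) a := by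
  let _ : NormedRing (Matrix ι ι K) := Matrix.linftyOpNormedRing
  let _ : NormedAlgebra ℝ (Matrix ι ι K) := Matrix.linftyOpNormedAlgebra
  have : CompleteSpace (Matrix ι ι K) := FiniteDimensional.complete ℝ (Matrix ι ι K)
  obtain ⟨u, rfl⟩ := ha
  exact NormedRing.inverse_continuousAt u

variable {E : Type} [NormedAddCommGroup E] [NormedSpace ℝ E] [FiniteDimensional ℝ E]
  [MeasurableSpace E] [BorelSpace E]

/-- An affine map to square matrices with an invertible value has almost all values invertible. -/
theorem ae_isUnit_add (μ : Measure E) [μ.IsAddHaarMeasure] (a : Matrix ι ι K)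
    (f : E →ₗ[ℝ] Matrix ι ι K) {x₀ : E} (h : IsUnit (a + f x₀)) :
    ∀ᵐ x ∂μ, IsUnit (a + f x) := by
  have hfc : Continuous f := f.continuous_of_finiteDimensional
  set b := a + f x₀ with hb
  have hmeas : MeasurableSet {p : E × ℝ | IsUnit (b + f (p.2 • p.1))} :=
    (isOpen_setOf_isUnit.preimage (by fun_prop : Continuous fun p : E × ℝ =>
      b + f (p.2 • p.1))).measurableSet
  -- On each line through the base point only finitely many parameters are bad. Fubini yields one `t
  -- ≠ 0` that is good for almost all `v`, and rescaling by `t` preserves null sets.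
  have h1 : ∀ᵐ v ∂μ, ∀ᵐ t : ℝ, IsUnit (b + f (t • v)) := by
    refine Eventually.of_forall fun v => ?_
    rw [ae_iff]
    simp only [map_smul]
    exact (finite_setOf_not_isUnit_add_smul h (f v)).measure_zero _
  rw [Measure.ae_ae_comm (p := fun v t => IsUnit (b + f (t • v))) hmeas] at h1
  have h2 : ∀ᵐ t : ℝ, t ≠ 0 := by simp [ae_iff]
  obtain ⟨t, ht, ht0⟩ := (h1.and h2).exists
  have h3 : μ {v | ¬ IsUnit (b + f v)} = 0 := by
    have e : {v | ¬ IsUnit (b + f (t • v))} = (fun v => t • v) ⁻¹' {v | ¬ IsUnit (b + f v)} := rfl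
    rw [ae_iff, e, Measure.addHaar_preimage_smul μ ht0, mul_eq_zero] at ht
    refine ht.resolve_left ?_
    have := pow_pos (abs_pos.mpr ht0) (Module.finrank ℝ E)
    simpa using this
  have h4 : ∀ᵐ v ∂μ, IsUnit (b + f v) := h3
  have h5 := (measurePreserving_sub_right μ x₀).quasiMeasurePreserving.ae h4
  filter_upwards [h5] with x hx
  simpa [hb] using hx

end Topology

/-! ### Unitary representations from partially defined actions -/

section PartialAction

open scoped ENNReal Topology

/-- A right action of `G` on `E` by maps `act g` defined on open sets `dom g`, together with a
multiplier `mult` whose square modulus is the Jacobian of the action. Outside of the domain, the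
action and the multiplier have the junk values `x` and `0`. -/
structure PartialAction (G E : Type) [Group G] [NormedAddCommGroup E] [NormedSpace ℝ E] where
  dom : G → Set E
  act : G → E → E
  mult : G → E → ℂ
  isOpen_dom : ∀ g, IsOpen (dom g)
  act_of_notMem : ∀ g, ∀ x ∉ dom g, act g x = x
  mult_of_notMem : ∀ g, ∀ x ∉ dom g, mult g x = 0
  mult_ne_zero : ∀ g, ∀ x ∈ dom g, mult g x ≠ 0
  continuousOn_mult : ∀ g, ContinuousOn (mult g) (dom g)
  exists_hasFDerivAt : ∀ g, ∀ x ∈ dom g, ∃ f' : E →L[ℝ] E, HasFDerivAt (act g) f' x ∧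
    |f'.det| = ‖mult g x‖ ^ 2
  one_dom : dom 1 = Set.univ
  one_act : ∀ x, act 1 x = x
  one_mult : ∀ x, mult 1 x = 1
  inv_dom : ∀ g, ∀ x ∈ dom g, act g x ∈ dom g⁻¹
  mul_dom : ∀ g h, ∀ x ∈ dom g, act g x ∈ dom h → x ∈ dom (g * h)
  mul_act : ∀ g h, ∀ x ∈ dom g, act g x ∈ dom h → act (g * h) x = act h (act g x)
  mul_mult : ∀ g h, ∀ x ∈ dom g, act g x ∈ dom h → mult (g * h) x = mult g x * mult h (act g x)

namespace PartialAction

variable {G E : Type} [Group G] [NormedAddCommGroup E] [NormedSpace ℝ E] (A : PartialAction G E)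

lemma act_inv_act {g : G} {x : E} (hx : x ∈ A.dom g) : A.act g⁻¹ (A.act g x) = x := by
  rw [← A.mul_act g g⁻¹ x hx (A.inv_dom g x hx), mul_inv_cancel, A.one_act]

lemma injOn_act (g : G) : Set.InjOn (A.act g) (A.dom g) := fun x hx y hy h => by
  rw [← A.act_inv_act hx, h, A.act_inv_act hy]

lemma image_act (g : G) : A.act g '' A.dom g = A.dom g⁻¹ := by
  apply Set.Subset.antisymm
  · rintro _ ⟨x, hx, rfl⟩
    exact A.inv_dom g x hx
  · intro y hy
    have h1 := A.inv_dom g⁻¹ y hy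
    have h2 := A.act_inv_act hy
    rw [inv_inv] at h1 h2
    exact ⟨_, h1, h2⟩

/-- The operator `F(x) ↦ mult(g, x) F(x g)`. -/
def op (g : G) (F : E → ℂ) (x : E) : ℂ := A.mult g x * F (A.act g x)

lemma op_add (g : G) (F F' : E → ℂ) : A.op g (F + F') = A.op g F + A.op g F' := by
  ext x
  simp [op, mul_add]

lemma op_smul (g : G) (c : ℂ) (F : E → ℂ) : A.op g (c • F) = c • A.op g F := by
  ext x
  simp [op, mul_left_comm]

lemma op_one (F : E → ℂ) : A.op 1 F = F := by
  ext x
  simp [op, A.one_act, A.one_mult]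

variable [FiniteDimensional ℝ E] [MeasurableSpace E] [BorelSpace E]

lemma measurable_act (g : G) : Measurable (A.act g) := by
  classical
  have h : A.act g = (A.dom g).piecewise (A.act g) id := by
    ext1 x
    by_cases hx : x ∈ A.dom g
    · simp [hx]
    · simp [hx, A.act_of_notMem g x hx]
  rw [h]
  refine ContinuousOn.measurable_piecewise (fun x hx => ?_) continuousOn_id
    (A.isOpen_dom g).measurableSet
  obtain ⟨f', hf', -⟩ := A.exists_hasFDerivAt g x hx
  exact hf'.continuousAt.continuousWithinAt

lemma measurable_mult (g : G) : Measurable (A.mult g) := by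
  classical
  have h : A.mult g = (A.dom g).piecewise (A.mult g) (fun _ => 0) := by
    ext1 x
    by_cases hx : x ∈ A.dom g
    · simp [hx]
    · simp [hx, A.mult_of_notMem g x hx]
  rw [h]
  exact ContinuousOn.measurable_piecewise (A.continuousOn_mult g) continuousOn_const
    (A.isOpen_dom g).measurableSet

variable (μ : Measure E) [μ.IsAddHaarMeasure] (hA : ∀ g, ∀ᵐ x ∂μ, x ∈ A.dom g)

include hA

/-- The Jacobian is the squared modulus of the multiplier, so this is change of variables for the
bijection of `dom g` onto `dom g⁻¹`, two conull sets. -/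
lemma lintegral_act (g : G) (φ : E → ℝ≥0∞) :
    ∫⁻ x, ‖A.mult g x‖ₑ ^ 2 * φ (A.act g x) ∂μ = ∫⁻ x, φ x ∂μ := by
  classical
  choose! f' hf' hd using A.exists_hasFDerivAt g
  have h := lintegral_image_eq_lintegral_abs_det_fderiv_mul μ (A.isOpen_dom g).measurableSet
    (fun x hx => (hf' x hx).hasFDerivWithinAt) (A.injOn_act g) φ
  rw [A.image_act, Measure.restrict_eq_self_of_ae_mem (hA g⁻¹)] at h
  rw [h]
  nth_rewrite 1 [← Measure.restrict_eq_self_of_ae_mem (hA g)]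
  refine setLIntegral_congr_fun (A.isOpen_dom g).measurableSet fun x hx => ?_
  simp only [hd x hx]
  rw [ENNReal.ofReal_pow (norm_nonneg _), ofReal_norm]

lemma quasiMeasurePreserving_act (g : G) : Measure.QuasiMeasurePreserving (A.act g) μ μ := by
  refine ⟨A.measurable_act g, Measure.AbsolutelyContinuous.mk fun s hs h0 => ?_⟩
  rw [Measure.map_apply (A.measurable_act g) hs]
  have h := A.lintegral_act μ hA g (s.indicator 1)
  rw [lintegral_indicator_one hs, h0, lintegral_eq_zero_iff] at h
  · rw [measure_eq_zero_iff_ae_notMem]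
    filter_upwards [h, hA g] with x hx hxd hxs
    have : A.act g x ∈ s := hxs
    have h1 : ‖A.mult g x‖ₑ ≠ 0 := by simpa using A.mult_ne_zero g x hxd
    simp [this, A.mult_ne_zero g x hxd] at hx
  · exact ((A.measurable_mult g).enorm.pow_const 2).mul
      ((measurable_one.indicator hs).comp (A.measurable_act g))

lemma op_congr (g : G) {F F' : E → ℂ} (h : F =ᵐ[μ] F') : A.op g F =ᵐ[μ] A.op g F' := by
  filter_upwards [(A.quasiMeasurePreserving_act μ hA g).ae h] with x hx
  simp [op, hx]

/-- Only almost everywhere: the cocycle identity needs `x ∈ dom g` and `act g x ∈ dom h`. The second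
condition is generic because `act g` pulls null sets back to null sets. -/
lemma op_mul (g h : G) (F : E → ℂ) : A.op (g * h) F =ᵐ[μ] A.op g (A.op h F) := by
  filter_upwards [hA g, (A.quasiMeasurePreserving_act μ hA g).ae (hA h)] with x h1 h2
  simp [op, A.mul_act g h x h1 h2, A.mul_mult g h x h1 h2, mul_assoc]

lemma eLpNorm_op (g : G) (F : E → ℂ) : eLpNorm (A.op g F) 2 μ = eLpNorm F 2 μ := by
  have h2 : (2 : ℝ≥0∞).toReal = 2 := by simp
  rw [eLpNorm_eq_lintegral_rpow_enorm_toReal two_ne_zero ENNReal.ofNat_ne_top,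
    eLpNorm_eq_lintegral_rpow_enorm_toReal two_ne_zero ENNReal.ofNat_ne_top, h2]
  congr 1
  rw [← A.lintegral_act μ hA g fun x => ‖F x‖ₑ ^ (2 : ℝ)]
  refine lintegral_congr fun x => ?_
  rw [op, enorm_mul, ENNReal.mul_rpow_of_nonneg _ _ zero_le_two]
  norm_cast

lemma memLp_op (g : G) {F : E → ℂ} (hF : MemLp F 2 μ) : MemLp (A.op g F) 2 μ := by
  refine ⟨?_, by rw [A.eLpNorm_op μ hA]; exact hF.2⟩
  exact (A.measurable_mult g).aestronglyMeasurable.mul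
    (hF.1.comp_quasiMeasurePreserving (A.quasiMeasurePreserving_act μ hA g))

/-- The operator `F(x) ↦ mult(g, x) F(x g)` on `L²`. -/
noncomputable def opLp (g : G) : Lp ℂ 2 μ →ₗᵢ[ℂ] Lp ℂ 2 μ where
  toFun F := (A.memLp_op μ hA g (Lp.memLp F)).toLp
  map_add' F F' := by
    rw [← MemLp.toLp_add _ _, MemLp.toLp_eq_toLp_iff, ← op_add]
    exact A.op_congr μ hA g (Lp.coeFn_add F F')
  map_smul' c F := by
    rw [RingHom.id_apply, ← MemLp.toLp_const_smul, MemLp.toLp_eq_toLp_iff, ← op_smul]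
    exact A.op_congr μ hA g (Lp.coeFn_smul c F)
  norm_map' F := by
    change ‖MemLp.toLp _ (A.memLp_op μ hA g (Lp.memLp F))‖ = ‖F‖
    rw [Lp.norm_toLp _ (A.memLp_op μ hA g (Lp.memLp F)), A.eLpNorm_op μ hA, Lp.norm_def]

lemma coeFn_opLp (g : G) (F : Lp ℂ 2 μ) : A.opLp μ hA g F =ᵐ[μ] A.op g F :=
  MemLp.coeFn_toLp (A.memLp_op μ hA g (Lp.memLp F))

lemma opLp_one (F : Lp ℂ 2 μ) : A.opLp μ hA 1 F = F := by
  apply Lp.ext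
  filter_upwards [A.coeFn_opLp μ hA 1 F] with x hx
  rw [hx, op_one]

lemma opLp_mul (g h : G) (F : Lp ℂ 2 μ) :
    A.opLp μ hA (g * h) F = A.opLp μ hA g (A.opLp μ hA h F) := by
  apply Lp.ext
  filter_upwards [A.coeFn_opLp μ hA (g * h) F, A.coeFn_opLp μ hA g (A.opLp μ hA h F),
    A.op_mul μ hA g h F, A.op_congr μ hA g (A.coeFn_opLp μ hA h F)] with x h1 h2 h3 h4
  rw [h1, h2, h3, h4]

/-- The unitary representation defined by a partial action and a multiplier. -/
noncomputable def rep : G →* (Lp ℂ 2 μ ≃ₗᵢ[ℂ] Lp ℂ 2 μ) where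
  toFun g :=
    { toLinearEquiv := LinearEquiv.ofLinearMap (A.opLp μ hA g).toLinearMap
        (A.opLp μ hA g⁻¹).toLinearMap
        (by
          ext1 F
          simp only [LinearMap.comp_apply, LinearIsometry.coe_toLinearMap, LinearMap.id_apply]
          rw [← opLp_mul, mul_inv_cancel, opLp_one])
        (by
          ext1 F
          simp only [LinearMap.comp_apply, LinearIsometry.coe_toLinearMap, LinearMap.id_apply]
          rw [← opLp_mul, inv_mul_cancel, opLp_one])
      norm_map' := fun F => (A.opLp μ hA g).norm_map F }
  map_one' := by
    ext1 F
    exact A.opLp_one μ hA F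
  map_mul' g h := by
    ext1 F
    exact A.opLp_mul μ hA g h F

lemma coeFn_rep (g : G) (F : Lp ℂ 2 μ) : A.rep μ hA g F =ᵐ[μ] A.op g F :=
  A.coeFn_opLp μ hA g F

end PartialAction

/-- A homomorphism to the unitary group is strongly continuous if its matrix coefficients on the
diagonal of a dense set are continuous at the identity. -/
lemma isStronglyContinuous_of_dense {Γ : Type} [Group Γ] [TopologicalSpace Γ]
    [IsTopologicalGroup Γ] {H : Type} [NormedAddCommGroup H] [InnerProductSpace ℂ H]
    (π : Γ →* (H ≃ₗᵢ[ℂ] H)) {S : Set H} (hS : Dense S)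
    (h : ∀ v ∈ S, Tendsto (fun g => inner ℂ v (π g v)) (𝓝 1) (𝓝 (inner ℂ v v))) :
    IsStronglyContinuous π := by
  have h1 : ∀ v ∈ S, Tendsto (fun g => π g v) (𝓝 1) (𝓝 v) := by
    intro v hv
    rw [tendsto_iff_norm_sub_tendsto_zero]
    -- By unitarity `‖π(g)v - v‖² = 2‖v‖² - 2 Re ⟨v, π(g)v⟩`, so weak continuity at the identity is
    -- strong continuity there.
    have e : ∀ g, ‖π g v - v‖ = √(2 * RCLike.re (inner ℂ v v) -
        2 * RCLike.re (inner ℂ v (π g v))) := by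
      intro g
      rw [← Real.sqrt_sq (norm_nonneg (π g v - v)), @norm_sub_sq ℂ, (π g).norm_map,
        inner_re_symm, inner_self_eq_norm_sq]
      congr 1
      ring
    simp only [e]
    have h2 := (Complex.continuous_re.tendsto _).comp (h v hv)
    have h3 := ((tendsto_const_nhds (x := 2 * RCLike.re (inner ℂ v v))).sub
      (h2.const_mul 2)).sqrt
    simpa using h3
  have h2 : ∀ v, Tendsto (fun g => π g v) (𝓝 1) (𝓝 v) := by
    intro v
    rw [Metric.tendsto_nhds]
    intro ε hε
    obtain ⟨w, hw, hvw⟩ := Metric.dense_iff.mp hS v (ε / 3) (by positivity)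
    have hvw' : dist v w < ε / 3 := by rw [dist_comm]; exact hw
    filter_upwards [Metric.tendsto_nhds.mp (h1 w hvw) (ε / 3) (by positivity)] with g hg
    calc dist (π g v) v ≤ dist (π g v) (π g w) + dist (π g w) w + dist w v := dist_triangle4 _ _ _ _
      _ < ε / 3 + ε / 3 + ε / 3 := by
        rw [(π g).dist_map]
        rw [dist_comm w v]
        gcongr
      _ = ε := by ring
  intro v
  rw [continuous_iff_continuousAt]
  intro g₀
  have h3 : Tendsto (fun g : Γ => g * g₀⁻¹) (𝓝 g₀) (𝓝 1) := by
    have : ContinuousAt (fun g : Γ => g * g₀⁻¹) g₀ := by fun_prop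
    simpa [ContinuousAt] using this
  have h4 := (h2 (π g₀ v)).comp h3
  refine h4.congr fun g => ?_
  change π (g * g₀⁻¹) (π g₀ v) = π g v
  have : π g = π (g * g₀⁻¹) * π g₀ := by rw [← map_mul]; simp
  rw [this]
  rfl

namespace PartialAction

variable {G E : Type} [Group G] [TopologicalSpace G] [IsTopologicalGroup G]
  [FirstCountableTopology G] [NormedAddCommGroup E] [NormedSpace ℝ E] (A : PartialAction G E)
  [FiniteDimensional ℝ E] [MeasurableSpace E] [BorelSpace E]
  (μ : Measure E) [μ.IsAddHaarMeasure] (hA : ∀ g, ∀ᵐ x ∂μ, x ∈ A.dom g)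

/-- Matrix coefficients of compactly supported continuous functions converge by dominated
convergence. First countability of `G` makes the neighbourhood filter of `1` countably generated, as
that theorem requires. -/
theorem isStronglyContinuous_rep
    (hact : ∀ x, ContinuousAt (fun p : G × E => A.act p.1 p.2) (1, x))
    (hmult : ∀ x, ContinuousAt (fun p : G × E => A.mult p.1 p.2) (1, x)) :
    IsStronglyContinuous (A.rep μ hA) := by
  have : ProperSpace E := FiniteDimensional.proper ℝ E
  refine isStronglyContinuous_of_dense (S := {F | ∃ φ : E → ℂ, HasCompactSupport φ ∧ Continuous φ ∧
    F =ᵐ[μ] φ}) _ ?_ ?_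
  · rw [Metric.dense_iff]
    intro F ε hε
    obtain ⟨φ, hφs, hφε, hφc, hφ⟩ := (Lp.memLp F).exists_hasCompactSupport_eLpNorm_sub_le
      ENNReal.ofNat_ne_top (ε := ENNReal.ofReal (ε / 2)) (by simpa using hε)
    refine ⟨hφ.toLp, ?_, φ, hφs, hφc, hφ.coeFn_toLp⟩
    rw [Metric.mem_ball, dist_comm, Lp.dist_def]
    have e : eLpNorm (⇑F - ⇑hφ.toLp) 2 μ = eLpNorm (⇑F - φ) 2 μ :=
      eLpNorm_congr_ae (EventuallyEq.rfl.sub hφ.coeFn_toLp)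
    rw [e]
    calc _ ≤ (ENNReal.ofReal (ε / 2)).toReal := ENNReal.toReal_mono ENNReal.ofReal_ne_top hφε
      _ = ε / 2 := ENNReal.toReal_ofReal (by positivity)
      _ < ε := by linarith
  · rintro F ⟨φ, hφs, hφc, hF⟩
    obtain ⟨C, hC⟩ := hφc.bounded_above_of_compact_support hφs
    have e : ∀ g, inner ℂ F (A.rep μ hA g F) =
        ∫ x, inner ℂ (φ x) (A.mult g x * φ (A.act g x)) ∂μ := by
      intro g
      rw [L2.inner_def]
      refine integral_congr_ae ?_
      filter_upwards [hF, A.coeFn_rep μ hA g F, A.op_congr μ hA g hF] with x h1 h2 h3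
      rw [h1, h2, h3]
      rfl
    have e1 : inner ℂ F F = ∫ x, inner ℂ (φ x) (1 * φ x) ∂μ := by
      rw [L2.inner_def]
      refine integral_congr_ae ?_
      filter_upwards [hF] with x h1
      rw [h1, one_mul]
    simp only [e, e1]
    -- Joint continuity at the identity and compactness bound the multiplier uniformly on the
    -- support of `φ`. Elsewhere the factor `φ x` kills the integrand.
    have hb : ∀ᶠ g : G in 𝓝 1, ∀ x ∈ tsupport φ, ‖A.mult g x‖ < 2 := by
      refine IsCompact.eventually_forall_of_forall_eventually hφs fun x _ => ?_
      have h1 := (hmult x).norm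
      have h2 : ‖A.mult 1 x‖ < 2 := by rw [A.one_mult]; norm_num
      exact h1.eventually_lt_const h2
    refine tendsto_integral_filter_of_dominated_convergence (fun x => 2 * C * ‖φ x‖) ?_ ?_ ?_ ?_
    · refine Eventually.of_forall fun g => ?_
      have h1 : Measurable fun x => A.mult g x * φ (A.act g x) :=
        (A.measurable_mult g).mul (hφc.measurable.comp (A.measurable_act g))
      exact hφc.aestronglyMeasurable.inner h1.aestronglyMeasurable
    · filter_upwards [hb] with g hg
      refine Eventually.of_forall fun x => ?_
      by_cases hx : x ∈ tsupport φ
      · calc ‖inner ℂ (φ x) (A.mult g x * φ (A.act g x))‖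
            ≤ ‖φ x‖ * ‖A.mult g x * φ (A.act g x)‖ := norm_inner_le_norm _ _
          _ = ‖φ x‖ * (‖A.mult g x‖ * ‖φ (A.act g x)‖) := by rw [norm_mul]
          _ ≤ ‖φ x‖ * (2 * C) := by
            gcongr
            · exact (hg x hx).le
            · exact hC _
          _ = 2 * C * ‖φ x‖ := mul_comm _ _
      · rw [image_eq_zero_of_notMem_tsupport hx]
        simp
    · exact ((hφc.norm.integrable_of_hasCompactSupport hφs.norm)).const_mul _
    · refine Eventually.of_forall fun x => ?_
      have h0 : Tendsto (fun g : G => (g, x)) (𝓝 1) (𝓝 (1, x)) :=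
        (Continuous.prodMk_left x).tendsto 1
      have h1 : Tendsto (fun g => A.mult g x) (𝓝 1) (𝓝 1) := by
        have := (hmult x).tendsto.comp h0
        rwa [A.one_mult] at this
      have h2 : Tendsto (fun g => A.act g x) (𝓝 1) (𝓝 x) := by
        have := (hact x).tendsto.comp h0
        rwa [A.one_act] at this
      exact tendsto_const_nhds.inner (h1.mul ((hφc.tendsto x).comp h2))

end PartialAction

end PartialAction

/-! ### Fourier transforms of square-integrable functions -/

section Fourier

open scoped FourierTransform SchwartzMap ComplexConjugate RealInnerProductSpace

variable {V : Type} [NormedAddCommGroup V] [InnerProductSpace ℝ V] [FiniteDimensional ℝ V]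
  [MeasurableSpace V] [BorelSpace V]

lemma ae_eq_zero_of_forall_integral_schwartz_mul {u : V → ℂ} (hu : LocallyIntegrable u)
    (h : ∀ φ : 𝓢(V, ℂ), ∫ x, φ x * u x = 0) : u =ᵐ[volume] 0 := by
  refine ae_eq_zero_of_integral_contDiff_smul_eq_zero hu fun g hg hgs => ?_
  have hs : HasCompactSupport fun x => (g x : ℂ) := hgs.comp_left Complex.ofReal_zero
  have hd : ContDiff ℝ (↑(⊤ : ℕ∞)) fun x => (g x : ℂ) := Complex.ofRealCLM.contDiff.comp hg
  simpa using h (hs.toSchwartzMap hd)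

lemma integral_schwartz_mul_fourier (φ : 𝓢(V, ℂ)) (F : Lp ℂ 2 (volume : Measure V)) :
    ∫ x, φ x * (𝓕 F : Lp ℂ 2 (volume : Measure V)) x = ∫ x, (𝓕 φ) x * F x := by
  have h := congrArg (fun D => D φ) (Lp.fourier_toTemperedDistribution_eq F)
  simp only [Lp.toTemperedDistribution_apply, smul_eq_mul] at h
  rw [← h]
  simp [TemperedDistribution.fourier_apply]

/-- The hypothesis says that the Fourier transform of `w` vanishes. Writing a Schwartz function as
`φ = 𝓕 (𝓕⁻ φ)` and moving the transform onto `w` shows that `w` pairs to zero with every `φ`. -/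
lemma ae_eq_zero_of_forall_integral_fourierChar {w : V → ℂ} (hw : Integrable w)
    (h : ∀ c : V, ∫ x, Real.fourierChar ⟪c, x⟫ • w x = 0) : w =ᵐ[volume] 0 := by
  have h0 : 𝓕 w = 0 := by
    ext c
    rw [Real.fourier_eq, Pi.zero_apply, ← h (-c)]
    simp only [inner_neg_left, real_inner_comm]
  refine ae_eq_zero_of_forall_integral_schwartz_mul hw.locallyIntegrable fun φ => ?_
  have key := VectorFourier.integral_fourierIntegral_smul_eq_flip (L := innerₗ V) (μ := volume)
    (ν := volume) Real.continuous_fourierChar continuous_inner hw (𝓕⁻ φ).integrable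
  have e1 : VectorFourier.fourierIntegral Real.fourierChar volume (innerₗ V) w = 𝓕 w := rfl
  have e2 : VectorFourier.fourierIntegral Real.fourierChar volume (innerₗ V).flip
      (⇑(𝓕⁻ φ : 𝓢(V, ℂ))) = φ := by
    have h1 : VectorFourier.fourierIntegral Real.fourierChar volume (innerₗ V).flip
        (⇑(𝓕⁻ φ : 𝓢(V, ℂ))) = ⇑(𝓕 (𝓕⁻ φ : 𝓢(V, ℂ)) : 𝓢(V, ℂ)) := by
      rw [SchwartzMap.fourier_coe, flip_innerₗ]
      rfl
    rw [h1, FourierTransform.fourier_fourierInv_eq]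
  rw [e1, e2, h0] at key
  simp only [Pi.zero_apply, smul_eq_mul, zero_mul, integral_zero] at key
  rw [key]
  simp only [mul_comm]

variable {E : Type} [NormedAddCommGroup E] [NormedSpace ℝ E] [FiniteDimensional ℝ E]
  [MeasurableSpace E] [BorelSpace E]

lemma exists_integral_comp_linearEquiv (μ : Measure E) [μ.IsAddHaarMeasure] (T : E ≃L[ℝ] E) :
    ∃ k : ℂ, k ≠ 0 ∧ ∀ (c : E) (F : E → ℂ), ∫ x, F (T x + c) ∂μ = k * ∫ x, F x ∂μ := by
  have hd : LinearMap.det (T : E →ₗ[ℝ] E) ≠ 0 := T.toLinearEquiv.isUnit_det'.ne_zero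
  have hm := Measure.map_linearMap_addHaar_eq_smul_addHaar μ hd
  refine ⟨((|(LinearMap.det (T : E →ₗ[ℝ] E))⁻¹| : ℝ) : ℂ), by simpa using hd, fun c F => ?_⟩
  have h1 : ∫ x, F (T x + c) ∂μ = ∫ x, F (x + c) ∂(Measure.map T μ) :=
    (T.toHomeomorph.measurableEmbedding.integral_map fun x => F (x + c)).symm
  have h2 : Measure.map T μ = ENNReal.ofReal |(LinearMap.det (T : E →ₗ[ℝ] E))⁻¹| • μ := hm
  rw [h1, h2, integral_smul_measure, integral_add_right_eq_self,
    ENNReal.toReal_ofReal (abs_nonneg _), Complex.real_smul]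

lemma quasiMeasurePreserving_linearEquiv {E' : Type} [NormedAddCommGroup E'] [NormedSpace ℝ E']
    [FiniteDimensional ℝ E'] [MeasurableSpace E'] [BorelSpace E'] (L : E ≃L[ℝ] E')
    (μ : Measure E) [μ.IsAddHaarMeasure] (ν : Measure E') [ν.IsAddHaarMeasure] :
    Measure.QuasiMeasurePreserving L μ ν :=
  ⟨L.continuous.measurable, Measure.absolutelyContinuous_isAddHaarMeasure _ _⟩

/-- The Fourier transform of a composition with an affine map. -/
lemma exists_fourier_comp_affine (T S : V ≃L[ℝ] V) (hTS : ∀ y x, ⟪S y, T x⟫ = ⟪y, x⟫) :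
    ∃ k : ℂ, k ≠ 0 ∧ ∀ (c : V) (F G : Lp ℂ 2 (volume : Measure V)),
      G =ᵐ[volume] (fun x => F (T x + c)) →
      (𝓕 G : Lp ℂ 2 (volume : Measure V)) =ᵐ[volume] fun y => k * (Real.fourierChar ⟪c, S y⟫ •
        (𝓕 F : Lp ℂ 2 (volume : Measure V)) (S y)) := by
  obtain ⟨k, hk, hTk⟩ := exists_integral_comp_linearEquiv (volume : Measure V) T
  obtain ⟨l, hl, hSl⟩ := exists_integral_comp_linearEquiv (volume : Measure V) S
  refine ⟨l⁻¹, inv_ne_zero hl, fun c F G hG => ?_⟩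
  have hchar : Continuous fun y => (Real.fourierChar ⟪c, S y⟫ : ℂ) :=
    continuous_subtype_val.comp (Real.continuous_fourierChar.comp
      (continuous_const.inner S.continuous))
  have hFl : LocallyIntegrable (𝓕 F : Lp ℂ 2 (volume : Measure V)) :=
    (Lp.memLp _).locallyIntegrable (by norm_num)
  have hGl : LocallyIntegrable (𝓕 G : Lp ℂ 2 (volume : Measure V)) :=
    (Lp.memLp _).locallyIntegrable (by norm_num)
  have hFS : MemLp (fun y => (𝓕 F : Lp ℂ 2 (volume : Measure V)) (S y)) 2 volume := by
    have h1 := quasiMeasurePreserving_linearEquiv S (volume : Measure V) volume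
    have hd : LinearMap.det (S : V →ₗ[ℝ] V) ≠ 0 := S.toLinearEquiv.isUnit_det'.ne_zero
    have h2 : Measure.map S (volume : Measure V) =
        ENNReal.ofReal |(LinearMap.det (S : V →ₗ[ℝ] V))⁻¹| • volume :=
      Measure.map_linearMap_addHaar_eq_smul_addHaar _ hd
    have h3 : MemLp (𝓕 F : Lp ℂ 2 (volume : Measure V)) 2 (Measure.map S volume) := by
      rw [h2]
      exact (Lp.memLp _).smul_measure ENNReal.ofReal_ne_top
    exact (S.toHomeomorph.measurableEmbedding.memLp_map_measure_iff).mp h3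
  have hR : MemLp (fun y => l⁻¹ * (Real.fourierChar ⟪c, S y⟫ •
        (𝓕 F : Lp ℂ 2 (volume : Measure V)) (S y))) 2 volume := by
    refine MemLp.const_mul ?_ _
    refine hFS.of_le (hchar.aestronglyMeasurable.mul hFS.1) (Eventually.of_forall fun y => ?_)
    simp only [Circle.smul_def, smul_eq_mul, norm_mul, Circle.norm_coe, one_mul, le_refl]
  have hsub : LocallyIntegrable (fun y => (𝓕 G : Lp ℂ 2 (volume : Measure V)) y -
      l⁻¹ * (Real.fourierChar ⟪c, S y⟫ • (𝓕 F : Lp ℂ 2 (volume : Measure V)) (S y))) :=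
    hGl.sub (hR.locallyIntegrable (by norm_num))
  have key := ae_eq_zero_of_forall_integral_schwartz_mul hsub fun φ => ?_
  · filter_upwards [key] with y hy
    exact sub_eq_zero.mp hy
  -- The `L²` transform is not given by an integral, so the identity is tested against Schwartz
  -- functions. The affine substitution is carried to the test side: `θ` is `𝓕 φ` composed with the
  -- inverse of `x ↦ T x + c`, and its inverse transform is explicit.
  · set θ : 𝓢(V, ℂ) := SchwartzMap.compSubConstCLM ℂ c
      (SchwartzMap.compCLMOfContinuousLinearEquiv ℂ T.symm (𝓕 φ)) with hθ
    have hθ' : ∀ x, θ (T x + c) = (𝓕 φ) x := by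
      intro x
      simp [hθ]
    have e1 : ∫ x, φ x * (𝓕 G : Lp ℂ 2 (volume : Measure V)) x = k * ∫ x, θ x * F x := by
      rw [integral_schwartz_mul_fourier, ← hTk c]
      refine integral_congr_ae ?_
      filter_upwards [hG] with x hx
      rw [hθ', hx]
    have e2 : ∀ y, (𝓕⁻ θ) y = k⁻¹ * (Real.fourierChar ⟪c, y⟫ • φ (S.symm y)) := by
      intro y
      have hin : (𝓕⁻ (𝓕 φ)) (S.symm y) = φ (S.symm y) := by
        rw [FourierTransform.fourierInv_fourier_eq]
      rw [← hin]
      simp only [SchwartzMap.fourierInv_coe, Real.fourierInv_eq]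
      rw [eq_inv_mul_iff_mul_eq₀ hk, ← hTk c, Circle.smul_def, smul_eq_mul, ← integral_const_mul]
      congr 1
      ext x
      have : ⟪T x + c, y⟫ = ⟪c, y⟫ + ⟪x, S.symm y⟫ := by
        have := hTS (S.symm y) x
        rw [S.apply_symm_apply] at this
        rw [inner_add_left, real_inner_comm, this, real_inner_comm x, add_comm]
      rw [this, hθ', AddChar.map_add_eq_mul]
      simp [Circle.smul_def, mul_assoc]
    have e3 : ∫ x, θ x * F x = ∫ x, (𝓕⁻ θ) x * (𝓕 F : Lp ℂ 2 (volume : Measure V)) x := by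
      rw [integral_schwartz_mul_fourier, FourierTransform.fourier_fourierInv_eq]
    have e4 : ∫ x, φ x * (𝓕 G : Lp ℂ 2 (volume : Measure V)) x =
        ∫ x, φ x * (l⁻¹ * (Real.fourierChar ⟪c, S x⟫ •
          (𝓕 F : Lp ℂ 2 (volume : Measure V)) (S x))) := by
      rw [e1, e3]
      have h5 := hSl 0 fun y => (𝓕⁻ θ) y * (𝓕 F : Lp ℂ 2 (volume : Measure V)) y
      rw [eq_comm, ← eq_inv_mul_iff_mul_eq₀ hl] at h5
      rw [h5, ← integral_const_mul, ← integral_const_mul]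
      congr 1
      ext x
      simp only [add_zero, e2, S.symm_apply_apply, Circle.smul_def, smul_eq_mul]
      field_simp
    have i1 : Integrable fun x => φ x * (𝓕 G : Lp ℂ 2 (volume : Measure V)) x :=
      (φ.memLp 2 volume).integrable_mul (Lp.memLp _)
    have i2 : Integrable fun x => φ x * (l⁻¹ * (Real.fourierChar ⟪c, S x⟫ •
          (𝓕 F : Lp ℂ 2 (volume : Measure V)) (S x))) :=
      (φ.memLp 2 volume).integrable_mul hR
    simp only [mul_sub]
    rw [integral_sub i1 i2, e4, sub_self]

/-- For a square-integrable `f` on a space with a non-degenerate pairing `B`, the Fourier transform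
of `f` with respect to `B` is defined up to null sets; here only its zero set matters. -/
theorem exists_fourier_of_pairing (μ : Measure E) [μ.IsAddHaarMeasure]
    (B : E →ₗ[ℝ] E →ₗ[ℝ] ℝ) (hB : ∀ y, (∀ x, B y x = 0) → y = 0) (f h : E → ℂ)
    (hf : MemLp f 2 μ) (hh : MemLp h 2 μ) :
    ∃ u v : E → ℂ, Measurable u ∧ Measurable v ∧ (u =ᵐ[μ] 0 → f =ᵐ[μ] 0) ∧
      (v =ᵐ[μ] 0 → h =ᵐ[μ] 0) ∧ ∀ S T : E ≃ₗ[ℝ] E, (∀ y x, B (S y) (T x) = B y x) →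
        (∀ c, ∫ x, conj (h x) * f (T x + c) ∂μ = 0) → ∀ᵐ y ∂μ, u (S y) * v y = 0 := by
  set W := EuclideanSpace ℝ (Fin (Module.finrank ℝ E))
  set t : E ≃L[ℝ] W := toEuclidean with ht
  set e : W ≃L[ℝ] E := t.symm with he
  -- The problem is moved to Euclidean coordinates, where the Lebesgue measure is a nonzero multiple
  -- of the image of `μ`.
  obtain ⟨r, hr0, hr⟩ : ∃ r : NNReal, r ≠ 0 ∧ (volume : Measure W) = r • Measure.map t μ :=
    ⟨_, (Measure.addHaarScalarFactor_pos_of_isAddHaarMeasure _ _).ne',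
      Measure.isAddLeftInvariant_eq_smul _ _⟩
  have hmem : ∀ f : E → ℂ, MemLp f 2 μ → MemLp (fun w => f (e w)) 2 (volume : Measure W) := by
    intro f hf
    rw [hr]
    refine MemLp.smul_measure ?_ ENNReal.coe_ne_top
    refine (t.toHomeomorph.measurableEmbedding.memLp_map_measure_iff).mpr ?_
    refine hf.ae_eq (Eventually.of_forall fun x => ?_)
    simp [he]
  have hint : ∀ f : E → ℂ, ∫ w : W, f (e w) = r • ∫ x, f x ∂μ := by
    intro f
    rw [hr, integral_smul_nnreal_measure]
    congr 1
    have := t.toHomeomorph.measurableEmbedding.integral_map (μ := μ) fun w => f (e w)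
    refine this.trans ?_
    simp [he]
  -- `φ₀ y` is the vector of `W` that represents the functional `B y`. Thus `B` becomes the inner
  -- product, and a pair `S`, `T` dual for `B` becomes a pair `S'`, `T'` dual for the inner product.
  set φ₀ : E →ₗ[ℝ] W := (InnerProductSpace.toDual ℝ W).symm.toLinearMap ∘ₗ
    LinearMap.toContinuousLinearMap.toLinearMap ∘ₗ
      (LinearMap.lcomp ℝ ℝ (e : W →ₗ[ℝ] E)) ∘ₗ B with hφ₀
  have hφ₀' : ∀ y w, ⟪φ₀ y, w⟫ = B y (e w) := by
    intro y w
    simp [hφ₀]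
  have hinj : Function.Injective φ₀ := by
    rw [← LinearMap.ker_eq_bot, LinearMap.ker_eq_bot']
    intro y hy
    refine hB y fun x => ?_
    have := hφ₀' y (t x)
    rw [hy, inner_zero_left] at this
    simpa [he] using this.symm
  set φ : E ≃L[ℝ] W := (LinearEquiv.ofInjectiveOfFinrankEq φ₀ hinj
    (by simp [W])).toContinuousLinearEquiv with hφ
  have hφ' : ∀ y w, ⟪φ y, w⟫ = B y (e w) := hφ₀'
  have hφq : Measure.QuasiMeasurePreserving φ μ volume :=
    quasiMeasurePreserving_linearEquiv φ μ volume
  have hφs : Measure.QuasiMeasurePreserving φ.symm volume μ :=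
    quasiMeasurePreserving_linearEquiv φ.symm volume μ
  have htq : Measure.QuasiMeasurePreserving t μ volume :=
    quasiMeasurePreserving_linearEquiv t μ volume
  have heq : Measure.QuasiMeasurePreserving e volume μ :=
    quasiMeasurePreserving_linearEquiv e volume μ
  have hzero : ∀ (f : E → ℂ) (hf : MemLp f 2 μ),
      (fun y => (𝓕 ((hmem f hf).toLp) : Lp ℂ 2 (volume : Measure W)) (φ y)) =ᵐ[μ] 0 →
        f =ᵐ[μ] 0 := by
    intro f hf h0
    have h1 : (𝓕 ((hmem f hf).toLp) : Lp ℂ 2 (volume : Measure W)) = 0 := by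
      rw [Lp.eq_zero_iff_ae_eq_zero]
      filter_upwards [hφs.ae h0] with w hw
      simpa using hw
    have h2 : (hmem f hf).toLp = 0 := by
      rw [← norm_eq_zero, ← Lp.norm_fourier_eq, h1, norm_zero]
    rw [Lp.eq_zero_iff_ae_eq_zero] at h2
    have h3 := (hmem f hf).coeFn_toLp.symm.trans h2
    filter_upwards [htq.ae h3] with x hx
    simpa [he] using hx
  refine ⟨fun y => (𝓕 ((hmem f hf).toLp) : Lp ℂ 2 (volume : Measure W)) (φ y),
    fun y => (𝓕 ((hmem h hh).toLp) : Lp ℂ 2 (volume : Measure W)) (φ y),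
    (Lp.stronglyMeasurable _).measurable.comp φ.continuous.measurable,
    (Lp.stronglyMeasurable _).measurable.comp φ.continuous.measurable, hzero f hf, hzero h hh, ?_⟩
  intro S T hST hzero'
  set S' : W ≃L[ℝ] W := (φ.symm.trans S.toContinuousLinearEquiv).trans φ with hS'
  set T' : W ≃L[ℝ] W := (e.trans T.toContinuousLinearEquiv).trans t with hT'
  have hST' : ∀ y x, ⟪S' y, T' x⟫ = ⟪y, x⟫ := by
    intro y x
    have h1 : S' y = φ (S (φ.symm y)) := rfl
    have h2 : e (T' x) = T (e x) := by simp [hT', he]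
    rw [h1, hφ', h2, hST, ← hφ', φ.apply_symm_apply]
  obtain ⟨k, hk, hkF⟩ := exists_fourier_comp_affine T' S' hST'
  set F := (hmem f hf).toLp with hF
  set H := (hmem h hh).toLp with hH
  have hTq : ∀ c, Measure.QuasiMeasurePreserving (fun w => T' w + c) (volume : Measure W) volume :=
    fun c => (measurePreserving_add_right volume c).quasiMeasurePreserving.comp
      (quasiMeasurePreserving_linearEquiv T' volume volume)
  have hfT : ∀ c, MemLp (fun w => F (T' w + c)) 2 (volume : Measure W) := by
    intro c
    have hd : LinearMap.det (T' : W →ₗ[ℝ] W) ≠ 0 := T'.toLinearEquiv.isUnit_det'.ne_zero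
    have h2 : Measure.map T' (volume : Measure W) =
        ENNReal.ofReal |(LinearMap.det (T' : W →ₗ[ℝ] W))⁻¹| • volume :=
      Measure.map_linearMap_addHaar_eq_smul_addHaar _ hd
    have h3 : MemLp (fun w => F (w + c)) 2 (Measure.map T' (volume : Measure W)) := by
      rw [h2]
      exact ((Lp.memLp F).comp_measurePreserving (measurePreserving_add_right volume c)).smul_measure
        ENNReal.ofReal_ne_top
    exact (T'.toHomeomorph.measurableEmbedding.memLp_map_measure_iff).mp h3
  have hw : ∀ c, ∫ y, Real.fourierChar ⟪c, y⟫ •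
      (conj ((𝓕 H : Lp ℂ 2 (volume : Measure W)) y) *
        (𝓕 F : Lp ℂ 2 (volume : Measure W)) (S' y)) = 0 := by
    intro c
    -- Translating by `T' c` rather than by `c` turns the character `⟪T' c, S' y⟫` into `⟪c, y⟫`. As
    -- `c` varies, all Fourier coefficients of one integrable function are seen to vanish.
    set G : Lp ℂ 2 (volume : Measure W) := (hfT (T' c)).toLp with hG
    have h1 : inner ℂ H G = 0 := by
      rw [L2.inner_def]
      have h2 : ∀ᵐ w, inner ℂ (H w) (G w) =
          conj (h (e w)) * f (T (e w) + e (T' c)) := by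
        filter_upwards [(hmem h hh).coeFn_toLp, (hfT (T' c)).coeFn_toLp,
          (hTq (T' c)).ae (hmem f hf).coeFn_toLp] with w h1 h2 h3
        rw [hH, h1, hG, h2, hF, h3, RCLike.inner_apply, mul_comm]
        simp [hT', he]
      rw [integral_congr_ae h2, hint fun x => conj (h x) * f (T x + e (T' c)), hzero', smul_zero]
    have h2 : inner ℂ (𝓕 H : Lp ℂ 2 (volume : Measure W)) (𝓕 G) = 0 := by
      rw [Lp.inner_fourier_eq, h1]
    rw [L2.inner_def] at h2
    have h3 : ∀ᵐ y, inner ℂ ((𝓕 H : Lp ℂ 2 (volume : Measure W)) y)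
        ((𝓕 G : Lp ℂ 2 (volume : Measure W)) y) =
        k * (Real.fourierChar ⟪c, y⟫ • (conj ((𝓕 H : Lp ℂ 2 (volume : Measure W)) y) *
        (𝓕 F : Lp ℂ 2 (volume : Measure W)) (S' y))) := by
      filter_upwards [hkF (T' c) F G (hfT (T' c)).coeFn_toLp] with y hy
      rw [hy, RCLike.inner_apply, real_inner_comm, hST', real_inner_comm]
      simp only [Circle.smul_def, smul_eq_mul]
      ring
    rw [integral_congr_ae h3, integral_const_mul] at h2
    exact (mul_eq_zero.mp h2).resolve_left hk
  have hSm : MemLp (fun y => (𝓕 F : Lp ℂ 2 (volume : Measure W)) (S' y)) 2 volume := by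
    have hd : LinearMap.det (S' : W →ₗ[ℝ] W) ≠ 0 := S'.toLinearEquiv.isUnit_det'.ne_zero
    have h2 : Measure.map S' (volume : Measure W) =
        ENNReal.ofReal |(LinearMap.det (S' : W →ₗ[ℝ] W))⁻¹| • volume :=
      Measure.map_linearMap_addHaar_eq_smul_addHaar _ hd
    have h3 : MemLp (𝓕 F : Lp ℂ 2 (volume : Measure W)) 2 (Measure.map S' volume) := by
      rw [h2]
      exact (Lp.memLp _).smul_measure ENNReal.ofReal_ne_top
    exact (S'.toHomeomorph.measurableEmbedding.memLp_map_measure_iff).mp h3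
  have hwi : Integrable fun y => conj ((𝓕 H : Lp ℂ 2 (volume : Measure W)) y) *
        (𝓕 F : Lp ℂ 2 (volume : Measure W)) (S' y) :=
    (Lp.memLp (𝓕 H)).star.integrable_mul hSm
  filter_upwards [hφq.ae (ae_eq_zero_of_forall_integral_fourierChar hwi hw)] with y hy
  have h1 : S' (φ y) = φ (S y) := by simp [hS']
  rw [Pi.zero_apply, h1, mul_eq_zero, map_eq_zero] at hy
  exact mul_eq_zero.mpr hy.symm

end Fourier

/-! ### Ergodicity and irreducibility -/

section Ergodic

open scoped ComplexConjugate

variable {E : Type} [NormedAddCommGroup E] [NormedSpace ℝ E] [FiniteDimensional ℝ E]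
  [MeasurableSpace E] [BorelSpace E] (μ : Measure E) [μ.IsAddHaarMeasure]
  {X : Type} [MeasurableSpace X] (ν : Measure X) [SFinite ν]

/-- Ergodicity of a family `S` of linear maps that is transitive on a conull set: if almost all
`S a` carry no part of positive measure of `B'` into `A'`, then `A'` or `B'` is null. -/
lemma ae_notMem_or_ae_notMem (hν : ν ≠ 0) (S : X → E → E)
    (hS : Measurable fun p : X × E => S p.1 p.2)
    (hlin : ∀ᵐ a ∂ν, ∃ L : E ≃ₗ[ℝ] E, ∀ y, L y = S a y) {O : Set E} (hO : ∀ᵐ y ∂μ, y ∈ O)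
    (htrans : ∀ ξ ∈ O, ∀ η ∈ O, ∃ r : X → X, Measure.QuasiMeasurePreserving r ν ν ∧
      ∀ a, S a η = S (r a) ξ) {A' B' : Set E} (hA : MeasurableSet A') (hB : MeasurableSet B')
    (h : ∀ᵐ a ∂ν, ∀ᵐ y ∂μ, ¬ (S a y ∈ A' ∧ y ∈ B')) :
    (∀ᵐ y ∂μ, y ∉ A') ∨ ∀ᵐ y ∂μ, y ∉ B' := by
  by_contra! hcon
  obtain ⟨hA', hB'⟩ := hcon
  have hm1 : MeasurableSet {p : X × E | ¬ (S p.1 p.2 ∈ A' ∧ p.2 ∈ B')} :=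
    ((hS hA).inter (measurable_snd hB)).compl
  rw [Measure.ae_ae_comm (p := fun a y => ¬ (S a y ∈ A' ∧ y ∈ B')) hm1] at h
  obtain ⟨ξ, hξB, hξ, hξO⟩ := ((not_eventually.mp hB').and_eventually (h.and hO)).exists
  have hξA : ∀ᵐ a ∂ν, S a ξ ∉ A' := by
    filter_upwards [hξ] with a ha hA
    exact ha ⟨hA, not_not.mp hξB⟩
  have h2 : ∀ᵐ η ∂μ, ∀ᵐ a ∂ν, S a η ∉ A' := by
    filter_upwards [hO] with η hη
    obtain ⟨r, hr, hrS⟩ := htrans ξ hξO η hη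
    filter_upwards [hr.ae hξA] with a ha
    rwa [hrS]
  have hm2 : MeasurableSet {p : E × X | S p.2 p.1 ∉ A'} :=
    ((hS.comp measurable_swap) hA).compl
  rw [Measure.ae_ae_comm (p := fun η a => S a η ∉ A') hm2] at h2
  have : (ae ν).NeBot := ae_neBot.mpr hν
  obtain ⟨a, ha, L, hL⟩ := (h2.and hlin).exists
  refine hA' ?_
  have hq := quasiMeasurePreserving_linearEquiv L.toContinuousLinearEquiv.symm μ μ
  filter_upwards [hq.ae ha] with y hy
  rw [← hL] at hy
  simpa using hy

/-- A closed subspace of `L²` that is invariant under translations and under a family of linear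
substitutions is trivial if the dual family is transitive on a conull set. -/
theorem eq_bot_or_eq_top_of_invariant (B : E →ₗ[ℝ] E →ₗ[ℝ] ℝ)
    (hB : ∀ y, (∀ x, B y x = 0) → y = 0) (hν : ν ≠ 0) (S : X → E → E)
    (hS : Measurable fun p : X × E => S p.1 p.2) {O : Set E} (hO : ∀ᵐ y ∂μ, y ∈ O)
    (htrans : ∀ ξ ∈ O, ∀ η ∈ O, ∃ r : X → X, Measure.QuasiMeasurePreserving r ν ν ∧
      ∀ a, S a η = S (r a) ξ) (V : Submodule ℂ (Lp ℂ 2 μ)) (hV : IsClosed (V : Set (Lp ℂ 2 μ)))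
    (hinv : ∀ᵐ a ∂ν, ∃ L T : E ≃ₗ[ℝ] E, (∀ y, L y = S a y) ∧ (∀ y x, B (L y) (T x) = B y x) ∧
      ∀ c, ∀ F ∈ V, ∃ F' ∈ V, ∃ k : ℂ, k ≠ 0 ∧ F' =ᵐ[μ] fun x => k * F (T x + c)) :
    V = ⊥ ∨ V = ⊤ := by
  by_contra! hcon
  obtain ⟨hbot, htop⟩ := hcon
  have : CompleteSpace V := hV.completeSpace_coe
  obtain ⟨f, hfV, hf0⟩ := V.ne_bot_iff.mp hbot
  obtain ⟨h, hhV, hh0⟩ := (Submodule.ne_bot_iff _).mp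
    (fun h' => htop (Submodule.orthogonal_eq_bot_iff.mp h'))
  obtain ⟨u, v, hu, hv, hu0, hv0, huv⟩ :=
    exists_fourier_of_pairing μ B hB f h (Lp.memLp f) (Lp.memLp h)
  have key : ∀ᵐ a ∂ν, ∀ᵐ y ∂μ, ¬ (S a y ∈ {y | u y ≠ 0} ∧ y ∈ {y | v y ≠ 0}) := by
    filter_upwards [hinv] with a ha
    obtain ⟨L, T, hL, hLT, hT⟩ := ha
    -- Orthogonality of `h` to `V`, applied to the translate of `f`. The nonzero factor `k` of the
    -- representation is irrelevant.
    have h1 : ∀ c, ∫ x, conj (h x) * f (T x + c) ∂μ = 0 := by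
      intro c
      obtain ⟨F', hF', k, hk, hFk⟩ := hT c f hfV
      have h2 : inner ℂ h F' = 0 := Submodule.inner_left_of_mem_orthogonal hF' hhV
      rw [L2.inner_def] at h2
      have h3 : ∀ᵐ x ∂μ, inner ℂ (h x) (F' x) = k * (conj (h x) * f (T x + c)) := by
        filter_upwards [hFk] with x hx
        rw [hx, RCLike.inner_apply]
        ring
      rw [integral_congr_ae h3, integral_const_mul] at h2
      exact (mul_eq_zero.mp h2).resolve_left hk
    filter_upwards [huv L T hLT h1] with y hy hy'
    rw [hL] at hy
    exact (mul_ne_zero hy'.1 hy'.2) hy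
  have hlin : ∀ᵐ a ∂ν, ∃ L : E ≃ₗ[ℝ] E, ∀ y, L y = S a y := by
    filter_upwards [hinv] with a ha
    obtain ⟨L, T, hL, -⟩ := ha
    exact ⟨L, hL⟩
  rcases ae_notMem_or_ae_notMem μ ν hν S hS hlin hO htrans
    (hu (measurableSet_singleton (0 : ℂ)).compl) (hv (measurableSet_singleton (0 : ℂ)).compl) key
    with h1 | h1
  · refine hf0 ((Lp.eq_zero_iff_ae_eq_zero).mpr (hu0 ?_))
    filter_upwards [h1] with y hy
    simpa using hy
  · refine hh0 ((Lp.eq_zero_iff_ae_eq_zero).mpr (hv0 ?_))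
    filter_upwards [h1] with y hy
    simpa using hy

/-- The unit ball has positive finite measure, also when `E` is the zero space. -/
lemma nontrivial_Lp : Nontrivial (Lp ℂ 2 μ) := by
  have : ProperSpace E := FiniteDimensional.proper ℝ E
  have hfin : μ (Metric.ball 0 1) ≠ ⊤ := Metric.isBounded_ball.measure_lt_top.ne
  have hpos : μ (Metric.ball 0 1) ≠ 0 := (Metric.measure_ball_pos μ 0 one_pos).ne'
  refine ⟨indicatorConstLp 2 Metric.isOpen_ball.measurableSet hfin (1 : ℂ), 0, fun h => ?_⟩
  have := congrArg norm h
  rw [norm_indicatorConstLp two_ne_zero ENNReal.ofNat_ne_top, norm_zero, norm_one, one_mul] at this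
  have h2 := (Real.rpow_eq_zero measureReal_nonneg (by norm_num)).mp this
  exact hpos ((measureReal_eq_zero_iff hfin).mp h2)

end Ergodic

/-! ### Degenerate principal series on a flat matrix space -/

section Blocks

variable {n : ℕ} {K : Type} [DivisionRing K]

/-- The left block `a + xc` of `(1 x) g`. -/
def leftBlock (g : Matrix (Fin n ⊕ Fin n) (Fin n ⊕ Fin n) K) (x : Matrix (Fin n) (Fin n) K) :
    Matrix (Fin n) (Fin n) K := g.toBlocks₁₁ + x * g.toBlocks₂₁

/-- The right block `b + xd` of `(1 x) g`. -/
def rightBlock (g : Matrix (Fin n ⊕ Fin n) (Fin n ⊕ Fin n) K) (x : Matrix (Fin n) (Fin n) K) :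
    Matrix (Fin n) (Fin n) K := g.toBlocks₁₂ + x * g.toBlocks₂₂

lemma mul_eq_fromBlocks (g h : Matrix (Fin n ⊕ Fin n) (Fin n ⊕ Fin n) K) :
    g * h = fromBlocks (g.toBlocks₁₁ * h.toBlocks₁₁ + g.toBlocks₁₂ * h.toBlocks₂₁)
      (g.toBlocks₁₁ * h.toBlocks₁₂ + g.toBlocks₁₂ * h.toBlocks₂₂)
      (g.toBlocks₂₁ * h.toBlocks₁₁ + g.toBlocks₂₂ * h.toBlocks₂₁)
      (g.toBlocks₂₁ * h.toBlocks₁₂ + g.toBlocks₂₂ * h.toBlocks₂₂) := by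
  rw [← fromBlocks_multiply, fromBlocks_toBlocks, fromBlocks_toBlocks]

lemma leftBlock_mul (g h : Matrix (Fin n ⊕ Fin n) (Fin n ⊕ Fin n) K)
    (x : Matrix (Fin n) (Fin n) K) : leftBlock (g * h) x =
      leftBlock g x * h.toBlocks₁₁ + rightBlock g x * h.toBlocks₂₁ := by
  rw [leftBlock, mul_eq_fromBlocks, toBlocks_fromBlocks₁₁, toBlocks_fromBlocks₂₁, leftBlock,
    rightBlock]
  noncomm_ring

lemma rightBlock_mul (g h : Matrix (Fin n ⊕ Fin n) (Fin n ⊕ Fin n) K)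
    (x : Matrix (Fin n) (Fin n) K) : rightBlock (g * h) x =
      leftBlock g x * h.toBlocks₁₂ + rightBlock g x * h.toBlocks₂₂ := by
  rw [rightBlock, mul_eq_fromBlocks, toBlocks_fromBlocks₁₂, toBlocks_fromBlocks₂₂, leftBlock,
    rightBlock]
  noncomm_ring

lemma leftBlock_one (x : Matrix (Fin n) (Fin n) K) : leftBlock 1 x = 1 := by
  rw [leftBlock, ← fromBlocks_one, toBlocks_fromBlocks₁₁, toBlocks_fromBlocks₂₁]
  simp

lemma rightBlock_one (x : Matrix (Fin n) (Fin n) K) : rightBlock 1 x = x := by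
  rw [rightBlock, ← fromBlocks_one, toBlocks_fromBlocks₁₂, toBlocks_fromBlocks₂₂]
  simp

end Blocks

/-! ### Linear-fractional actions on an admissible matrix space. -/

section Admissible

variable {n : ℕ} {K : Type} [NormedDivisionRing K] [NormedAlgebra ℝ K]

/-- What is needed of a flat matrix space `E` (embedded by `j`) and of a group `G` acting on it by
linear-fractional maps in order that the degenerate principal series exists and is irreducible
on the parabolic subgroup. -/
structure IsAdmissible {E : Type} [AddCommGroup E] [Module ℝ E] [TopologicalSpace E]
    (j : E →ₗ[ℝ] Matrix (Fin n) (Fin n) K) (G : Subgroup (GL2 n K)) (h : ℝ) : Prop where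
  injective : Function.Injective j
  exists_frac : ∀ g ∈ G, ∀ (x : E) (u : (Matrix (Fin n) (Fin n) K)ˣ),
    (u : Matrix (Fin n) (Fin n) K) = leftBlock g.val (j x) →
    ∃ y : E, (u : Matrix (Fin n) (Fin n) K) * j y = rightBlock g.val (j x) ∧ ∃ T : E →ₗ[ℝ] E,
      (∀ δ, j (T δ) = (↑u⁻¹ : Matrix (Fin n) (Fin n) K) * j δ *
        (g.val.toBlocks₂₂ - g.val.toBlocks₂₁ * j y)) ∧
      |LinearMap.det T| = absDet (u : Matrix (Fin n) (Fin n) K) ^ (-h) *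
        absDet g.val ^ betaExp n K
  exists_isUnit_leftBlock : ∀ g ∈ G, ∃ x, IsUnit (leftBlock g.val (j x))
  -- `S a` is the action dual to `T x = a⁻¹ x d` for the pairing `B`. It must be defined and jointly
  -- continuous for all matrices `a`, so that the additive Haar measure of the matrix space can
  -- serve as the measure on the parameters. The last clause says that the invertible elements form
  -- one orbit, in a form that reparametrizes `a` by a left multiplication.
  exists_pairing : ∃ B : E →ₗ[ℝ] E →ₗ[ℝ] ℝ, (∀ y, (∀ x, B y x = 0) → y = 0) ∧
    ∃ S : Matrix (Fin n) (Fin n) K → E → E,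
      Continuous (fun p : Matrix (Fin n) (Fin n) K × E => S p.1 p.2) ∧
      (∀ a : (Matrix (Fin n) (Fin n) K)ˣ, ∃ (L T : E ≃ₗ[ℝ] E) (d : Matrix (Fin n) (Fin n) K),
        (∀ c, ∃ g ∈ G, g.val = fromBlocks (a : Matrix (Fin n) (Fin n) K)
          ((a : Matrix (Fin n) (Fin n) K) * j c) 0 d) ∧
        (∀ x, j (T x) = (↑a⁻¹ : Matrix (Fin n) (Fin n) K) * j x * d) ∧
        (∀ y, L y = S a y) ∧ ∀ y x, B (L y) (T x) = B y x) ∧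
      (∃ y, IsUnit (j y)) ∧
      ∀ ξ η, IsUnit (j ξ) → IsUnit (j η) →
        ∃ b : (Matrix (Fin n) (Fin n) K)ˣ, ∀ a, S a η = S (b * a) ξ

open scoped Topology

/-- A character of the group of units, extended by zero. -/
noncomputable def extendChar (ω : (Matrix (Fin n) (Fin n) K)ˣ →* Circle)
    (a : Matrix (Fin n) (Fin n) K) : ℂ := by
  classical
  exact if h : IsUnit a then (ω h.unit : ℂ) else 0

lemma extendChar_unit (ω : (Matrix (Fin n) (Fin n) K)ˣ →* Circle)
    (u : (Matrix (Fin n) (Fin n) K)ˣ) : extendChar ω (u : Matrix (Fin n) (Fin n) K) = ω u := by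
  rw [extendChar, dif_pos u.isUnit]
  congr 2
  exact Units.ext rfl

lemma extendChar_of_not_isUnit (ω : (Matrix (Fin n) (Fin n) K)ˣ →* Circle)
    {a : Matrix (Fin n) (Fin n) K} (h : ¬ IsUnit a) : extendChar ω a = 0 := by
  rw [extendChar, dif_neg h]

variable [FiniteDimensional ℝ K]

lemma continuousAt_extendChar (ω : (Matrix (Fin n) (Fin n) K)ˣ →* Circle) (hω : Continuous ω)
    {a : Matrix (Fin n) (Fin n) K} (h : IsUnit a) : ContinuousAt (extendChar ω) a := by
  obtain ⟨u, rfl⟩ := h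
  have h1 : extendChar ω ∘ Units.val = fun u => (ω u : ℂ) := by
    ext u
    exact extendChar_unit ω u
  rw [← isOpenEmbedding_unitsVal.continuousAt_iff, h1]
  exact (continuous_subtype_val.comp hω).continuousAt

/-- The dependence of the multiplier on `a + xc`. -/
noncomputable def multiplier (ω : (Matrix (Fin n) (Fin n) K)ˣ →* Circle) (h : ℝ)
    (a : Matrix (Fin n) (Fin n) K) : ℂ := extendChar ω a * ((absDet a ^ (-h / 2) : ℝ) : ℂ)

lemma multiplier_mul (ω : (Matrix (Fin n) (Fin n) K)ˣ →* Circle) (h : ℝ)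
    {a b : Matrix (Fin n) (Fin n) K} (ha : IsUnit a) (hb : IsUnit b) :
    multiplier ω h (a * b) = multiplier ω h a * multiplier ω h b := by
  obtain ⟨u, rfl⟩ := ha
  obtain ⟨v, rfl⟩ := hb
  rw [multiplier, multiplier, multiplier, ← Units.val_mul, extendChar_unit, extendChar_unit,
    extendChar_unit, Units.val_mul, absDet_mul, Real.mul_rpow (absDet_nonneg _) (absDet_nonneg _),
    map_mul, Circle.coe_mul, Complex.ofReal_mul]
  ring

lemma norm_multiplier (ω : (Matrix (Fin n) (Fin n) K)ˣ →* Circle) (h : ℝ)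
    {a : Matrix (Fin n) (Fin n) K} (ha : IsUnit a) :
    ‖multiplier ω h a‖ = absDet a ^ (-h / 2) := by
  obtain ⟨u, rfl⟩ := ha
  rw [multiplier, extendChar_unit, norm_mul, Circle.norm_coe, one_mul, Complex.norm_real,
    Real.norm_of_nonneg (Real.rpow_nonneg (absDet_nonneg _) _)]

lemma multiplier_one (ω : (Matrix (Fin n) (Fin n) K)ˣ →* Circle) (h : ℝ) :
    multiplier ω h 1 = 1 := by
  have := extendChar_unit ω 1
  rw [Units.val_one] at this
  rw [multiplier, this, absDet_one]
  simp

lemma continuousAt_multiplier (ω : (Matrix (Fin n) (Fin n) K)ˣ →* Circle) (hω : Continuous ω)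
    (h : ℝ) {a : Matrix (Fin n) (Fin n) K} (ha : IsUnit a) : ContinuousAt (multiplier ω h) a := by
  refine (continuousAt_extendChar ω hω ha).mul ?_
  exact Complex.continuous_ofReal.continuousAt.comp
    (continuous_absDet.continuousAt.rpow_const (Or.inl (absDet_pos ha).ne'))

variable {E : Type} [NormedAddCommGroup E] [NormedSpace ℝ E] [FiniteDimensional ℝ E]
  {j : E →ₗ[ℝ] Matrix (Fin n) (Fin n) K} {G : Subgroup (GL2 n K)} {h : ℝ}

/-- A criterion for differentiability by means of a slope that is continuous at the point. -/
lemma hasFDerivAt_of_slope {f : E → E} {x : E} {Λ : E → E →L[ℝ] E} (hΛ : ContinuousAt Λ x)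
    (hf : ∀ᶠ x' in 𝓝 x, f x' - f x = Λ x' (x' - x)) : HasFDerivAt f (Λ x) x := by
  refine HasFDerivAt.of_isLittleO ?_
  rw [Asymptotics.isLittleO_iff]
  intro ε hε
  filter_upwards [hf, (Metric.continuousAt_iff'.mp hΛ) ε hε] with x' h1 h2
  rw [h1, ← _root_.sub_apply]
  refine (ContinuousLinearMap.le_opNorm _ _).trans ?_
  rw [dist_eq_norm] at h2
  gcongr

lemma continuous_leftBlock (hj : Continuous j) :
    Continuous fun p : G × E => leftBlock (p.1 : GL2 n K).val (j p.2) := by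
  have h1 : Continuous fun p : G × E => (p.1 : GL2 n K).val :=
    Units.continuous_val.comp (continuous_subtype_val.comp continuous_fst)
  have h2 : Continuous fun p : G × E => (p.1 : GL2 n K).val.toBlocks₁₁ :=
    continuous_matrix fun i k => h1.matrix_elem _ _
  have h3 : Continuous fun p : G × E => (p.1 : GL2 n K).val.toBlocks₂₁ :=
    continuous_matrix fun i k => h1.matrix_elem _ _
  exact h2.add ((hj.comp continuous_snd).matrix_mul h3)

lemma continuous_rightBlock (hj : Continuous j) :
    Continuous fun p : G × E => rightBlock (p.1 : GL2 n K).val (j p.2) := by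
  have h1 : Continuous fun p : G × E => (p.1 : GL2 n K).val :=
    Units.continuous_val.comp (continuous_subtype_val.comp continuous_fst)
  have h2 : Continuous fun p : G × E => (p.1 : GL2 n K).val.toBlocks₁₂ :=
    continuous_matrix fun i k => h1.matrix_elem _ _
  have h3 : Continuous fun p : G × E => (p.1 : GL2 n K).val.toBlocks₂₂ :=
    continuous_matrix fun i k => h1.matrix_elem _ _
  exact h2.add ((hj.comp continuous_snd).matrix_mul h3)

namespace IsAdmissible

variable (hE : IsAdmissible j G h)

include hE

lemma exists_act (g : G) (x : E) : ∃ y : E, (¬ IsUnit (leftBlock (g : GL2 n K).val (j x)) → y = x) ∧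
    (IsUnit (leftBlock (g : GL2 n K).val (j x)) → leftBlock (g : GL2 n K).val (j x) * j y =
      rightBlock (g : GL2 n K).val (j x)) := by
  by_cases hx : IsUnit (leftBlock (g : GL2 n K).val (j x))
  · obtain ⟨y, hy, -⟩ := hE.exists_frac g g.2 x hx.unit rfl
    exact ⟨y, fun h => absurd hx h, fun _ => hy⟩
  · exact ⟨x, fun _ => rfl, fun h => absurd h hx⟩

/-- The linear-fractional map, extended by the identity. -/
noncomputable def frac (g : G) (x : E) : E := (hE.exists_act g x).choose

lemma frac_of_not_isUnit {g : G} {x : E} (hx : ¬ IsUnit (leftBlock (g : GL2 n K).val (j x))) :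
    hE.frac g x = x := (hE.exists_act g x).choose_spec.1 hx

lemma leftBlock_mul_frac {g : G} {x : E} (hx : IsUnit (leftBlock (g : GL2 n K).val (j x))) :
    leftBlock (g : GL2 n K).val (j x) * j (hE.frac g x) = rightBlock (g : GL2 n K).val (j x) :=
  (hE.exists_act g x).choose_spec.2 hx

lemma frac_eq_of_mul_eq {g : G} {x y : E} (hx : IsUnit (leftBlock (g : GL2 n K).val (j x)))
    (hy : leftBlock (g : GL2 n K).val (j x) * j y = rightBlock (g : GL2 n K).val (j x)) :
    hE.frac g x = y := by
  refine hE.injective (hx.mul_left_cancel ?_)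
  rw [hy, hE.leftBlock_mul_frac hx]

/-- The cocycle identity: `(1 x) g g' = u (1 y) g'` with `u` the left block of `(1 x) g` and `y` the
image of `x`. -/
lemma leftBlock_mul_eq {g g' : G} {x : E} (hx : IsUnit (leftBlock (g : GL2 n K).val (j x))) :
    leftBlock ((g * g' : G) : GL2 n K).val (j x) =
      leftBlock (g : GL2 n K).val (j x) * leftBlock (g' : GL2 n K).val (j (hE.frac g x)) := by
  rw [Subgroup.coe_mul, Units.val_mul, leftBlock_mul, ← hE.leftBlock_mul_frac hx,
    leftBlock.eq_1 _ (j (hE.frac g x)), Matrix.mul_add, Matrix.mul_assoc]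

lemma rightBlock_mul_eq {g g' : G} {x : E} (hx : IsUnit (leftBlock (g : GL2 n K).val (j x))) :
    rightBlock ((g * g' : G) : GL2 n K).val (j x) =
      leftBlock (g : GL2 n K).val (j x) * rightBlock (g' : GL2 n K).val (j (hE.frac g x)) := by
  rw [Subgroup.coe_mul, Units.val_mul, rightBlock_mul, ← hE.leftBlock_mul_frac hx,
    rightBlock.eq_1 _ (j (hE.frac g x)), Matrix.mul_add, Matrix.mul_assoc]

/-- No inverse has to be differentiated: the difference formula `y' - y = u(x')⁻¹ (x' - x)(d - cy)`
exhibits a slope that is continuous in `x'`, and its value at `x` is the map `T`. -/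
lemma hasFDerivAt_frac {g : G} {x : E} (hx : IsUnit (leftBlock (g : GL2 n K).val (j x))) :
    ∃ f' : E →L[ℝ] E, HasFDerivAt (hE.frac g) f' x ∧
      |f'.det| = absDet (leftBlock (g : GL2 n K).val (j x)) ^ (-h) *
        absDet (g : GL2 n K).val ^ betaExp n K := by
  obtain ⟨y, hy, T, hT, hdet⟩ := hE.exists_frac g g.2 x hx.unit rfl
  have hyf : hE.frac g x = y := hE.frac_eq_of_mul_eq hx hy
  obtain ⟨p, hp⟩ := LinearMap.exists_leftInverse_of_injective j (LinearMap.ker_eq_bot.mpr hE.injective)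
  have hpj : ∀ x, p (j x) = x := fun x => LinearMap.congr_fun hp x
  set w := (g : GL2 n K).val.toBlocks₂₂ - (g : GL2 n K).val.toBlocks₂₁ * j y with hw
  set Ψ : Matrix (Fin n) (Fin n) K →ₗ[ℝ] (E →L[ℝ] E) :=
    LinearMap.toContinuousLinearMap.toLinearMap ∘ₗ
      { toFun := fun z => p ∘ₗ (LinearMap.mulRight ℝ w) ∘ₗ (LinearMap.mulLeft ℝ z) ∘ₗ j
        map_add' := by intro z z'; ext δ; simp [add_mul]
        map_smul' := by intro r z; ext δ; simp } with hΨ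
  have hΨa : ∀ z δ, Ψ z δ = p (z * j δ * w) := fun z δ => by simp [hΨ]
  have hΨc : Continuous Ψ := Ψ.continuous_of_finiteDimensional
  have hjc : Continuous j := j.continuous_of_finiteDimensional
  have hlc : Continuous fun x' => leftBlock (g : GL2 n K).val (j x') :=
    (continuous_leftBlock hjc).comp (Continuous.prodMk_right g)
  have hc : ContinuousAt (fun x' => Ψ (Ring.inverse (leftBlock (g : GL2 n K).val (j x')))) x :=
    hΨc.continuousAt.comp (ContinuousAt.comp (f := fun x' => leftBlock (g : GL2 n K).val (j x'))
      (continuousAt_matrix_ringInverse hx) hlc.continuousAt)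
  have hd := hasFDerivAt_of_slope (f := hE.frac g) hc ?_
  · refine ⟨_, hd, ?_⟩
    -- The left inverse `p` of `j` lets `Ψ` be defined for every matrix `z`. At `z = u⁻¹` it is the
    -- map `T` of the admissibility condition.
    have hTΨ : Ψ (Ring.inverse (leftBlock (g : GL2 n K).val (j x))) =
        LinearMap.toContinuousLinearMap T := by
      ext δ
      rw [hΨa]
      refine Eq.trans ?_ (hpj (T δ))
      rw [hT, ← Ring.inverse_unit, hx.unit_spec]
    rw [hTΨ, LinearMap.det_toContinuousLinearMap, hdet, hx.unit_spec]
  · filter_upwards [(isOpen_setOf_isUnit.preimage hlc).mem_nhds hx] with x' hx'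
    have hx'u : IsUnit (leftBlock (g : GL2 n K).val (j x')) := hx'
    rw [hΨa]
    refine (hpj _).symm.trans (congrArg p ?_)
    -- After multiplication by `u(x')`, the difference formula follows by eliminating `b = u y -
    -- xd`.
    refine hx'u.mul_left_cancel ?_
    rw [← Matrix.mul_assoc, ← Matrix.mul_assoc, Ring.mul_inverse_cancel _ hx'u, one_mul, map_sub,
      Matrix.mul_sub, hE.leftBlock_mul_frac hx', hyf, map_sub, hw]
    have e : rightBlock (g : GL2 n K).val (j x) = leftBlock (g : GL2 n K).val (j x) * j y := hy.symm
    rw [leftBlock, rightBlock] at *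
    have e2 : (g : GL2 n K).val.toBlocks₁₂ = ((g : GL2 n K).val.toBlocks₁₁ +
        j x * (g : GL2 n K).val.toBlocks₂₁) * j y - j x * (g : GL2 n K).val.toBlocks₂₂ := by
      rw [← e]; simp
    rw [e2]
    noncomm_ring

lemma mul_frac_isUnit {g g' : G} {x : E} (hx : IsUnit (leftBlock (g : GL2 n K).val (j x)))
    (hx' : IsUnit (leftBlock (g' : GL2 n K).val (j (hE.frac g x)))) :
    IsUnit (leftBlock ((g * g' : G) : GL2 n K).val (j x)) := by
  rw [hE.leftBlock_mul_eq hx]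
  exact hx.mul hx'

/-- The partial action by linear-fractional maps. -/
noncomputable def partialAction (ω : (Matrix (Fin n) (Fin n) K)ˣ →* Circle) (hω : Continuous ω) :
    PartialAction G E where
  dom g := {x | IsUnit (leftBlock (g : GL2 n K).val (j x))}
  act := hE.frac
  mult g x := multiplier ω h (leftBlock (g : GL2 n K).val (j x)) *
    ((absDet (g : GL2 n K).val ^ (betaExp n K / 2) : ℝ) : ℂ)
  isOpen_dom g := isOpen_setOf_isUnit.preimage
    ((continuous_leftBlock j.continuous_of_finiteDimensional).comp (Continuous.prodMk_right g))
  act_of_notMem g x hx := hE.frac_of_not_isUnit hx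
  mult_of_notMem g x hx := by
    rw [multiplier, extendChar_of_not_isUnit ω hx, zero_mul, zero_mul]
  mult_ne_zero g x hx := by
    refine mul_ne_zero ?_ ?_
    · rw [← norm_ne_zero_iff, norm_multiplier ω h hx]
      exact (Real.rpow_pos_of_pos (absDet_pos hx) _).ne'
    · exact_mod_cast (Real.rpow_pos_of_pos (absDet_pos (g : GL2 n K).isUnit) _).ne'
  continuousOn_mult g x hx := by
    have hlc : Continuous fun x' => leftBlock (g : GL2 n K).val (j x') :=
      (continuous_leftBlock j.continuous_of_finiteDimensional).comp (Continuous.prodMk_right g)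
    exact ((ContinuousAt.comp (f := fun x' => leftBlock (g : GL2 n K).val (j x'))
      (continuousAt_multiplier ω hω h hx) hlc.continuousAt).mul
        continuousAt_const).continuousWithinAt
  exists_hasFDerivAt g x hx := by
    obtain ⟨f', hf', hdet⟩ := hE.hasFDerivAt_frac hx
    refine ⟨f', hf', ?_⟩
    rw [hdet, norm_mul, norm_multiplier ω h hx, Complex.norm_real,
      Real.norm_of_nonneg (Real.rpow_nonneg (absDet_nonneg _) _), mul_pow,
      ← Real.rpow_mul_natCast (absDet_nonneg _), ← Real.rpow_mul_natCast (absDet_nonneg _)]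
    congr 2 <;> push_cast <;> ring
  one_dom := by
    ext x
    simp [leftBlock_one]
  one_act x := by
    refine hE.frac_eq_of_mul_eq ?_ ?_
    · simp [leftBlock_one]
    · simp [leftBlock_one, rightBlock_one]
  one_mult x := by
    simp [leftBlock_one, multiplier_one, absDet_one]
  inv_dom g x hx := by
    -- The cocycle identity for `g g⁻¹ = 1` displays the inverse of the left block at the image
    -- point.
    have h1 := hE.leftBlock_mul_eq (g' := g⁻¹) hx
    rw [mul_inv_cancel, Subgroup.coe_one, Units.val_one, leftBlock_one] at h1
    exact ⟨⟨_, _, mul_eq_one_comm.mp h1.symm, h1.symm⟩, rfl⟩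
  mul_dom g g' x hx hx' := hE.mul_frac_isUnit hx hx'
  mul_act g g' x hx hx' := by
    refine hE.frac_eq_of_mul_eq (hE.mul_frac_isUnit hx hx') ?_
    rw [hE.leftBlock_mul_eq hx, hE.rightBlock_mul_eq hx, Matrix.mul_assoc,
      hE.leftBlock_mul_frac hx']
  mul_mult g g' x hx hx' := by
    rw [hE.leftBlock_mul_eq hx, multiplier_mul ω h hx hx', Subgroup.coe_mul, Units.val_mul,
      absDet_mul, Real.mul_rpow (absDet_nonneg _) (absDet_nonneg _), Complex.ofReal_mul]
    ring

variable [MeasurableSpace E] [BorelSpace E] (μ : Measure E) [μ.IsAddHaarMeasure]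

lemma ae_isUnit_leftBlock (g : G) :
    ∀ᵐ x ∂μ, IsUnit (leftBlock (g : GL2 n K).val (j x)) := by
  obtain ⟨x₀, hx₀⟩ := hE.exists_isUnit_leftBlock g g.2
  exact ae_isUnit_add μ (g : GL2 n K).val.toBlocks₁₁
    (LinearMap.mulRight ℝ (g : GL2 n K).val.toBlocks₂₁ ∘ₗ j) hx₀

/-- The degenerate principal series. -/
noncomputable def principalSeries (ω : (Matrix (Fin n) (Fin n) K)ˣ →* Circle) (hω : Continuous ω) :
    G →* (Lp ℂ 2 μ ≃ₗᵢ[ℂ] Lp ℂ 2 μ) :=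
  (hE.partialAction ω hω).rep μ (hE.ae_isUnit_leftBlock μ)

lemma coeFn_principalSeries (ω : (Matrix (Fin n) (Fin n) K)ˣ →* Circle) (hω : Continuous ω)
    (g : G) (F : Lp ℂ 2 μ) : ∀ᵐ x ∂μ, ∃ (u : (Matrix (Fin n) (Fin n) K)ˣ) (y : E),
      (u : Matrix (Fin n) (Fin n) K) = leftBlock (g : GL2 n K).val (j x) ∧
      j y = (↑u⁻¹ : Matrix (Fin n) (Fin n) K) * rightBlock (g : GL2 n K).val (j x) ∧
      hE.principalSeries μ ω hω g F x = (ω u : ℂ) *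
        ((absDet (u : Matrix (Fin n) (Fin n) K) ^ (-h / 2) *
          absDet (g : GL2 n K).val ^ (betaExp n K / 2) : ℝ) : ℂ) * F y := by
  filter_upwards [(hE.partialAction ω hω).coeFn_rep μ (hE.ae_isUnit_leftBlock μ) g F,
    hE.ae_isUnit_leftBlock μ g] with x hx hu
  obtain ⟨u, hu'⟩ := hu
  refine ⟨u, hE.frac g x, hu', ?_, ?_⟩
  · rw [← hE.leftBlock_mul_frac ⟨u, hu'⟩, ← hu', ← Matrix.mul_assoc, u.inv_mul, one_mul]
  · refine hx.trans ?_
    change multiplier ω h (leftBlock (g : GL2 n K).val (j x)) * _ * F (hE.frac g x) = _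
    rw [← hu', multiplier, extendChar_unit]
    push_cast
    ring

lemma isStronglyContinuous_principalSeries (ω : (Matrix (Fin n) (Fin n) K)ˣ →* Circle)
    (hω : Continuous ω) : IsStronglyContinuous (hE.principalSeries μ ω hω) := by
  have hfc : FirstCountableTopology (Matrix (Fin n ⊕ Fin n) (Fin n ⊕ Fin n) K) :=
    inferInstanceAs (FirstCountableTopology (Fin n ⊕ Fin n → Fin n ⊕ Fin n → K))
  have hfc' : FirstCountableTopology (GL2 n K) :=
    isOpenEmbedding_unitsVal.isInducing.firstCountableTopology
  have hfc'' : FirstCountableTopology G :=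
    Topology.IsInducing.subtypeVal.firstCountableTopology
  have hjc : Continuous j := j.continuous_of_finiteDimensional
  have hl := continuous_leftBlock (G := G) hjc
  have h1 : ∀ x, IsUnit (leftBlock ((1 : G) : GL2 n K).val (j x)) := fun x => by
    simp [leftBlock_one]
  refine (hE.partialAction ω hω).isStronglyContinuous_rep μ (hE.ae_isUnit_leftBlock μ) ?_ ?_
  · intro x
    obtain ⟨p, hp⟩ := LinearMap.exists_leftInverse_of_injective j
      (LinearMap.ker_eq_bot.mpr hE.injective)
    have hpj : ∀ x, p (j x) = x := fun x => LinearMap.congr_fun hp x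
    have hpc : Continuous p := p.continuous_of_finiteDimensional
    have h2 : ContinuousAt (fun q : G × E => p (Ring.inverse (leftBlock (q.1 : GL2 n K).val (j q.2))
        * rightBlock (q.1 : GL2 n K).val (j q.2))) (1, x) := by
      refine hpc.continuousAt.comp (ContinuousAt.mul ?_ (continuous_rightBlock hjc).continuousAt)
      exact ContinuousAt.comp (f := fun q : G × E => leftBlock (q.1 : GL2 n K).val (j q.2))
        (continuousAt_matrix_ringInverse (h1 x)) hl.continuousAt
    refine h2.congr ?_
    filter_upwards [(isOpen_setOf_isUnit.preimage hl).mem_nhds (h1 x)] with q hq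
    have hq' : IsUnit (leftBlock (q.1 : GL2 n K).val (j q.2)) := hq
    change _ = hE.frac q.1 q.2
    rw [← hE.leftBlock_mul_frac hq', ← Matrix.mul_assoc, Ring.inverse_mul_cancel _ hq', one_mul,
      hpj]
  · intro x
    have h3 : Continuous fun q : G × E => absDet (q.1 : GL2 n K).val :=
      continuous_absDet.comp
        (Units.continuous_val.comp (continuous_subtype_val.comp continuous_fst))
    refine ContinuousAt.mul ?_ ?_
    · exact ContinuousAt.comp (f := fun q : G × E => leftBlock (q.1 : GL2 n K).val (j q.2))
        (continuousAt_multiplier ω hω h (h1 x)) hl.continuousAt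
    · exact Complex.continuous_ofReal.continuousAt.comp
        (h3.continuousAt.rpow_const (Or.inl (absDet_pos (Units.isUnit _)).ne'))

lemma coeFn_principalSeries_parabolic (ω : (Matrix (Fin n) (Fin n) K)ˣ →* Circle)
    (hω : Continuous ω) (p : parabolic G) (F : Lp ℂ 2 μ) : ∃ a : (Matrix (Fin n) (Fin n) K)ˣ,
    (a : Matrix (Fin n) (Fin n) K) = (p : GL2 n K).val.toBlocks₁₁ ∧
    ∀ᵐ x : E ∂μ, ∃ y : E,
      j y = (↑a⁻¹ : Matrix (Fin n) (Fin n) K) * rightBlock (p : GL2 n K).val (j x) ∧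
      hE.principalSeries μ ω hω p F x = (ω a : ℂ) *
        ((absDet (a : Matrix (Fin n) (Fin n) K) ^ ((betaExp n K - h) / 2) *
          absDet (p : GL2 n K).val.toBlocks₂₂ ^ (betaExp n K / 2) : ℝ) : ℂ) * F y := by
  have hp : (p : GL2 n K).val.toBlocks₂₁ = 0 := p.2
  have hl : ∀ x, leftBlock (p : GL2 n K).val (j x) = (p : GL2 n K).val.toBlocks₁₁ := by
    intro x
    rw [leftBlock, hp, Matrix.mul_zero, add_zero]
  -- For `c = 0` the left block is `a` at every `x`, so one generic point already shows that `a` is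
  -- invertible.
  have key := hE.coeFn_principalSeries μ ω hω p F
  obtain ⟨x₀, a, -, ha, -⟩ := key.exists
  rw [hl] at ha
  refine ⟨a, ha, ?_⟩
  filter_upwards [key] with x hx
  obtain ⟨u, y, hu, hy, hF⟩ := hx
  have hua : u = a := Units.ext (by rw [hu, hl, ha])
  subst hua
  refine ⟨y, hy, hF.trans ?_⟩
  -- Since `|det g| = |det a| |det d|`, the exponent of `|det a|` becomes `-h/2 + β/2`.
  have hg : absDet (p : GL2 n K).val = absDet (u : Matrix (Fin n) (Fin n) K) *
      absDet (p : GL2 n K).val.toBlocks₂₂ := by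
    conv_lhs => rw [← fromBlocks_toBlocks (p : GL2 n K).val, hp, absDet_fromBlocks_zero₂₁, ← ha]
  congr 3
  rw [hg, Real.mul_rpow (absDet_nonneg _) (absDet_nonneg _), ← mul_assoc,
    ← Real.rpow_add (absDet_pos u.isUnit)]
  congr 2
  ring

/-- The element `(a ac; 0 d)` substitutes `T x + c` for `x` up to a nonzero constant, so
`eq_bot_or_eq_top_of_invariant` applies. The parameter `a` runs over all matrices with additive Haar
measure, for which the units are conull. -/
lemma isIrreducibleRep_parabolic (ω : (Matrix (Fin n) (Fin n) K)ˣ →* Circle) (hω : Continuous ω) :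
    IsIrreducibleRep ((hE.principalSeries μ ω hω).comp (parabolic G).subtype) := by
  refine ⟨nontrivial_Lp μ, fun V hV hinv => ?_⟩
  obtain ⟨B, hB, S, hS, hST, ⟨y₀, hy₀⟩, htrans⟩ := hE.exists_pairing
  have : ProperSpace K := FiniteDimensional.proper ℝ K
  let _ : MeasurableSpace K := borel K
  have : BorelSpace K := ⟨rfl⟩
  have : ProperSpace E := FiniteDimensional.proper ℝ E
  have : SecondCountableTopology K := secondCountable_of_proper
  have : SecondCountableTopology E := secondCountable_of_proper
  let m : (Fin n → Fin n → K) ≃ₗ[ℝ] Matrix (Fin n) (Fin n) K := Matrix.ofLinearEquiv ℝ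
  set ν : Measure (Fin n → Fin n → K) := Measure.addHaar
  have hν : ν ≠ 0 := NeZero.ne ν
  have hSc : Continuous fun q : (Fin n → Fin n → K) × E => S (m q.1) q.2 := hS
  have hS' : Measurable fun q : (Fin n → Fin n → K) × E => S (m q.1) q.2 :=
    hSc.measurable
  have hO : ∀ᵐ y ∂μ, y ∈ {y : E | IsUnit (j y)} := by
    have := ae_isUnit_add μ 0 j (x₀ := y₀) (by simpa using hy₀)
    simpa using this
  have hU : ∀ᵐ a ∂ν, IsUnit (m a) := by
    have := ae_isUnit_add ν 0 (m : (Fin n → Fin n → K) →ₗ[ℝ] Matrix (Fin n) (Fin n) K)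
      (x₀ := m.symm 1) (by simp)
    simpa using this
  refine eq_bot_or_eq_top_of_invariant μ ν B hB hν (fun a => S (m a)) hS' hO ?_ V hV ?_
  · intro ξ hξ η hη
    obtain ⟨b, hb⟩ := htrans ξ η hξ hη
    -- Left multiplication by a unit is an invertible linear map of the parameter space, hence
    -- preserves null sets.
    let L : Matrix (Fin n) (Fin n) K ≃ₗ[ℝ] Matrix (Fin n) (Fin n) K :=
      { toFun := fun a => b * a
        invFun := fun a => (↑b⁻¹ : Matrix (Fin n) (Fin n) K) * a
        map_add' := fun x y => mul_add _ _ _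
        map_smul' := fun r x => by simp
        left_inv := fun a => by
          change (↑b⁻¹ : Matrix (Fin n) (Fin n) K) * ((b : Matrix (Fin n) (Fin n) K) * a) = a
          rw [← Matrix.mul_assoc, b.inv_mul, one_mul]
        right_inv := fun a => by
          change (b : Matrix (Fin n) (Fin n) K) * ((↑b⁻¹ : Matrix (Fin n) (Fin n) K) * a) = a
          rw [← Matrix.mul_assoc, b.mul_inv, one_mul] }
    refine ⟨fun a => m.symm (L (m a)), ?_, fun a => ?_⟩
    · exact quasiMeasurePreserving_linearEquiv
        ((m.trans L).trans m.symm).toContinuousLinearEquiv ν ν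
    · rw [m.apply_symm_apply]
      exact hb _
  · filter_upwards [hU] with a ha
    obtain ⟨u, hu⟩ := ha
    obtain ⟨L, T, d, hg, hT, hL, hLT⟩ := hST u
    refine ⟨L, T, fun y => by rw [hL, hu], hLT, fun c F hF => ?_⟩
    obtain ⟨g, hgG, hgc⟩ := hg c
    have hgP : (⟨g, hgG⟩ : G) ∈ parabolic G := by
      change g.val.toBlocks₂₁ = 0
      rw [hgc, toBlocks_fromBlocks₂₁]
    refine ⟨_, hinv ⟨⟨g, hgG⟩, hgP⟩ F hF, (ω u : ℂ) *
        ((absDet (u : Matrix (Fin n) (Fin n) K) ^ (-h / 2) *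
          absDet g.val ^ (betaExp n K / 2) : ℝ) : ℂ), ?_, ?_⟩
    · refine mul_ne_zero (Circle.coe_ne_zero _) ?_
      exact_mod_cast (mul_pos (Real.rpow_pos_of_pos (absDet_pos u.isUnit) _)
        (Real.rpow_pos_of_pos (absDet_pos g.isUnit) _)).ne'
    · filter_upwards [hE.coeFn_principalSeries μ ω hω ⟨g, hgG⟩ F] with x hx
      obtain ⟨u', y, hu', hy, hF'⟩ := hx
      have huu : u' = u := by
        refine Units.ext ?_
        rw [hu', leftBlock]
        simp [hgc]
      subst huu
      have hyT : y = T x + c := by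
        refine hE.injective ?_
        rw [hy, rightBlock, map_add, hT]
        simp only [hgc, toBlocks_fromBlocks₁₂, toBlocks_fromBlocks₂₂]
        rw [Matrix.mul_add, ← Matrix.mul_assoc, u'.inv_mul, one_mul, ← Matrix.mul_assoc, add_comm]
      rw [← hyT]
      exact hF'

lemma isIrreducibleRep (ω : (Matrix (Fin n) (Fin n) K)ˣ →* Circle) (hω : Continuous ω) :
    IsIrreducibleRep (hE.principalSeries μ ω hω) := by
  obtain ⟨h1, h2⟩ := hE.isIrreducibleRep_parabolic μ ω hω
  exact ⟨h1, fun V hV hinv => h2 V hV fun p => hinv p⟩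

end IsAdmissible

end Admissible

/-! ### From admissibility to the principal series. -/

section Main

variable {n : ℕ} {K : Type} [NormedDivisionRing K] [NormedAlgebra ℝ K] [FiniteDimensional ℝ K]

theorem IsAdmissible.principalSeriesIrreducible {M : Submodule ℝ (Matrix (Fin n) (Fin n) K)}
    {G : Subgroup (GL2 n K)} (hM : IsAdmissible M.subtype G (hExp M)) :
    PrincipalSeriesIrreducible M G := by
  intro _ hB μ hμ ω hω
  -- The claim involves only the topology and the Borel sets of `M`. An auxiliary norm inducing this
  -- topology is chosen for the differential calculus.
  let i₁ : NormedAddCommGroup (Matrix (Fin n) (Fin n) K) := Matrix.normedAddCommGroup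
  let i₂ : NormedSpace ℝ (Matrix (Fin n) (Fin n) K) := Matrix.normedSpace
  let i₃ : NormedAddCommGroup M := inferInstance
  let i₄ : NormedSpace ℝ M := inferInstance
  have key := fun hE => @IsAdmissible.coeFn_principalSeries n K _ _ _ M i₃ i₄ _ M.subtype G (hExp M)
    hE _ hB μ hμ ω hω
  have key₁ := fun hE => @IsAdmissible.isStronglyContinuous_principalSeries n K _ _ _ M i₃ i₄ _
    M.subtype G (hExp M) hE _ hB μ hμ ω hω
  have key₂ := fun hE => @IsAdmissible.coeFn_principalSeries_parabolic n K _ _ _ M i₃ i₄ _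
    M.subtype G (hExp M) hE _ hB μ hμ ω hω
  have key₃ := fun hE => @IsAdmissible.isIrreducibleRep_parabolic n K _ _ _ M i₃ i₄ _
    M.subtype G (hExp M) hE _ hB μ hμ ω hω
  have key₄ := fun hE => @IsAdmissible.isIrreducibleRep n K _ _ _ M i₃ i₄ _
    M.subtype G (hExp M) hE _ hB μ hμ ω hω
  exact ⟨_, key hM, key₁ hM, key₂ hM, key₃ hM, key₄ hM⟩

end Main

/-! ### Jacobians of the maps `x ↦ a x d` -/

section Jacobian

variable {K : Type} [NormedDivisionRing K] [NormedAlgebra ℝ K] [FiniteDimensional ℝ K]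
  {ι : Type} [Fintype ι] [DecidableEq ι]

lemma continuous_det_of_pointwise {X E : Type*} [TopologicalSpace X] [AddCommGroup E] [Module ℝ E]
    [TopologicalSpace E] [IsTopologicalAddGroup E] [ContinuousSMul ℝ E] [T2Space E]
    [FiniteDimensional ℝ E] {Φ : X → Module.End ℝ E} (hΦ : ∀ v, Continuous fun a => Φ a v) :
    Continuous fun a => LinearMap.det (Φ a) := by
  let b := Module.finBasis ℝ E
  simp only [← LinearMap.det_toMatrix b]
  refine Continuous.matrix_det (continuous_matrix fun p q => ?_)
  simp only [LinearMap.toMatrix_apply]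
  exact (b.coord p).continuous_of_finiteDimensional.comp (hΦ (b q))

/-- Homogeneous multiplicative families of operators have a power of `absDet` as determinant. -/
theorem abs_det_eq_absDet_rpow {E : Type*} [AddCommGroup E] [Module ℝ E]
    [TopologicalSpace E] [IsTopologicalAddGroup E] [ContinuousSMul ℝ E] [T2Space E]
    [FiniteDimensional ℝ E] {Φ : Matrix ι ι K → Module.End ℝ E}
    (hΦ : ∀ v, Continuous fun a => Φ a v) (hone : Φ 1 = 1)
    (hmul : ∀ a b, LinearMap.det (Φ (a * b)) = LinearMap.det (Φ a) * LinearMap.det (Φ b))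
    {k : ℕ} (hk : ∀ r : ℝ, Φ (r • 1) = r ^ k • 1) {p : ℝ} (hp : 0 ≤ p)
    (hkp : Fintype.card ι * p = k * Module.finrank ℝ E) {a : Matrix ι ι K} (ha : IsUnit a) :
    |LinearMap.det (Φ a)| = absDet a ^ p := by
  let χ₁ : Matrix ι ι K →* ℝ :=
    { toFun := fun a => |LinearMap.det (Φ a)|
      map_one' := by rw [hone, map_one, abs_one]
      map_mul' := fun a b => by rw [hmul, abs_mul] }
  let χ₂ : Matrix ι ι K →* ℝ :=
    { toFun := fun a => absDet a ^ p
      map_one' := by rw [absDet_one, Real.one_rpow]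
      map_mul' := fun a b => by
        rw [absDet_mul, Real.mul_rpow (absDet_nonneg _) (absDet_nonneg _)] }
  refine character_eq_of_eq_on_scalars χ₁ χ₂ (continuous_det_of_pointwise hΦ).abs
    (continuous_absDet.rpow_const fun _ => Or.inr hp) (fun _ => abs_nonneg _)
    (fun _ => Real.rpow_nonneg (absDet_nonneg _) _) (fun r hr => ?_) ha
  -- On a scalar `r` the two sides are `r^(k dim E)` and `r^(p · card ι)`, whence the condition on
  -- `p`.
  change |LinearMap.det (Φ (r • 1))| = absDet (r • (1 : Matrix ι ι K)) ^ p
  rw [hk, LinearMap.det_smul, map_one, mul_one, absDet_smul_one, abs_of_pos hr,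
    abs_of_pos (by positivity), ← pow_mul, ← Real.rpow_natCast, ← Real.rpow_natCast,
    ← Real.rpow_mul hr.le, hkp]
  push_cast
  rfl

variable {M : Submodule ℝ (Matrix ι ι K)}

/-- The map `x ↦ a x d` of matrices. -/
noncomputable def sandwich (a d : Matrix ι ι K) : Matrix ι ι K →ₗ[ℝ] Matrix ι ι K :=
  LinearMap.mulLeft ℝ a ∘ₗ LinearMap.mulRight ℝ d

lemma sandwich_apply (a d x : Matrix ι ι K) : sandwich a d x = a * x * d := by
  simp [sandwich, Matrix.mul_assoc]

/-- The map `x ↦ a x d` of a space of matrices. -/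
noncomputable def sandwichOn (a d : Matrix ι ι K) (h : ∀ x ∈ M, a * x * d ∈ M) : Module.End ℝ M :=
  (sandwich a d).restrict fun x hx => by
    rw [sandwich_apply]
    exact h x hx

lemma coe_sandwichOn (a d : Matrix ι ι K) (h : ∀ x ∈ M, a * x * d ∈ M) (x : M) :
    (sandwichOn a d h x : Matrix ι ι K) = a * x * d := sandwich_apply a d x

/-- The map `x ↦ a x d` of a space of matrices for units `a` and `d`. -/
noncomputable def sandwichEquiv (a d : (Matrix ι ι K)ˣ) (h : ∀ x ∈ M, (a : Matrix ι ι K) * x * d ∈ M)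
    (h' : ∀ x ∈ M, (↑a⁻¹ : Matrix ι ι K) * x * (↑d⁻¹ : Matrix ι ι K) ∈ M) : M ≃ₗ[ℝ] M :=
  LinearEquiv.ofLinearMap (sandwichOn _ _ h) (sandwichOn _ _ h')
    (by
      ext1 x
      refine Subtype.ext ?_
      change (sandwichOn _ _ h (sandwichOn _ _ h' x) : Matrix ι ι K) = x
      rw [coe_sandwichOn, coe_sandwichOn]
      simp only [Matrix.mul_assoc]
      simp)
    (by
      ext1 x
      refine Subtype.ext ?_
      change (sandwichOn _ _ h' (sandwichOn _ _ h x) : Matrix ι ι K) = x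
      rw [coe_sandwichOn, coe_sandwichOn]
      simp only [Matrix.mul_assoc]
      simp)

lemma coe_sandwichEquiv (a d : (Matrix ι ι K)ˣ) (h : ∀ x ∈ M, (a : Matrix ι ι K) * x * d ∈ M)
    (h' : ∀ x ∈ M, (↑a⁻¹ : Matrix ι ι K) * x * (↑d⁻¹ : Matrix ι ι K) ∈ M) (x : M) :
    (sandwichEquiv a d h h' x : Matrix ι ι K) = a * x * d := coe_sandwichOn _ _ h x

/-- The trace form defined by a linear form on `K`. -/
noncomputable def traceForm (t : K →ₗ[ℝ] ℝ) : Matrix ι ι K →ₗ[ℝ] Matrix ι ι K →ₗ[ℝ] ℝ :=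
  (LinearMap.mul ℝ (Matrix ι ι K)).compr₂ (t ∘ₗ Matrix.traceLinearMap ι ℝ K)

lemma traceForm_apply (t : K →ₗ[ℝ] ℝ) (y x : Matrix ι ι K) :
    traceForm t y x = t (trace (y * x)) := rfl

lemma eq_zero_of_traceForm_eq_zero {t : K →ₗ[ℝ] ℝ} (ht : t 1 ≠ 0) {y : Matrix ι ι K}
    (hy : ∀ x, traceForm t y x = 0) : y = 0 := by
  ext i j
  by_contra h
  have := hy (Matrix.single j i (y i j)⁻¹)
  rw [traceForm_apply, trace_mul_single, op_smul_eq_mul,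
    mul_inv_cancel₀ h] at this
  exact ht this

end Jacobian

/-! ### Block factorizations. -/

section Factor

variable {n : ℕ} {K : Type} [DivisionRing K]

lemma fromBlocks_one_mul (g : Matrix (Fin n ⊕ Fin n) (Fin n ⊕ Fin n) K)
    (x : Matrix (Fin n) (Fin n) K) : fromBlocks 1 x 0 1 * g =
      fromBlocks (leftBlock g x) (rightBlock g x) g.toBlocks₂₁ g.toBlocks₂₂ := by
  conv_lhs => rw [← fromBlocks_toBlocks g, fromBlocks_multiply]
  simp [leftBlock, rightBlock]

/-- Taking determinants gives `|det g| = |det u| |det (d - cy)|`, which controls the right factor of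
the derivative. -/
lemma fromBlocks_one_mul_eq {g : Matrix (Fin n ⊕ Fin n) (Fin n ⊕ Fin n) K}
    {x y : Matrix (Fin n) (Fin n) K} (h : leftBlock g x * y = rightBlock g x) :
    fromBlocks 1 x 0 1 * g = fromBlocks (leftBlock g x) 0 g.toBlocks₂₁
      (g.toBlocks₂₂ - g.toBlocks₂₁ * y) * fromBlocks 1 y 0 1 := by
  rw [fromBlocks_one_mul, fromBlocks_multiply]
  simp [h]

lemma exists_units_fromBlocks (a d : (Matrix (Fin n) (Fin n) K)ˣ) (b : Matrix (Fin n) (Fin n) K) :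
    ∃ g : GL2 n K, g.val = fromBlocks (a : Matrix (Fin n) (Fin n) K) b 0 d := by
  refine ⟨⟨fromBlocks a.val b 0 d.val, fromBlocks (a⁻¹).val (-((a⁻¹).val * b * (d⁻¹).val)) 0
    (d⁻¹).val, ?_, ?_⟩, rfl⟩ <;>
    simp [fromBlocks_multiply, ← Matrix.mul_assoc]

lemma exists_mul_add_mul_eq_one (g : GL2 n K) : ∃ p q : Matrix (Fin n) (Fin n) K,
    p * g.val.toBlocks₁₁ + q * g.val.toBlocks₂₁ = 1 := by
  refine ⟨(g⁻¹).val.toBlocks₁₁, (g⁻¹).val.toBlocks₁₂, ?_⟩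
  have h := congrArg toBlocks₁₁ g.inv_mul
  rw [mul_eq_fromBlocks, toBlocks_fromBlocks₁₁] at h
  rw [h, ← fromBlocks_one, toBlocks_fromBlocks₁₁]

lemma coordProj_mul_self {ι : Type} [Fintype ι] [DecidableEq ι] (D : Finset ι) :
    coordProj K D * coordProj K D = coordProj K D := by
  rw [coordProj, diagonal_mul_diagonal]
  congr 1
  ext i
  split_ifs <;> simp

end Factor

/-! ### The space of all matrices and the general linear group. -/

section FullMatrices

variable {n : ℕ} {K : Type} [NormedDivisionRing K] [NormedAlgebra ℝ K] [FiniteDimensional ℝ K]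

/-- With `l a m = E` a coordinate projection and `p a + q c = 1`, the choice `x = l⁻¹ (1 - E) m⁻¹ q`
makes `a + xc` equal to `l⁻¹ (1 - z) m⁻¹`, where `z = (1 - E) m⁻¹ p l⁻¹ E` has square zero. -/
lemma exists_isUnit_leftBlock_top (g : GL2 n K) :
    ∃ x, IsUnit (leftBlock g.val x) := by
  obtain ⟨p, q, hpq⟩ := exists_mul_add_mul_eq_one g
  obtain ⟨l, m, D, hE⟩ := exists_units_mul_mul_eq_coordProj g.val.toBlocks₁₁
  set E := coordProj K D with hEdef
  have hEE : E * E = E := coordProj_mul_self D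
  set a := g.val.toBlocks₁₁
  set c := g.val.toBlocks₂₁
  set z : Matrix (Fin n) (Fin n) K := (1 - E) * ((m⁻¹).val * p * (l⁻¹).val) * E with hz
  have hzz : z * z = 0 := by
    have : E * (1 - E) = 0 := by rw [mul_sub, hEE, mul_one, sub_self]
    calc z * z = (1 - E) * ((m⁻¹).val * p * (l⁻¹).val) * (E * (1 - E)) * ((m⁻¹).val * p * (l⁻¹).val) * E := by
          rw [hz]; simp only [mul_assoc]
      _ = 0 := by rw [this]; simp
  have hu : IsUnit (1 + -z) := isUnit_one_add_of_mul_self (by rw [neg_mul_neg, hzz])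
  have hc : (m⁻¹).val * q * c * m.val = 1 - (m⁻¹).val * p * (l⁻¹).val * E := by
    have ha : a = (l⁻¹).val * E * (m⁻¹).val := by rw [← hE]; simp [mul_assoc]
    rw [eq_sub_iff_add_eq']
    calc (m⁻¹).val * p * (l⁻¹).val * E + (m⁻¹).val * q * c * m.val
        = (m⁻¹).val * (p * ((l⁻¹).val * E * (m⁻¹).val) + q * c) * m.val := by
          simp [mul_add, add_mul, mul_assoc]
      _ = 1 := by rw [← ha, hpq]; simp
  refine ⟨(l⁻¹).val * (1 - E) * (m⁻¹).val * q, ?_⟩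
  have key : leftBlock g.val ((l⁻¹).val * (1 - E) * (m⁻¹).val * q) = (l⁻¹).val * (1 + -z) * (m⁻¹).val := by
    have ha : a = (l⁻¹).val * E * (m⁻¹).val := by rw [← hE]; simp [mul_assoc]
    have : (m⁻¹).val * q * c = (1 - (m⁻¹).val * p * (l⁻¹).val * E) * (m⁻¹).val := by
      rw [← hc]; simp [mul_assoc]
    calc a + (l⁻¹).val * (1 - E) * (m⁻¹).val * q * c
        = (l⁻¹).val * E * (m⁻¹).val + (l⁻¹).val * (1 - E) * ((m⁻¹).val * q * c) := by
          rw [ha]; simp only [mul_assoc]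
      _ = _ := by rw [this, hz]; noncomm_ring
  rw [key]
  exact ((l⁻¹).isUnit.mul hu).mul (m⁻¹).isUnit

lemma isUnit_of_absDet_ne_zero {ι : Type} [Fintype ι] [DecidableEq ι] {a : Matrix ι ι K}
    (h : absDet a ≠ 0) : IsUnit a := by
  refine (det_mulVecReal_ne_zero_iff a).mp fun h0 => h ?_
  rw [absDet, h0, abs_zero, Real.zero_rpow]
  have : Module.finrank ℝ K ≠ 0 := Module.finrank_pos.ne'
  positivity

lemma finrank_top_matrix :
    Module.finrank ℝ (⊤ : Submodule ℝ (Matrix (Fin n) (Fin n) K)) =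
      n * n * Module.finrank ℝ K := by
  rw [finrank_top, Module.finrank_matrix]
  simp

lemma hExp_top : hExp (⊤ : Submodule ℝ (Matrix (Fin n) (Fin n) K)) = 2 * betaExp n K := by
  rw [hExp, finrank_top_matrix, betaExp]
  rcases eq_or_ne n 0 with rfl | hn
  · simp
  · push_cast
    field_simp

lemma abs_det_sandwichOn_left {a : Matrix (Fin n) (Fin n) K} (ha : IsUnit a) :
    |LinearMap.det (sandwichOn (M := ⊤) a 1 fun _ _ => Submodule.mem_top)| = absDet a ^ betaExp n K := by
  refine abs_det_eq_absDet_rpow (k := 1)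
    (Φ := fun a : Matrix (Fin n) (Fin n) K => sandwichOn (M := ⊤) a 1 fun _ _ => Submodule.mem_top)
    (fun v => ?_) ?_ (fun a b => ?_) (fun r => ?_) ?_ ?_ ha
  · refine Topology.IsInducing.subtypeVal.continuous_iff.mpr ?_
    simp only [Function.comp_def, coe_sandwichOn]
    exact (continuous_id.matrix_mul continuous_const).matrix_mul continuous_const
  · ext1 δ
    refine Subtype.ext ((coe_sandwichOn _ _ _ δ).trans ?_)
    simp
  · rw [← map_mul]
    congr 1
    ext1 δ
    refine Subtype.ext ((coe_sandwichOn _ _ _ δ).trans ?_)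
    rw [Module.End.mul_apply, coe_sandwichOn, coe_sandwichOn]
    simp [mul_assoc]
  · ext1 δ
    refine Subtype.ext ((coe_sandwichOn _ _ _ δ).trans ?_)
    simp
  · rw [betaExp]; positivity
  · rw [finrank_top_matrix, betaExp, Fintype.card_fin]
    push_cast
    ring

lemma abs_det_sandwichOn_right {a : Matrix (Fin n) (Fin n) K} (ha : IsUnit a) :
    |LinearMap.det (sandwichOn (M := ⊤) 1 a fun _ _ => Submodule.mem_top)| = absDet a ^ betaExp n K := by
  refine abs_det_eq_absDet_rpow (k := 1)
    (Φ := fun a : Matrix (Fin n) (Fin n) K => sandwichOn (M := ⊤) 1 a fun _ _ => Submodule.mem_top)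
    (fun v => ?_) ?_ (fun a b => ?_) (fun r => ?_) ?_ ?_ ha
  · refine Topology.IsInducing.subtypeVal.continuous_iff.mpr ?_
    simp only [Function.comp_def, coe_sandwichOn]
    exact continuous_const.matrix_mul continuous_id
  · ext1 δ
    refine Subtype.ext ((coe_sandwichOn _ _ _ δ).trans ?_)
    simp
  · rw [mul_comm, ← map_mul]
    congr 1
    ext1 δ
    refine Subtype.ext ((coe_sandwichOn _ _ _ δ).trans ?_)
    rw [Module.End.mul_apply, coe_sandwichOn, coe_sandwichOn]
    simp [mul_assoc]
  · ext1 δ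
    refine Subtype.ext ((coe_sandwichOn _ _ _ δ).trans ?_)
    simp
  · rw [betaExp]; positivity
  · rw [finrank_top_matrix, betaExp, Fintype.card_fin]
    push_cast
    ring

theorem isAdmissible_top {t : K →ₗ[ℝ] ℝ} (ht : t 1 ≠ 0) :
    IsAdmissible (⊤ : Submodule ℝ (Matrix (Fin n) (Fin n) K)).subtype (⊤ : Subgroup (GL2 n K))
      (hExp (⊤ : Submodule ℝ (Matrix (Fin n) (Fin n) K))) where
  injective := Subtype.val_injective
  exists_frac g _ x u hu := by
    set y : Matrix (Fin n) (Fin n) K := (u⁻¹).val * rightBlock g.val x with hy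
    have huy : (u : Matrix (Fin n) (Fin n) K) * y = rightBlock g.val x := by
      rw [hy, ← mul_assoc, u.mul_inv, one_mul]
    have hfac := fromBlocks_one_mul_eq (g := g.val) (x := (x : Matrix (Fin n) (Fin n) K)) (y := y)
      (by rw [← huy, hu]; rfl)
    set w := g.val.toBlocks₂₂ - g.val.toBlocks₂₁ * y with hw
    have hdet : absDet g.val = absDet (u : Matrix (Fin n) (Fin n) K) * absDet w := by
      have := congrArg absDet hfac
      rwa [absDet_mul, absDet_mul, absDet_fromBlocks_zero₂₁, absDet_fromBlocks_zero₂₁,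
        absDet_fromBlocks_zero₁₂, absDet_one, one_mul, one_mul, mul_one,
        show leftBlock g.val x = u from hu.symm] at this
    have hwu : IsUnit w := by
      refine isUnit_of_absDet_ne_zero fun h0 => ?_
      rw [h0, mul_zero] at hdet
      exact (absDet_pos g.isUnit).ne' hdet
    refine ⟨⟨y, Submodule.mem_top⟩, huy, sandwichOn ((u⁻¹).val) w fun _ _ => Submodule.mem_top,
      fun δ => coe_sandwichOn _ _ (fun _ _ => Submodule.mem_top) δ, ?_⟩
    have hcomp : sandwichOn (M := ⊤) (u⁻¹).val w (fun _ _ => Submodule.mem_top) =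
        sandwichOn (M := ⊤) (u⁻¹).val 1 (fun _ _ => Submodule.mem_top) *
          sandwichOn (M := ⊤) 1 w (fun _ _ => Submodule.mem_top) := by
      ext1 δ
      refine Subtype.ext ((coe_sandwichOn _ _ _ δ).trans ?_)
      rw [Module.End.mul_apply, coe_sandwichOn, coe_sandwichOn]
      simp [mul_assoc]
    -- The left and right factors contribute `|det u|^(-β)` and `|det w|^β = (|det g| / |det u|)^β`,
    -- and `h = 2β`.
    rw [hcomp, map_mul, abs_mul, abs_det_sandwichOn_left (u⁻¹).isUnit,
      abs_det_sandwichOn_right hwu, hdet, absDet_inv,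
      Real.mul_rpow (absDet_nonneg _) (absDet_nonneg _), ← mul_assoc,
      Real.inv_rpow (absDet_nonneg _), ← Real.rpow_neg (absDet_nonneg _),
      ← Real.rpow_add (absDet_pos u.isUnit), hExp_top]
    congr 2
    ring
  exists_isUnit_leftBlock g _ := by
    obtain ⟨x, hx⟩ := exists_isUnit_leftBlock_top g
    exact ⟨⟨x, Submodule.mem_top⟩, hx⟩
  exists_pairing := by
    -- The block `d = 1` suffices: `x ↦ a⁻¹ x` is dual to `y ↦ y a` for the trace form, and right
    -- multiplications are transitive on invertible matrices.
    refine ⟨(traceForm t).domRestrict₁₂ ⊤ ⊤, fun y hy => ?_, fun a y => ⟨y * a, Submodule.mem_top⟩, ?_,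
      fun a => ⟨sandwichEquiv 1 a (fun _ _ => Submodule.mem_top) (fun _ _ => Submodule.mem_top),
        sandwichEquiv a⁻¹ 1 (fun _ _ => Submodule.mem_top) (fun _ _ => Submodule.mem_top), 1, fun c => ?_, fun x => ?_,
        fun y => ?_, fun y x => ?_⟩, ⟨⟨1, Submodule.mem_top⟩, isUnit_one⟩, fun ξ η hξ hη => ?_⟩
    · exact Subtype.ext (eq_zero_of_traceForm_eq_zero ht fun x => hy (⟨x, Submodule.mem_top⟩ : (⊤ : Submodule ℝ (Matrix (Fin n) (Fin n) K))))
    · refine Continuous.subtype_mk ?_ _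
      exact (continuous_subtype_val.comp continuous_snd).mul continuous_fst
    · obtain ⟨g, hg⟩ := exists_units_fromBlocks a 1 ((a : Matrix (Fin n) (Fin n) K) * c)
      exact ⟨g, trivial, hg⟩
    · exact coe_sandwichEquiv a⁻¹ 1 (fun _ _ => Submodule.mem_top) (fun _ _ => Submodule.mem_top) x
    · refine Subtype.ext ((coe_sandwichEquiv _ _ _ _ y).trans ?_)
      simp
    · refine congrArg t (congrArg (traceLinearMap (Fin n) ℝ K) ?_)
      have h1 := coe_sandwichEquiv (M := ⊤) 1 a (fun _ _ => Submodule.mem_top)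
        (fun _ _ => Submodule.mem_top) y
      have h2 := coe_sandwichEquiv (M := ⊤) a⁻¹ 1 (fun _ _ => Submodule.mem_top)
        (fun _ _ => Submodule.mem_top) x
      refine (congrArg₂ (· * ·) h1 h2).trans ?_
      simp [mul_assoc]
    · obtain ⟨ξ', hξ'⟩ := hξ
      obtain ⟨η', hη'⟩ := hη
      refine ⟨ξ'⁻¹ * η', fun a => Subtype.ext ?_⟩
      change (η : Matrix _ _ K) * a = (ξ : Matrix _ _ K) * ((ξ'⁻¹ * η').val * a)
      change ξ'.val = (ξ : Matrix _ _ K) at hξ'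
      change η'.val = (η : Matrix _ _ K) at hη'
      rw [← hξ', ← hη']
      simp [← mul_assoc]

end FullMatrices

/-! ### Spaces of Hermitian and anti-Hermitian matrices -/

section HermForm

variable {n : ℕ} {K : Type} [DivisionRing K] [Algebra ℝ K] [StarRing K] [StarModule ℝ K]

/-- The form `(0 -ε; 1 0)`. -/
def hermForm (n : ℕ) (K : Type) [DivisionRing K] [Algebra ℝ K] (ε : ℝ) :
    Matrix (Fin n ⊕ Fin n) (Fin n ⊕ Fin n) K := fromBlocks 0 (-(ε • 1)) 1 0

variable {ε : ℝ}

lemma fromBlocks_mul_hermForm_mul (a b c d : Matrix (Fin n) (Fin n) K) :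
    fromBlocks a b c d * hermForm n K ε * (fromBlocks a b c d)ᴴ =
      fromBlocks (b * aᴴ - ε • (a * bᴴ)) (b * cᴴ - ε • (a * dᴴ))
        (d * aᴴ - ε • (c * bᴴ)) (d * cᴴ - ε • (c * dᴴ)) := by
  rw [hermForm, fromBlocks_conjTranspose, fromBlocks_multiply, fromBlocks_multiply]
  simp [sub_eq_add_neg]

lemma fromBlocks_one_mul_hermForm {x : Matrix (Fin n) (Fin n) K} (hε : ε * ε = 1)
    (hx : xᴴ = ε • x) :
    fromBlocks 1 x 0 1 * hermForm n K ε * (fromBlocks 1 x 0 1)ᴴ = hermForm n K ε := by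
  rw [fromBlocks_mul_hermForm_mul, hx, Matrix.one_mul, smul_smul, hε, hermForm]
  simp

lemma fromBlocks_one_mul_mul_hermForm {g : Matrix (Fin n ⊕ Fin n) (Fin n ⊕ Fin n) K}
    {x : Matrix (Fin n) (Fin n) K} (hε : ε * ε = 1) (hx : xᴴ = ε • x)
    (hg : g * hermForm n K ε * gᴴ = hermForm n K ε) :
    (fromBlocks 1 x 0 1 * g) * hermForm n K ε * (fromBlocks 1 x 0 1 * g)ᴴ = hermForm n K ε := by
  conv_rhs => rw [← fromBlocks_one_mul_hermForm hε hx, ← hg]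
  rw [conjTranspose_mul]
  simp only [Matrix.mul_assoc]

lemma smul_left_cancel_of_mul_self {V : Type*} [AddCommGroup V] [Module ℝ V] (hε : ε * ε = 1)
    {v w : V} (h : ε • v = ε • w) : v = w := by
  have := congrArg (ε • ·) h
  simpa [smul_smul, hε] using this

/-- The product `(1 x; 0 1) g` preserves the form and has upper row `(u, uy)`. Its upper left block
relation is `u y uᴴ = ε u yᴴ uᴴ`. -/
lemma conjTranspose_frac {g : Matrix (Fin n ⊕ Fin n) (Fin n ⊕ Fin n) K}
    {x y : Matrix (Fin n) (Fin n) K} (hε : ε * ε = 1) (hx : xᴴ = ε • x)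
    (hg : g * hermForm n K ε * gᴴ = hermForm n K ε) (u : (Matrix (Fin n) (Fin n) K)ˣ)
    (hu : u.val = leftBlock g x) (hy : u.val * y = rightBlock g x) : yᴴ = ε • y := by
  have h := congrArg toBlocks₁₁ (fromBlocks_one_mul_mul_hermForm hε hx hg)
  rw [fromBlocks_one_mul, fromBlocks_mul_hermForm_mul, hermForm, toBlocks_fromBlocks₁₁,
    toBlocks_fromBlocks₁₁, ← hu, ← hy, conjTranspose_mul, sub_eq_zero] at h
  have hu' : u.valᴴ * (u⁻¹).valᴴ = 1 := by
    rw [← conjTranspose_mul, u.inv_mul, conjTranspose_one]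
  have h1 : y = ε • yᴴ := by
    calc y = (u⁻¹).val * (u.val * y * u.valᴴ) * (u⁻¹).valᴴ := by
          simp only [Matrix.mul_assoc, hu', Matrix.mul_one]
          rw [← Matrix.mul_assoc, u.inv_mul, Matrix.one_mul]
      _ = ε • yᴴ := by
          rw [h]
          simp only [Matrix.mul_smul, Matrix.smul_mul, Matrix.mul_assoc, hu', Matrix.mul_one]
          rw [← Matrix.mul_assoc, u.inv_mul, Matrix.one_mul]
  conv_rhs => rw [h1, smul_smul, hε, one_smul]

/-- Removing `(1 y; 0 1)` leaves a lower triangular matrix preserving the form, whose diagonal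
blocks must be inverse to each other up to conjugate transposition. -/
lemma conjTranspose_lowerBlock {g : Matrix (Fin n ⊕ Fin n) (Fin n ⊕ Fin n) K}
    {x y : Matrix (Fin n) (Fin n) K} (hε : ε * ε = 1) (hx : xᴴ = ε • x)
    (hg : g * hermForm n K ε * gᴴ = hermForm n K ε) (u : (Matrix (Fin n) (Fin n) K)ˣ)
    (hu : u.val = leftBlock g x) (hy : u.val * y = rightBlock g x) :
    g.toBlocks₂₂ - g.toBlocks₂₁ * y = (u⁻¹).valᴴ := by
  have h := fromBlocks_one_mul_mul_hermForm hε hx hg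
  rw [fromBlocks_one_mul_eq (y := y) (by rw [← hu, hy]), conjTranspose_mul,
    show ∀ z t s t' z' : Matrix (Fin n ⊕ Fin n) (Fin n ⊕ Fin n) K,
      z * t * s * (t' * z') = z * (t * s * t') * z' from fun _ _ _ _ _ => by
        simp only [Matrix.mul_assoc],
    fromBlocks_one_mul_hermForm hε (conjTranspose_frac hε hx hg u hu hy),
    fromBlocks_mul_hermForm_mul, hermForm] at h
  have h2 := congrArg toBlocks₁₂ h
  rw [toBlocks_fromBlocks₁₂, toBlocks_fromBlocks₁₂, Matrix.zero_mul, zero_sub, neg_inj] at h2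
  have h3 := smul_left_cancel_of_mul_self hε h2
  rw [← hu] at h3
  rw [Units.inv_eq_of_mul_eq_one_right h3, conjTranspose_conjTranspose]

lemma hermForm_mul_dual (hε : ε * ε = 1) :
    hermForm n K ε * fromBlocks 0 1 (-(ε • 1)) 0 = 1 := by
  rw [hermForm, fromBlocks_multiply]
  simp [smul_smul, hε]

/-- From `g S gᴴ = S` follows `gᴴ S' g = S'` for the inverse form `S'`. This is its upper left
block, a relation within the first block column. -/
lemma conjTranspose_mul_eq_of_preserves (hε : ε * ε = 1) (g : GL2 n K)
    (hg : g.val * hermForm n K ε * g.valᴴ = hermForm n K ε) :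
    g.val.toBlocks₁₁ᴴ * g.val.toBlocks₂₁ = ε • (g.val.toBlocks₂₁ᴴ * g.val.toBlocks₁₁) := by
  set S' : Matrix (Fin n ⊕ Fin n) (Fin n ⊕ Fin n) K := fromBlocks 0 1 (-(ε • 1)) 0 with hS'
  have h1 : hermForm n K ε * S' = 1 := hermForm_mul_dual hε
  have h2 : S' * hermForm n K ε = 1 := mul_eq_one_comm.mp h1
  have h3 : g.val * (hermForm n K ε * g.valᴴ * S') = 1 := by
    rw [← h1]
    conv_rhs => rw [← hg]
    simp only [Matrix.mul_assoc]
  have h4 : hermForm n K ε * g.valᴴ * S' * g.val = 1 := mul_eq_one_comm.mp h3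
  have h5 : g.valᴴ * S' * g.val = S' := by
    calc g.valᴴ * S' * g.val = S' * (hermForm n K ε * g.valᴴ * S' * g.val) := by
          simp only [← Matrix.mul_assoc, h2, Matrix.one_mul]
      _ = S' := by rw [h4, Matrix.mul_one]
  have h6 := congrArg toBlocks₁₁ h5
  conv_lhs at h6 => rw [← fromBlocks_toBlocks g.val]
  rw [hS', fromBlocks_conjTranspose, fromBlocks_multiply, fromBlocks_multiply,
    toBlocks_fromBlocks₁₁, toBlocks_fromBlocks₁₁] at h6
  simp only [Matrix.mul_zero, Matrix.mul_one, zero_add, add_zero, Matrix.mul_neg,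
    Matrix.mul_smul, Matrix.neg_mul, Matrix.smul_mul] at h6
  exact (neg_add_eq_zero.mp h6).symm

/-- An explicit left inverse. From `E + xC`, multiplication by `E` recovers `E` and hence `EC =
ECE`, while `x'` recovers `(1 - E) C`. Together these give `pE + qC = 1`. -/
lemma isUnit_add_mul_of_projection {E C p q x x' : Matrix (Fin n) (Fin n) K} (hpq : p * E + q * C = 1)
    (hEE : E * E = E) (hEC : E * C = E * C * E) (hEx : E * x = 0) (hxE : x' * E = 0)
    (hxx : x' * x = 1 - E) : IsUnit (E + x * C) := by
  have h : (p * E + q * (x' + E * C * E)) * (E + x * C) = 1 := by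
    calc (p * E + q * (x' + E * C * E)) * (E + x * C)
        = p * (E * E) + p * (E * x) * C + q * (x' * E) + q * (x' * x) * C
          + q * (E * C * (E * E)) + q * (E * C) * (E * x) * C := by noncomm_ring
      _ = p * E + q * C := by
          rw [hEE, hEx, hxE, hxx, ← hEC]; noncomm_ring
      _ = 1 := hpq
  exact ⟨⟨_, _, mul_eq_one_comm.mp h, h⟩, rfl⟩

/-- Put `C = (l⁻¹)ᴴ c m`. The relation between `a` and `c` becomes `EC = ε Cᴴ E`, which forces `EC =
ECE`. -/
lemma isUnit_coordProj_add (hε : ε * ε = 1) (g : GL2 n K)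
    (hg : g.val * hermForm n K ε * g.valᴴ = hermForm n K ε)
    {l m : (Matrix (Fin n) (Fin n) K)ˣ} {D : Finset (Fin n)}
    (hD : l.val * g.val.toBlocks₁₁ * m.val = coordProj K D) {x x' : Matrix (Fin n) (Fin n) K}
    (hEx : coordProj K D * x = 0) (hxE : x' * coordProj K D = 0)
    (hxx : x' * x = 1 - coordProj K D) :
    IsUnit (coordProj K D + x * ((l⁻¹).valᴴ * g.val.toBlocks₂₁ * m.val)) := by
  obtain ⟨p, q, hpq⟩ := exists_mul_add_mul_eq_one g
  have hrel := conjTranspose_mul_eq_of_preserves hε g hg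
  set a := g.val.toBlocks₁₁
  set c := g.val.toBlocks₂₁
  have hEH : (coordProj K D)ᴴ = coordProj K D := by
    rw [coordProj, diagonal_conjTranspose]
    congr 1
    ext i
    by_cases hi : i ∈ D <;> simp [hi]
  have hEE : coordProj K D * coordProj K D = coordProj K D := coordProj_mul_self D
  set E := coordProj K D
  have hll : l.valᴴ * (l⁻¹).valᴴ = 1 := by
    rw [← conjTranspose_mul, l.inv_mul, conjTranspose_one]
  have hEC : E * ((l⁻¹).valᴴ * c * m.val) = ε • (((l⁻¹).valᴴ * c * m.val)ᴴ * E) := by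
    have e1 : E * ((l⁻¹).valᴴ * c * m.val) = m.valᴴ * (aᴴ * c) * m.val := by
      calc E * ((l⁻¹).valᴴ * c * m.val) = Eᴴ * ((l⁻¹).valᴴ * c * m.val) := by rw [hEH]
        _ = m.valᴴ * aᴴ * (l.valᴴ * (l⁻¹).valᴴ) * c * m.val := by
            rw [← hD, conjTranspose_mul, conjTranspose_mul]; simp only [Matrix.mul_assoc]
        _ = _ := by rw [hll]; simp only [Matrix.mul_assoc, Matrix.one_mul]
    have e2 : ((l⁻¹).valᴴ * c * m.val)ᴴ * E = m.valᴴ * (cᴴ * a) * m.val := by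
      rw [← hD, conjTranspose_mul, conjTranspose_mul, conjTranspose_conjTranspose]
      simp only [Matrix.mul_assoc]
      rw [← Matrix.mul_assoc (l⁻¹).val, l.inv_mul, Matrix.one_mul]
    rw [e1, e2, hrel]
    simp only [Matrix.mul_smul, Matrix.smul_mul]
  refine isUnit_add_mul_of_projection (p := (m⁻¹).val * p * (l⁻¹).val)
    (q := (m⁻¹).val * q * l.valᴴ) ?_ hEE ?_ hEx hxE hxx
  · calc _ = (m⁻¹).val * (p * a + q * c) * m.val := by
          rw [← hD, Matrix.mul_add, Matrix.add_mul]
          congr 1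
          · simp only [Matrix.mul_assoc]
            rw [← Matrix.mul_assoc (l⁻¹).val, l.inv_mul, Matrix.one_mul]
          · simp only [Matrix.mul_assoc]
            rw [← Matrix.mul_assoc l.valᴴ, hll, Matrix.one_mul]
      _ = 1 := by rw [hpq, Matrix.mul_one, m.inv_mul]
  · rw [hEC, Matrix.smul_mul, Matrix.mul_assoc _ E E, hEE]

/-- This reduces generic invertibility to a matrix `x` of the required symmetry that lives, and is
invertible, on the coordinates outside `D`. The point is `z = l⁻¹ x (l⁻¹)ᴴ`. -/
lemma isUnit_leftBlock_of_projection (hε : ε * ε = 1) (g : GL2 n K)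
    (hg : g.val * hermForm n K ε * g.valᴴ = hermForm n K ε)
    {l m : (Matrix (Fin n) (Fin n) K)ˣ} {D : Finset (Fin n)}
    (hD : l.val * g.val.toBlocks₁₁ * m.val = coordProj K D) {x x' : Matrix (Fin n) (Fin n) K}
    (hx : xᴴ = ε • x)
    (hEx : coordProj K D * x = 0) (hxE : x' * coordProj K D = 0)
    (hxx : x' * x = 1 - coordProj K D) :
    ∃ z, zᴴ = ε • z ∧ IsUnit (leftBlock g.val z) := by
  have h := isUnit_coordProj_add hε g hg hD hEx hxE hxx
  refine ⟨(l⁻¹).val * x * (l⁻¹).valᴴ, ?_, ?_⟩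
  · rw [conjTranspose_mul, conjTranspose_mul, conjTranspose_conjTranspose, hx]
    simp [Matrix.mul_assoc]
  · have : leftBlock g.val ((l⁻¹).val * x * (l⁻¹).valᴴ) = (l⁻¹).val *
        (coordProj K D + x * ((l⁻¹).valᴴ * g.val.toBlocks₂₁ * m.val)) * (m⁻¹).val := by
      rw [← hD, leftBlock, Matrix.mul_add, Matrix.add_mul]
      simp only [Matrix.mul_assoc, m.mul_inv, Matrix.mul_one]
      rw [← Matrix.mul_assoc (l⁻¹).val l.val, l.inv_mul, Matrix.one_mul]
    rw [this]
    exact ((l⁻¹).isUnit.mul h).mul (m⁻¹).isUnit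

end HermForm

/-! ### Admissibility of spaces of Hermitian type. -/

section Hermitian

variable {n : ℕ} {K : Type} [NormedDivisionRing K] [NormedAlgebra ℝ K] [FiniteDimensional ℝ K]
  [StarRing K] [StarModule ℝ K] [ContinuousStar K]

lemma absDet_conjTranspose {a : Matrix (Fin n) (Fin n) K} (ha : IsUnit a) :
    absDet aᴴ = absDet a := by
  let χ : Matrix (Fin n) (Fin n) K →* ℝ :=
    { toFun := fun a => absDet aᴴ
      map_one' := by rw [conjTranspose_one, absDet_one]
      map_mul' := fun a b => by rw [conjTranspose_mul, absDet_mul, mul_comm] }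
  refine character_eq_of_eq_on_scalars χ absDetHom
    (continuous_absDet.comp continuous_id.matrix_conjTranspose) continuous_absDet
    (fun _ => absDet_nonneg _) (fun _ => absDet_nonneg _) (fun r _ => ?_) ha
  change absDet (r • (1 : Matrix (Fin n) (Fin n) K))ᴴ = absDet (r • (1 : Matrix (Fin n) (Fin n) K))
  rw [conjTranspose_smul, star_trivial, conjTranspose_one]

variable {M : Submodule ℝ (Matrix (Fin n) (Fin n) K)}

/-- The origin of `h`: a scalar `r` acts on `M` by `r²`, so the exponent `p` satisfies `n p = 2 dim
M`. -/
lemma abs_det_sandwichOn_conjTranspose (hM : ∀ a, ∀ x ∈ M, a * x * aᴴ ∈ M)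
    {a : Matrix (Fin n) (Fin n) K} (ha : IsUnit a) :
    |LinearMap.det (sandwichOn a aᴴ (hM a))| = absDet a ^ hExp M := by
  refine abs_det_eq_absDet_rpow (k := 2)
    (Φ := fun a : Matrix (Fin n) (Fin n) K => sandwichOn a aᴴ (hM a))
    (fun v => ?_) ?_ (fun a b => ?_) (fun r => ?_) ?_ ?_ ha
  · refine Topology.IsInducing.subtypeVal.continuous_iff.mpr ?_
    simp only [Function.comp_def, coe_sandwichOn]
    exact (continuous_id.matrix_mul continuous_const).matrix_mul continuous_id.matrix_conjTranspose
  · ext1 δ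
    refine Subtype.ext ((coe_sandwichOn _ _ _ δ).trans ?_)
    simp
  · rw [← map_mul]
    congr 1
    ext1 δ
    refine Subtype.ext ((coe_sandwichOn _ _ _ δ).trans ?_)
    rw [Module.End.mul_apply, coe_sandwichOn, coe_sandwichOn, conjTranspose_mul]
    simp only [Matrix.mul_assoc]
  · ext1 δ
    refine Subtype.ext ((coe_sandwichOn _ _ _ δ).trans ?_)
    simp [smul_smul, sq]
  · rw [hExp]; positivity
  · rw [hExp, Fintype.card_fin]
    rcases eq_or_ne n 0 with rfl | hn
    · have : Module.finrank ℝ M = 0 := Module.finrank_zero_of_subsingleton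
      simp [this]
    · push_cast
      field_simp

lemma trace_mul_comm_of_map {t : K →ₗ[ℝ] ℝ} (ht : ∀ p q, t (p * q) = t (q * p))
    (x y : Matrix (Fin n) (Fin n) K) : t (trace (x * y)) = t (trace (y * x)) := by
  simp only [trace, diag_apply, mul_apply, map_sum]
  rw [Finset.sum_comm]
  simp only [ht]

variable {ε : ℝ}

/-- Any `z` is symmetrized to `z + ε zᴴ`, and both summands pair equally with `y`. -/
lemma eq_zero_of_traceForm_eq_zero_of_hermitian {t : K →ₗ[ℝ] ℝ} (ht : t 1 ≠ 0)
    (ht_comm : ∀ p q, t (p * q) = t (q * p)) (ht_star : ∀ p, t (star p) = t p) (hε : ε * ε = 1)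
    {y : Matrix (Fin n) (Fin n) K} (hy : yᴴ = ε • y)
    (h : ∀ x, xᴴ = ε • x → traceForm t y x = 0) : y = 0 := by
  refine eq_zero_of_traceForm_eq_zero ht fun z => ?_
  have h1 := h (z + ε • zᴴ) (by
    rw [conjTranspose_add, conjTranspose_smul, conjTranspose_conjTranspose, star_trivial, smul_add,
      smul_smul, hε, one_smul, add_comm])
  have h2 : traceForm t y (ε • zᴴ) = traceForm t y z := by
    rw [traceForm_apply, traceForm_apply, Matrix.mul_smul, ← Matrix.smul_mul, ← hy,
      ← conjTranspose_mul, trace_conjTranspose, ht_star, trace_mul_comm_of_map ht_comm]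
  rw [map_add, h2] at h1
  linarith

/-- Spaces of Hermitian or anti-Hermitian matrices are admissible. -/
theorem isAdmissible_of_hermitian {t : K →ₗ[ℝ] ℝ} (ht : t 1 ≠ 0)
    (ht_comm : ∀ p q, t (p * q) = t (q * p)) (ht_star : ∀ p, t (star p) = t p) (hε : ε * ε = 1)
    (hM : ∀ x, x ∈ M ↔ xᴴ = ε • x) {G : Subgroup (GL2 n K)}
    (hG : ∀ g ∈ G, g.val * hermForm n K ε * g.valᴴ = hermForm n K ε)
    (hGP : ∀ (a : (Matrix (Fin n) (Fin n) K)ˣ) (c : Matrix (Fin n) (Fin n) K), cᴴ = ε • c →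
      ∃ g ∈ G, g.val = fromBlocks a.val (a.val * c) 0 (a⁻¹).valᴴ)
    (hGu : ∀ g ∈ G, ∃ x, xᴴ = ε • x ∧ IsUnit (leftBlock g.val x))
    {κ : Matrix (Fin n) (Fin n) K} (hκ : κᴴ = ε • κ) (hκu : IsUnit κ)
    (horb : ∀ y : Matrix (Fin n) (Fin n) K, yᴴ = ε • y → IsUnit y →
      ∃ b : (Matrix (Fin n) (Fin n) K)ˣ, b.valᴴ * y * b.val = κ) :
    IsAdmissible M.subtype G (hExp M) := by
  have hMs : ∀ a, ∀ x ∈ M, a * x * aᴴ ∈ M := fun a x hx => by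
    rw [hM] at hx ⊢
    simp [conjTranspose_mul, hx, Matrix.mul_assoc]
  have hMs' : ∀ a, ∀ x ∈ M, aᴴ * x * a ∈ M := fun a x hx => by
    have := hMs aᴴ x hx
    rwa [conjTranspose_conjTranspose] at this
  refine ⟨Subtype.val_injective, fun g hgG x u hu => ?_, fun g hgG => ?_, ?_⟩
  · have hg := hG g hgG
    have hx : (x : Matrix (Fin n) (Fin n) K)ᴴ = ε • (x : Matrix (Fin n) (Fin n) K) := (hM _).mp x.2
    set y : Matrix (Fin n) (Fin n) K := (u⁻¹).val * rightBlock g.val x with hy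
    have huy : u.val * y = rightBlock g.val x := by
      rw [hy, ← Matrix.mul_assoc, u.mul_inv, Matrix.one_mul]
    have hyM := conjTranspose_frac hε hx hg u hu huy
    have hw := conjTranspose_lowerBlock hε hx hg u hu huy
    have hdet : absDet g.val = 1 := by
      have := congrArg absDet (fromBlocks_one_mul_eq (g := g.val)
        (x := (x : Matrix (Fin n) (Fin n) K)) (y := y) (by rw [← huy, hu]; rfl))
      rwa [hw, absDet_mul, absDet_mul, absDet_fromBlocks_zero₂₁, absDet_fromBlocks_zero₂₁,
        absDet_fromBlocks_zero₁₂, absDet_one, one_mul, one_mul, mul_one,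
        show leftBlock g.val x = u.val from hu.symm, absDet_conjTranspose (u⁻¹).isUnit, absDet_inv,
        mul_inv_cancel₀ (absDet_pos u.isUnit).ne'] at this
    refine ⟨⟨y, (hM y).mpr hyM⟩, huy, sandwichOn (u⁻¹).val (u⁻¹).valᴴ (hMs _), fun δ => ?_, ?_⟩
    · refine (coe_sandwichOn _ _ (hMs _) δ).trans ?_
      rw [← hw]
      rfl
    · rw [abs_det_sandwichOn_conjTranspose hMs (u⁻¹).isUnit, hdet, Real.one_rpow, mul_one,
        absDet_inv, Real.inv_rpow (absDet_nonneg _), ← Real.rpow_neg (absDet_nonneg _)]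
  · obtain ⟨x, hx, hxu⟩ := hGu g hgG
    exact ⟨⟨x, (hM x).mpr hx⟩, hxu⟩
  · have hunit : ∀ a : (Matrix (Fin n) (Fin n) K)ˣ, ∃ d : (Matrix (Fin n) (Fin n) K)ˣ,
        d.val = a.valᴴ ∧ (d⁻¹).val = (a⁻¹).valᴴ := fun a => by
      refine ⟨⟨a.valᴴ, (a⁻¹).valᴴ, ?_, ?_⟩, rfl, rfl⟩ <;> rw [← conjTranspose_mul] <;> simp
    -- The action `y ↦ aᴴ y a` is dual to `x ↦ a⁻¹ x (a⁻¹)ᴴ`, so its orbits are congruence classes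
    -- of forms.
    refine ⟨(traceForm t).domRestrict₁₂ M M, fun y hy => ?_,
      fun a y => ⟨aᴴ * y * a, hMs' a _ y.2⟩, ?_, fun a => ?_, ⟨⟨κ, (hM κ).mpr hκ⟩, hκu⟩,
      fun ξ η hξ hη => ?_⟩
    · exact Subtype.ext (eq_zero_of_traceForm_eq_zero_of_hermitian ht ht_comm ht_star hε
        ((hM _).mp y.2) fun x hx => hy ⟨x, (hM x).mpr hx⟩)
    · refine Continuous.subtype_mk ?_ _
      exact (continuous_fst.matrix_conjTranspose.matrix_mul
        (continuous_subtype_val.comp continuous_snd)).matrix_mul continuous_fst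
    · obtain ⟨d, hd, hd'⟩ := hunit a
      have h1 : ∀ x ∈ M, d.val * x * a.val ∈ M := fun x hx => by rw [hd]; exact hMs' _ x hx
      have h1' : ∀ x ∈ M, (d⁻¹).val * x * (a⁻¹).val ∈ M := fun x hx => by
        rw [hd']; exact hMs' _ x hx
      have h2 : ∀ x ∈ M, (a⁻¹).val * x * (d⁻¹).val ∈ M := fun x hx => by
        rw [hd']; exact hMs _ x hx
      have h2' : ∀ x ∈ M, (a⁻¹⁻¹).val * x * (d⁻¹⁻¹).val ∈ M := fun x hx => by
        rw [inv_inv, inv_inv, hd]; exact hMs _ x hx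
      refine ⟨sandwichEquiv d a h1 h1', sandwichEquiv a⁻¹ d⁻¹ h2 h2', (d⁻¹).val, fun c => ?_,
        fun x => coe_sandwichEquiv _ _ h2 h2' x, fun y => ?_, fun y x => ?_⟩
      · rw [hd']
        exact hGP a c ((hM _).mp c.2)
      · refine Subtype.ext ((coe_sandwichEquiv _ _ h1 h1' y).trans ?_)
        rw [hd]
      · change traceForm t (sandwichEquiv d a h1 h1' y : Matrix (Fin n) (Fin n) K)
          (sandwichEquiv a⁻¹ d⁻¹ h2 h2' x : Matrix (Fin n) (Fin n) K) =
            traceForm t (y : Matrix (Fin n) (Fin n) K) (x : Matrix (Fin n) (Fin n) K)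
        rw [coe_sandwichEquiv, coe_sandwichEquiv, traceForm_apply, traceForm_apply,
          show (d.val * (y : Matrix (Fin n) (Fin n) K) * a.val) *
            ((a⁻¹).val * (x : Matrix (Fin n) (Fin n) K) * (d⁻¹).val) =
            d.val * ((y : Matrix (Fin n) (Fin n) K) * (x : Matrix (Fin n) (Fin n) K) *
              (d⁻¹).val) by simp [Matrix.mul_assoc],
          trace_mul_comm_of_map ht_comm, Matrix.mul_assoc, d.inv_mul, Matrix.mul_one]
    · obtain ⟨b₁, hb₁⟩ := horb ξ ((hM _).mp ξ.2) hξ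
      obtain ⟨b₂, hb₂⟩ := horb η ((hM _).mp η.2) hη
      -- Both forms are congruent to `κ`, so `η` is obtained from `ξ` by the congruence with `b₁
      -- b₂⁻¹`.
      refine ⟨b₁ * b₂⁻¹, fun a => Subtype.ext ?_⟩
      change aᴴ * (η : Matrix (Fin n) (Fin n) K) * a =
        ((b₁ * b₂⁻¹).val * a)ᴴ * (ξ : Matrix (Fin n) (Fin n) K) * ((b₁ * b₂⁻¹).val * a)
      obtain ⟨d, hd, hd'⟩ := hunit b₂
      have key : (b₂⁻¹).valᴴ * (b₁.valᴴ * (ξ : Matrix (Fin n) (Fin n) K) * b₁.val) * (b₂⁻¹).val =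
          (η : Matrix (Fin n) (Fin n) K) := by
        rw [hb₁, ← hb₂, ← hd, ← hd']
        simp [Matrix.mul_assoc]
      rw [← key, Units.val_mul, conjTranspose_mul, conjTranspose_mul]
      simp only [Matrix.mul_assoc]

end Hermitian

/-! ### Normal forms of invertible Hermitian and skew-symmetric matrices -/

section Clear

/-- Orthogonalization against an idempotent on which the form `y` is already in normal form. -/
lemma exists_isUnit_star_mul_mul_eq {R : Type*} [Ring R] [StarRing R] {p e κ κ' y : R}
    (hee : e * e = e) (hpe : p * e = 0) (hep : e * p = 0) (hp : star p = p) (he : star e = e)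
    (hκ : κ * κ' = 1) (hκ' : κ' * κ = 1) (hpκ : p * κ = κ * p) (heκ : e * κ = κ * e)
    (hpy : p * y = p * κ) (hyp : y * p = κ * p) (heye : e * y * e = e * κ) :
    ∃ b : Rˣ, (p + e) * (star b.val * y * b.val) = (p + e) * κ := by
  have comm : ∀ f : R, f * κ = κ * f → f * κ' = κ' * f := fun f hf => by
    calc f * κ' = κ' * κ * f * κ' := by rw [hκ', one_mul]
      _ = κ' * (f * κ) * κ' := by rw [hf]; simp only [mul_assoc]
      _ = κ' * f := by simp only [mul_assoc, hκ, mul_one]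
  have heκ' := comm e heκ
  have hpκ' := comm p hpκ
  -- Gram–Schmidt: the substitution `1 - z` replaces `e y` by `e y e = e κ`. The element `z` has
  -- square zero and does not interact with `p`.
  set z := κ' * e * y * (1 - e) with hz
  have he1 : (1 - e) * e = 0 := by rw [sub_mul, one_mul, hee, sub_self]
  have hzz : z * z = 0 := by
    calc z * z = κ' * e * y * ((1 - e) * (κ' * e)) * y * (1 - e) := by
          rw [hz]; simp only [mul_assoc]
      _ = κ' * e * y * ((1 - e) * e * κ') * y * (1 - e) := by rw [← heκ', mul_assoc (1 - e)]
      _ = 0 := by rw [he1]; simp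
  have hzp : z * p = 0 := by
    calc z * p = κ' * (e * (y * p)) - κ' * e * y * (e * p) := by rw [hz]; noncomm_ring
      _ = κ' * (e * κ) * p := by rw [hep, hyp, mul_zero, sub_zero]; simp only [mul_assoc]
      _ = κ' * κ * (e * p) := by rw [heκ]; simp only [mul_assoc]
      _ = 0 := by rw [hep, mul_zero]
  have hpz : p * z = 0 := by
    calc p * z = p * κ' * e * y * (1 - e) := by rw [hz]; simp only [mul_assoc]
      _ = κ' * (p * e) * y * (1 - e) := by rw [hpκ']; simp only [mul_assoc]
      _ = 0 := by rw [hpe]; simp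
  have hze : z * e = 0 := by rw [hz, mul_assoc, he1, mul_zero]
  have hpz' : p * star z = 0 := by rw [← hp, ← star_mul, hzp, star_zero]
  have hez' : e * star z = 0 := by rw [← he, ← star_mul, hze, star_zero]
  obtain ⟨b, hb⟩ : IsUnit (1 + -z) := isUnit_one_add_of_mul_self (by rw [neg_mul_neg, hzz])
  refine ⟨b, ?_⟩
  rw [hb]
  have h1 : (p + e) * star (1 + -z) = p + e := by
    rw [star_add, star_neg, star_one, mul_add, mul_one, mul_neg, add_mul, hpz', hez']
    simp
  have h2 : p * y * (1 + -z) = p * κ := by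
    rw [hpy, hpκ, mul_assoc, mul_add, mul_neg, hpz]; simp
  have h3 : e * y * (1 + -z) = e * κ := by
    have : e * y * z = e * y - e * y * e := by
      calc e * y * z = e * y * (κ' * e) * y * (1 - e) := by rw [hz]; simp only [mul_assoc]
        _ = (e * y * e) * κ' * y * (1 - e) := by rw [← heκ']; simp only [mul_assoc]
        _ = e * (κ * κ') * y * (1 - e) := by rw [heye]; simp only [mul_assoc]
        _ = _ := by rw [hκ]; noncomm_ring
    rw [mul_add, mul_neg, this, mul_one, ← heye]
    noncomm_ring
  calc (p + e) * (star (1 + -z) * y * (1 + -z))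
      = (p + e) * star (1 + -z) * y * (1 + -z) := by simp only [mul_assoc]
    _ = p * y * (1 + -z) + e * y * (1 + -z) := by rw [h1]; noncomm_ring
    _ = (p + e) * κ := by rw [h2, h3, add_mul]

variable {K : Type} [DivisionRing K] {ι : Type} [Fintype ι] [DecidableEq ι]

lemma coordProj_mul_coordProj (S T : Finset ι) :
    coordProj K S * coordProj K T = coordProj K (S ∩ T) := by
  rw [coordProj, coordProj, coordProj, diagonal_mul_diagonal]
  congr 1
  ext i
  by_cases hS : i ∈ S <;> by_cases hT : i ∈ T <;> simp [hS, hT]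

lemma coordProj_empty : coordProj K (∅ : Finset ι) = 0 := by
  simp [coordProj]

lemma coordProj_univ : coordProj K (Finset.univ : Finset ι) = 1 := by
  simp [coordProj]

lemma coordProj_union {S T : Finset ι} (h : Disjoint S T) :
    coordProj K (S ∪ T) = coordProj K S + coordProj K T := by
  rw [coordProj, coordProj, coordProj, diagonal_add]
  congr 1
  ext i
  by_cases hS : i ∈ S
  · simp [hS, Finset.disjoint_left.mp h hS]
  · simp [hS]

lemma coordProj_mul_apply (S : Finset ι) (a : Matrix ι ι K) (i j : ι) :
    (coordProj K S * a) i j = if i ∈ S then a i j else 0 := by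
  rw [coordProj, diagonal_mul]
  split_ifs <;> simp

lemma mul_coordProj_apply (S : Finset ι) (a : Matrix ι ι K) (i j : ι) :
    (a * coordProj K S) i j = if j ∈ S then a i j else 0 := by
  rw [coordProj, mul_diagonal]
  split_ifs <;> simp

lemma conjTranspose_coordProj [StarRing K] (S : Finset ι) :
    (coordProj K S)ᴴ = coordProj K S := by
  rw [coordProj, diagonal_conjTranspose]
  congr 1
  ext i
  by_cases hi : i ∈ S <;> simp [hi]

lemma isUnit_updateCol_one {i : ι} {v : ι → K} (hv : v i ≠ 0) :
    IsUnit ((1 : Matrix ι ι K).updateCol i v) := by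
  obtain ⟨b, hb⟩ := mulVec_surjective_iff_exists_right_inverse.mp
    (show Function.Surjective ((1 : Matrix ι ι K).updateCol i v).mulVec from fun w => by
      refine ⟨fun k => if k = i then (v i)⁻¹ * w i else w k - v k * ((v i)⁻¹ * w i), ?_⟩
      have key : ∀ z : ι → K, ((1 : Matrix ι ι K).updateCol i v) *ᵥ z =
          fun k => (if k = i then 0 else z k) + v k * z i := by
        intro z
        ext k
        rw [mulVec, dotProduct, ← Finset.add_sum_erase _ _ (Finset.mem_univ i), add_comm]
        congr 1
        · have : ∀ x ∈ Finset.univ.erase i, (1 : Matrix ι ι K).updateCol i v k x * z x =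
              if x = k then z k else 0 := fun x hx => by
            rw [updateCol_ne (Finset.ne_of_mem_erase hx), one_apply]
            by_cases h : x = k
            · simp [h]
            · simp [h, Ne.symm h]
          rw [Finset.sum_congr rfl this, Finset.sum_ite_eq']
          simp
        · rw [updateCol_self]
      rw [key]
      ext k
      by_cases hk : k = i
      · simp [hk, hv]
      · simp [hk])
  exact ⟨⟨_, b, hb, mul_eq_one_comm.mp hb⟩, rfl⟩

lemma coordProj_mul_updateCol_one {S : Finset ι} {i : ι} {v : ι → K} (hi : i ∉ S)
    (hv : ∀ k ∈ S, v k = 0) :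
    coordProj K S * (1 : Matrix ι ι K).updateCol i v = coordProj K S := by
  conv_rhs => rw [← Matrix.mul_one (coordProj K S)]
  ext k j
  rw [coordProj_mul_apply, coordProj_mul_apply]
  split_ifs with hk
  · by_cases hj : j = i
    · subst hj
      rw [updateCol_self, hv k hk, one_apply_ne (fun h : k = j => hi (h ▸ hk))]
    · rw [updateCol_ne hj]
  · rfl

lemma updateCol_one_mul_coordProj {S : Finset ι} {i : ι} {v : ι → K} (hi : i ∉ S) :
    (1 : Matrix ι ι K).updateCol i v * coordProj K S = coordProj K S := by
  conv_rhs => rw [← Matrix.one_mul (coordProj K S)]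
  ext k j
  rw [mul_coordProj_apply, mul_coordProj_apply]
  split_ifs with hj
  · rw [updateCol_ne (fun h : j = i => hi (h ▸ hj))]
  · rfl

/-- One step of the reduction to the normal form `κ`. -/
lemma exists_units_coordProj_union [StarRing K] {S T : Finset ι} (hST : Disjoint S T)
    {κ κ' y : Matrix ι ι K} (hκ : κ * κ' = 1)
    (hS : coordProj K S * κ = κ * coordProj K S) (hT : coordProj K T * κ = κ * coordProj K T)
    (hSy : coordProj K S * y = coordProj K S * κ) (hyS : y * coordProj K S = κ * coordProj K S)
    {c : Matrix ι ι K} (hc : IsUnit c) (hSc : coordProj K S * c = coordProj K S)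
    (hcS : c * coordProj K S = coordProj K S)
    (hTc : coordProj K T * (cᴴ * y * c) * coordProj K T = coordProj K T * κ) :
    ∃ b : (Matrix ι ι K)ˣ, coordProj K (S ∪ T) * (b.valᴴ * y * b.val) = coordProj K (S ∪ T) * κ := by
  obtain ⟨c, rfl⟩ := hc
  have hSc' : coordProj K S * c.valᴴ = coordProj K S := by
    rw [← conjTranspose_coordProj S, ← conjTranspose_mul, hcS]
  have hcS' : c.valᴴ * coordProj K S = coordProj K S := by
    rw [← conjTranspose_coordProj S, ← conjTranspose_mul, hSc]
  have h0 : coordProj K S * coordProj K T = 0 := by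
    rw [coordProj_mul_coordProj, Finset.disjoint_iff_inter_eq_empty.mp hST, coordProj_empty]
  have h0' : coordProj K T * coordProj K S = 0 := by
    rw [coordProj_mul_coordProj, Finset.inter_comm, Finset.disjoint_iff_inter_eq_empty.mp hST,
      coordProj_empty]
  obtain ⟨b, hb⟩ := exists_isUnit_star_mul_mul_eq (p := coordProj K S) (e := coordProj K T)
    (κ := κ) (κ' := κ') (y := c.valᴴ * y * c.val) (coordProj_mul_self T) h0 h0'
    (conjTranspose_coordProj S) (conjTranspose_coordProj T) hκ (mul_eq_one_comm.mp hκ) hS hT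
    (by
      calc coordProj K S * (c.valᴴ * y * c.val) = coordProj K S * c.valᴴ * y * c.val := by
            simp only [Matrix.mul_assoc]
        _ = κ * (coordProj K S * c.val) := by rw [hSc', hSy, hS, Matrix.mul_assoc]
        _ = _ := by rw [hSc, hS])
    (by
      calc c.valᴴ * y * c.val * coordProj K S = c.valᴴ * (y * (c.val * coordProj K S)) := by
            simp only [Matrix.mul_assoc]
        _ = c.valᴴ * coordProj K S * κ := by rw [hcS, hyS, ← hS, Matrix.mul_assoc]
        _ = _ := by rw [hcS', hS])
    hTc
  refine ⟨c * b, ?_⟩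
  rw [coordProj_union hST, ← hb, Units.val_mul, conjTranspose_mul, star_eq_conjTranspose]
  simp only [Matrix.mul_assoc]

end Clear

/-! ### Diagonalization of Hermitian and anti-Hermitian forms. -/

section NormalForm

variable {ι : Type} [Fintype ι] [DecidableEq ι]

lemma conjTranspose_mul_mul_apply {K : Type} [DivisionRing K] [StarRing K] (c z : Matrix ι ι K)
    (i j : ι) : (cᴴ * z * c) i j = star (fun k => c k i) ⬝ᵥ z *ᵥ (fun k => c k j) := by
  rw [Matrix.mul_assoc]
  rfl

lemma exists_apply_ne_zero_of_isUnit {K : Type} [DivisionRing K] {z : Matrix ι ι K}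
    (hz : IsUnit z) (i : ι) : ∃ j, z i j ≠ 0 := by
  by_contra! h
  obtain ⟨u, rfl⟩ := hz
  have h1 := congrFun (congrFun u.mul_inv i) i
  rw [mul_apply, one_apply_eq] at h1
  simp [h] at h1

variable {K : Type} [DivisionRing K] [Algebra ℝ K] [StarRing K] [StarModule ℝ K] {ε : ℝ}

lemma conjTranspose_congr {y : Matrix ι ι K} (hy : yᴴ = ε • y) (b : Matrix ι ι K) :
    (bᴴ * y * b)ᴴ = ε • (bᴴ * y * b) := by
  rw [conjTranspose_mul, conjTranspose_mul, conjTranspose_conjTranspose, hy]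
  simp [Matrix.mul_assoc]

lemma isUnit_congr {y : Matrix ι ι K} (hy : IsUnit y) (b : (Matrix ι ι K)ˣ) :
    IsUnit (b.valᴴ * y * b.val) := by
  refine (IsUnit.mul ?_ hy).mul b.isUnit
  exact ⟨⟨b.valᴴ, (b⁻¹).valᴴ, by rw [← conjTranspose_mul]; simp,
    by rw [← conjTranspose_mul]; simp⟩, rfl⟩

lemma mul_coordProj_eq_of_coordProj_mul {S : Finset ι} {y κ : Matrix ι ι K} (hε : ε * ε = 1)
    (hy : yᴴ = ε • y) (hκ : κᴴ = ε • κ) (h : coordProj K S * y = coordProj K S * κ) :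
    y * coordProj K S = κ * coordProj K S := by
  have h1 := congrArg conjTranspose h
  rw [conjTranspose_mul, conjTranspose_mul, conjTranspose_coordProj, hy, hκ, Matrix.smul_mul,
    Matrix.smul_mul] at h1
  exact smul_left_cancel_of_mul_self hε h1

lemma star_apply_of_conjTranspose_eq {y : Matrix ι ι K} (hy : yᴴ = ε • y) (i j : ι) :
    star (y i j) = ε • y j i := congrFun (congrFun hy j) i

lemma star_dotProduct_mulVec_single_add {z : Matrix ι ι K} (i j : ι) (s t : K) :
    star (Pi.single i s + Pi.single j t) ⬝ᵥ z *ᵥ (Pi.single i s + Pi.single j t) =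
      star s * z i i * s + star s * z i j * t + star t * z j i * s + star t * z j j * t := by
  rw [star_add, Pi.star_single, Pi.star_single, mulVec_add, add_dotProduct, dotProduct_add,
    dotProduct_add]
  simp only [mulVec_single, single_dotProduct, Pi.smul_apply, col_apply, MulOpposite.smul_eq_mul_unop,
    MulOpposite.unop_op]
  simp only [mul_assoc, add_assoc]

lemma star_form_self {z : Matrix ι ι K} (hz : zᴴ = ε • z) (v : ι → K) :
    star (star v ⬝ᵥ z *ᵥ v) = ε • (star v ⬝ᵥ z *ᵥ v) := by
  rw [← star_dotProduct, star_mulVec, hz, vecMul_smul, smul_dotProduct, ← dotProduct_mulVec]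

/-- It suffices that the form is nonzero at some admissible vector, since `hscale` rescales the
value to `k₀`. If `z i i = 0`, choose `t` with `z i j * t = k₀`. The values at `eᵢ ± t eⱼ` differ by
`4 k₀`, so they are not both zero. -/
lemma exists_form_eq {S : Finset ι} {i : ι} (hi : i ∉ S) {z : Matrix ι ι K}
    (hz : zᴴ = ε • z) (hε : ε * ε = 1) (hzi : ∃ j, z i j ≠ 0) (hzS : ∀ j ∈ S, z i j = 0)
    {k₀ : K} (hk₀ : k₀ ≠ 0) (hk₀s : star k₀ = ε • k₀)
    (hscale : ∀ p : K, p ≠ 0 → star p = ε • p → ∃ s, s ≠ 0 ∧ star s * p * s = k₀) :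
    ∃ v : ι → K, v i ≠ 0 ∧ (∀ k ∈ S, v k = 0) ∧ star v ⬝ᵥ z *ᵥ v = k₀ := by
  suffices ∃ v : ι → K, v i ≠ 0 ∧ (∀ k ∈ S, v k = 0) ∧ star v ⬝ᵥ z *ᵥ v ≠ 0 by
    obtain ⟨v, hvi, hvS, hv⟩ := this
    obtain ⟨s, hs, hsk⟩ := hscale _ hv (star_form_self hz v)
    refine ⟨fun k => v k * s, mul_ne_zero hvi hs, fun k hk => by simp [hvS k hk], ?_⟩
    rw [← hsk]
    simp only [dotProduct, mulVec, Pi.star_apply, star_mul, Finset.mul_sum, Finset.sum_mul,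
      mul_assoc]
  by_cases hii : z i i = 0
  · obtain ⟨j, hj⟩ := hzi
    have hjS : j ∉ S := fun h => hj (hzS j h)
    have hji : j ≠ i := by rintro rfl; exact hj hii
    have hmem : ∀ t : K, (Pi.single i 1 + Pi.single j t : ι → K) i ≠ 0 ∧
        ∀ k ∈ S, (Pi.single i 1 + Pi.single j t : ι → K) k = 0 := fun t => by
      refine ⟨by simp [hji.symm], fun k hk => ?_⟩
      rw [Pi.add_apply, Pi.single_eq_of_ne (fun h : k = i => hi (h ▸ hk)),
        Pi.single_eq_of_ne (fun h : k = j => hjS (h ▸ hk)), add_zero]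
    set t := (z i j)⁻¹ * k₀ with ht
    have h1 : z i j * t = k₀ := by rw [ht, mul_inv_cancel_left₀ hj]
    have h2 : star t * z j i = k₀ := by
      have : star (z i j * t) = star k₀ := by rw [h1]
      rw [star_mul, star_apply_of_conjTranspose_eq hz, hk₀s, mul_smul_comm] at this
      exact smul_left_cancel_of_mul_self hε this
    by_contra! hcon
    have e1 := hcon _ (hmem t).1 (hmem t).2
    have e2 := hcon _ (hmem (-t)).1 (hmem (-t)).2
    rw [star_dotProduct_mulVec_single_add] at e1 e2
    simp only [star_one, one_mul, mul_one, hii, zero_add, h1, h2, mul_neg, star_neg, neg_mul,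
      neg_neg] at e1 e2
    have e3 : (4 : ℝ) • k₀ = 0 := by
      calc (4 : ℝ) • k₀ = (k₀ + k₀ + star t * z j j * t) - (-k₀ + -k₀ + star t * z j j * t) := by
            rw [show (4 : ℝ) = 1 + 1 + 1 + 1 by norm_num]
            simp only [add_smul, one_smul]
            abel
        _ = 0 := by rw [e1, e2, sub_zero]
    exact hk₀ ((smul_eq_zero.mp e3).resolve_left (by norm_num))
  · refine ⟨Pi.single i 1, by simp, fun k hk => Pi.single_eq_of_ne (fun h : k = i => hi (h ▸ hk)) _, ?_⟩
    simpa using hii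

/-- Diagonalization of invertible Hermitian or anti-Hermitian matrices. -/
theorem exists_units_congr_eq_diagonal (hε : ε * ε = 1) {k₀ : K} (hk₀ : k₀ ≠ 0)
    (hk₀s : star k₀ = ε • k₀)
    (hscale : ∀ p : K, p ≠ 0 → star p = ε • p → ∃ s, s ≠ 0 ∧ star s * p * s = k₀)
    {y : Matrix ι ι K} (hy : yᴴ = ε • y) (hyu : IsUnit y) :
    ∃ b : (Matrix ι ι K)ˣ, b.valᴴ * y * b.val = diagonal fun _ => k₀ := by
  set κ : Matrix ι ι K := diagonal fun _ => k₀ with hκdef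
  have hκ : κᴴ = ε • κ := by
    rw [hκdef, diagonal_conjTranspose, ← diagonal_smul]
    congr 1
    ext i
    exact hk₀s
  have hκκ : κ * diagonal (fun _ => k₀⁻¹) = 1 := by
    rw [hκdef, diagonal_mul_diagonal]
    simp [hk₀]
  have hcomm : ∀ S : Finset ι, coordProj K S * κ = κ * coordProj K S := fun S => by
    ext i j
    rw [coordProj_mul_apply, mul_coordProj_apply, hκdef]
    by_cases hij : i = j
    · rw [hij]
    · simp [diagonal_apply_ne _ hij]
  suffices ∀ S : Finset ι, ∃ b : (Matrix ι ι K)ˣ,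
      coordProj K S * (b.valᴴ * y * b.val) = coordProj K S * κ by
    obtain ⟨b, hb⟩ := this Finset.univ
    exact ⟨b, by simpa [coordProj_univ] using hb⟩
  intro S
  induction S using Finset.induction_on with
  | empty => exact ⟨1, by simp [coordProj_empty]⟩
  | insert i S hi ih =>
    obtain ⟨b, hb⟩ := ih
    have hz := conjTranspose_congr hy b.val
    have hzu := isUnit_congr hyu b
    set z := b.valᴴ * y * b.val
    have hzS := mul_coordProj_eq_of_coordProj_mul hε hz hκ hb
    obtain ⟨v, hvi, hvS, hv⟩ := exists_form_eq hi hz hε (exists_apply_ne_zero_of_isUnit hzu i)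
      (fun j hj => by
        have := congrFun (congrFun hzS i) j
        rwa [mul_coordProj_apply, mul_coordProj_apply, if_pos hj, if_pos hj, hκdef,
          diagonal_apply_ne _ (fun h : i = j => hi (h ▸ hj))] at this) hk₀ hk₀s hscale
    obtain ⟨b', hb'⟩ := exists_units_coordProj_union (Finset.disjoint_singleton_right.mpr hi) hκκ
      (hcomm S) (hcomm {i}) hb hzS (isUnit_updateCol_one hvi) (coordProj_mul_updateCol_one hi hvS)
      (updateCol_one_mul_coordProj hi) (by
        ext k l
        rw [mul_coordProj_apply, coordProj_mul_apply, coordProj_mul_apply]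
        simp only [Finset.mem_singleton]
        by_cases hk : k = i
        · subst hk
          by_cases hl : l = k
          · subst hl
            rw [if_pos rfl, if_pos rfl, conjTranspose_mul_mul_apply, hκdef, diagonal_apply_eq]
            simpa using hv
          · rw [if_neg hl, if_pos rfl, hκdef, diagonal_apply_ne _ (Ne.symm hl)]
        · simp [hk])
    refine ⟨b * b', ?_⟩
    rw [Finset.insert_eq, Finset.union_comm, ← hb', Units.val_mul, conjTranspose_mul]
    simp only [z, Matrix.mul_assoc]

end NormalForm

/-! ### Normal form of skew-symmetric matrices. -/

section Skew

variable {K : Type} [Field K] [Algebra ℝ K] [StarRing K] [StarModule ℝ K]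
  {α : Type} [Fintype α] [DecidableEq α]

/-- The skew-symmetric matrix `(0 1; -1 0)`. -/
def skewUnit (α K : Type) [DecidableEq α] [Field K] : Matrix (α ⊕ α) (α ⊕ α) K :=
  fromBlocks 0 1 (-1) 0

lemma conjTranspose_skewUnit : (skewUnit α K)ᴴ = -skewUnit α K := by
  rw [skewUnit, fromBlocks_conjTranspose, fromBlocks_neg]
  simp

lemma skewUnit_mul_self : skewUnit α K * skewUnit α K = -1 := by
  rw [skewUnit, fromBlocks_multiply, ← fromBlocks_one, fromBlocks_neg]
  simp

lemma coordProj_disjSum_mul_skewUnit (D : Finset α) :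
    coordProj K (D.disjSum D) * skewUnit α K = skewUnit α K * coordProj K (D.disjSum D) := by
  ext i j
  rw [coordProj_mul_apply, mul_coordProj_apply, skewUnit]
  rcases i with i | i <;> rcases j with j | j <;> by_cases h : i = j <;> simp [h]

lemma apply_eq_zero_of_conjTranspose_eq_neg {ι : Type} (hstar : ∀ a : K, star a = a)
    {z : Matrix ι ι K} (hz : zᴴ = -z) (i : ι) : z i i = 0 := by
  have := congrFun (congrFun hz i) i
  rw [conjTranspose_apply, hstar, neg_apply] at this
  have h2 : (2 : ℝ) • z i i = 0 := by rw [two_smul, add_eq_zero_iff_eq_neg, ← this]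
  exact (smul_eq_zero.mp h2).resolve_left two_ne_zero

lemma apply_swap_of_conjTranspose_eq_neg {ι : Type} (hstar : ∀ a : K, star a = a)
    {z : Matrix ι ι K} (hz : zᴴ = -z) (i j : ι) : z j i = - z i j := by
  have := congrFun (congrFun hz i) j
  rwa [conjTranspose_apply, hstar, neg_apply] at this

/-- The hyperbolic partner of the `i`-th basis vector. The condition `v i' ≠ 0` allows `v` to
replace the basis vector `i'`. -/
lemma exists_pairing_eq_one (hstar : ∀ a : K, star a = a) {ι : Type} [Fintype ι] [DecidableEq ι]
    {S : Finset ι} {i i' : ι} (hii' : i ≠ i') (hi' : i' ∉ S) {z : Matrix ι ι K}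
    (hz : zᴴ = -z) (hzi : ∃ j, z i j ≠ 0) (hzS : ∀ j ∈ S, z i j = 0) :
    ∃ v : ι → K, v i' ≠ 0 ∧ v i = 0 ∧ (∀ k ∈ S, v k = 0) ∧ (z *ᵥ v) i = 1 := by
  by_cases h : z i i' = 0
  · obtain ⟨j, hj⟩ := hzi
    have hjS : j ∉ S := fun h => hj (hzS j h)
    have hji : j ≠ i := by
      rintro rfl
      exact hj (apply_eq_zero_of_conjTranspose_eq_neg hstar hz j)
    have hji' : j ≠ i' := by rintro rfl; exact hj h
    refine ⟨Pi.single i' 1 + Pi.single j (z i j)⁻¹, by simp [hji'.symm],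
      by simp [hji.symm, hii'], fun k hk => ?_, ?_⟩
    · rw [Pi.add_apply, Pi.single_eq_of_ne (fun h : k = i' => hi' (h ▸ hk)),
        Pi.single_eq_of_ne (fun h : k = j => hjS (h ▸ hk)), add_zero]
    · rw [mulVec_add, Pi.add_apply]
      simp [h, hj]
  · refine ⟨Pi.single i' (z i i')⁻¹, by simpa using h, by simp [hii'],
      fun k hk => Pi.single_eq_of_ne (fun h : k = i' => hi' (h ▸ hk)) _, ?_⟩
    simp [h]

/-- The normal form of an invertible skew-symmetric matrix. -/
theorem exists_units_congr_eq_skewUnit (hstar : ∀ a : K, star a = a)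
    {y : Matrix (α ⊕ α) (α ⊕ α) K} (hy : yᴴ = -y) (hyu : IsUnit y) :
    ∃ b : (Matrix (α ⊕ α) (α ⊕ α) K)ˣ, b.valᴴ * y * b.val = skewUnit α K := by
  set κ : Matrix (α ⊕ α) (α ⊕ α) K := skewUnit α K with hκdef
  have hε : (-1 : ℝ) * (-1) = 1 := by norm_num
  have hκκ : κ * -κ = 1 := by rw [mul_neg, skewUnit_mul_self, neg_neg]
  suffices ∀ S : Finset α, ∃ b : (Matrix (α ⊕ α) (α ⊕ α) K)ˣ,
      coordProj K (S.disjSum S) * (b.valᴴ * y * b.val) = coordProj K (S.disjSum S) * κ by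
    obtain ⟨b, hb⟩ := this Finset.univ
    exact ⟨b, by simpa [coordProj_univ] using hb⟩
  intro S
  induction S using Finset.induction_on with
  | empty => exact ⟨1, by simp [coordProj_empty]⟩
  | insert i S hi ih =>
    obtain ⟨b, hb⟩ := ih
    have hz := conjTranspose_congr (ε := -1) (by simpa using hy) b.val
    have hzu := isUnit_congr hyu b
    set z := b.valᴴ * y * b.val
    have hzS := mul_coordProj_eq_of_coordProj_mul hε hz
      (by rw [hκdef, conjTranspose_skewUnit, neg_one_smul]) hb
    rw [neg_one_smul] at hz
    have hil : (Sum.inl i : α ⊕ α) ∉ S.disjSum S := by simpa using hi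
    have hir : (Sum.inr i : α ⊕ α) ∉ S.disjSum S := by simpa using hi
    obtain ⟨v, hvi, hvi', hvS, hv⟩ := exists_pairing_eq_one hstar
      (Sum.inl_ne_inr : (Sum.inl i : α ⊕ α) ≠ Sum.inr i) hir hz
      (exists_apply_ne_zero_of_isUnit hzu _) (fun j hj => by
        have := congrFun (congrFun hzS (Sum.inl i)) j
        rw [mul_coordProj_apply, mul_coordProj_apply, if_pos hj, if_pos hj, hκdef] at this
        rw [this, skewUnit]
        rcases j with j | j
        · simp
        · simp only [fromBlocks_apply₁₂]
          exact one_apply_ne fun h => hir (h ▸ hj))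
    have hunion : (insert i S).disjSum (insert i S) =
        S.disjSum S ∪ {Sum.inl i, Sum.inr i} := by
      ext (j | j) <;> simp
    have hdisj : Disjoint (S.disjSum S) {Sum.inl i, Sum.inr i} := by
      rw [Finset.disjoint_insert_right, Finset.disjoint_singleton_right]
      exact ⟨hil, hir⟩
    have hTκ : coordProj K {Sum.inl i, Sum.inr i} * κ = κ * coordProj K {Sum.inl i, Sum.inr i} := by
      have h1 := coordProj_disjSum_mul_skewUnit (K := K) (insert i S)
      have h2 := coordProj_disjSum_mul_skewUnit (K := K) S
      rw [hunion, coordProj_union hdisj, add_mul, mul_add, h2] at h1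
      exact add_left_cancel h1
    -- After this change of basis the plane of the two `i`-th coordinates carries the standard form,
    -- the diagonal entries being zero by skew-symmetry.
    set c := (1 : Matrix (α ⊕ α) (α ⊕ α) K).updateCol (Sum.inr i) v with hc
    have hz' : (cᴴ * z * c)ᴴ = -(cᴴ * z * c) := by
      simpa using conjTranspose_congr (ε := -1) (by simpa using hz) c
    have hlr : (cᴴ * z * c) (Sum.inl i) (Sum.inr i) = 1 := by
      rw [conjTranspose_mul_mul_apply]
      have h1 : (fun k => c k (Sum.inl i)) = Pi.single (Sum.inl i) 1 := by
        ext k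
        rw [hc, updateCol_ne Sum.inl_ne_inr, one_apply, Pi.single_apply]
      have h2 : (fun k => c k (Sum.inr i)) = v := by
        ext k
        rw [hc, updateCol_self]
      rw [h1, h2, ← Pi.single_star, star_one, single_dotProduct, one_mul, hv]
    have hrl : (cᴴ * z * c) (Sum.inr i) (Sum.inl i) = -1 := by
      rw [apply_swap_of_conjTranspose_eq_neg hstar hz', hlr]
    obtain ⟨b', hb'⟩ := exists_units_coordProj_union hdisj hκκ
      (coordProj_disjSum_mul_skewUnit S) hTκ hb hzS (isUnit_updateCol_one hvi)
      (coordProj_mul_updateCol_one hir hvS) (updateCol_one_mul_coordProj hir) (by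
        ext k l
        rw [mul_coordProj_apply, coordProj_mul_apply, hTκ, mul_coordProj_apply, ← hc]
        have hd := apply_eq_zero_of_conjTranspose_eq_neg hstar hz'
        by_cases hl : l ∈ ({Sum.inl i, Sum.inr i} : Finset (α ⊕ α))
        · rw [if_pos hl, if_pos hl]
          rw [Finset.mem_insert, Finset.mem_singleton] at hl
          split_ifs with hk
          · rw [Finset.mem_insert, Finset.mem_singleton] at hk
            rcases hk with rfl | rfl <;> rcases hl with rfl | rfl
            · simp [hd, hκdef, skewUnit]
            · simp [hlr, hκdef, skewUnit]
            · simp [hrl, hκdef, skewUnit]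
            · simp [hd, hκdef, skewUnit]
          · rw [Finset.mem_insert, Finset.mem_singleton, not_or] at hk
            rcases hl with rfl | rfl <;> rcases k with k | k
            · simp [hκdef, skewUnit]
            · have : k ≠ i := fun h => hk.2 (h ▸ rfl)
              simp [hκdef, skewUnit, this]
            · have : k ≠ i := fun h => hk.1 (h ▸ rfl)
              simp [hκdef, skewUnit, this]
            · simp [hκdef, skewUnit]
        · rw [if_neg hl, if_neg hl])
    refine ⟨b * b', ?_⟩
    rw [hunion, ← hb', Units.val_mul, conjTranspose_mul]
    simp only [z, Matrix.mul_assoc]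

/-- The skew-symmetric normal form on a set of coordinates of even size. -/
lemma exists_skew_of_even {ι : Type} [Fintype ι] [DecidableEq ι] {A : Finset ι} (hA : Even A.card) :
    ∃ x : Matrix ι ι K, xᴴ = -x ∧ x * x = -coordProj K A ∧ x * coordProj K A = x := by
  obtain ⟨k, hk⟩ := hA
  have hcard : Fintype.card (Fin k ⊕ Fin k) = Fintype.card A := by simp [hk]
  let e : Fin k ⊕ Fin k ≃ A := Fintype.equivOfCardEq hcard
  -- `Q` has the basis vectors indexed by `A` as rows. It transports the standard skew matrix to
  -- these coordinates, extended by zero.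
  let Q : Matrix (Fin k ⊕ Fin k) ι K := of fun r i => if (e r : ι) = i then 1 else 0
  have hQQ : Q * Qᴴ = 1 := by
    ext r s
    rw [mul_apply, one_apply]
    simp only [Q, conjTranspose_apply, of_apply, apply_ite star, star_one, star_zero, mul_ite,
      mul_one, mul_zero]
    simp [eq_comm]
  have hQA : Q * coordProj K A = Q := by
    ext r i
    rw [coordProj, mul_diagonal]
    split_ifs with hi
    · rw [mul_one]
    · simp only [Q, of_apply]
      rw [if_neg fun h : (e r : ι) = i => hi (h ▸ (e r).2), zero_mul]
  have hQ' : Qᴴ * Q = coordProj K A := by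
    ext i j
    rw [mul_apply, coordProj]
    simp only [Q, conjTranspose_apply, of_apply, apply_ite star, star_one, star_zero, mul_ite,
      mul_one, mul_zero, diagonal_apply]
    rw [← Equiv.sum_comp e.symm]
    simp only [Equiv.apply_symm_apply]
    rw [Finset.sum_coe_sort A (fun a => if a = j then if a = i then (1 : K) else 0 else 0)]
    rw [Finset.sum_ite_eq']
    by_cases hij : i = j
    · subst hij; simp
    · simp [hij, Ne.symm hij]
  refine ⟨Qᴴ * skewUnit (Fin k) K * Q, ?_, ?_, ?_⟩
  · rw [conjTranspose_mul, conjTranspose_mul, conjTranspose_conjTranspose, conjTranspose_skewUnit]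
    simp [Matrix.mul_assoc]
  · calc Qᴴ * skewUnit (Fin k) K * Q * (Qᴴ * skewUnit (Fin k) K * Q)
        = Qᴴ * (skewUnit (Fin k) K * (Q * Qᴴ) * skewUnit (Fin k) K) * Q := by
          simp only [Matrix.mul_assoc]
      _ = -coordProj K A := by
          rw [hQQ, Matrix.mul_one, skewUnit_mul_self, ← hQ']
          simp
  · rw [Matrix.mul_assoc, hQA]

end Skew

/-! ### Elements of the parabolic with prescribed blocks. -/

section Parabolic

variable {n : ℕ} {K : Type} [DivisionRing K] [Algebra ℝ K] [StarRing K] [StarModule ℝ K] {ε : ℝ}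

lemma exists_units_conjTranspose_inv (a : (Matrix (Fin n) (Fin n) K)ˣ) :
    ∃ d : (Matrix (Fin n) (Fin n) K)ˣ, d.val = (a⁻¹).valᴴ := by
  refine ⟨⟨(a⁻¹).valᴴ, a.valᴴ, ?_, ?_⟩, rfl⟩ <;> rw [← conjTranspose_mul] <;> simp

lemma exists_parabolic_preserves (hε : ε * ε = 1) (a : (Matrix (Fin n) (Fin n) K)ˣ)
    {c : Matrix (Fin n) (Fin n) K} (hc : cᴴ = ε • c) :
    ∃ g : GL2 n K, g.val = fromBlocks a.val (a.val * c) 0 (a⁻¹).valᴴ ∧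
      g.val * hermForm n K ε * g.valᴴ = hermForm n K ε := by
  obtain ⟨d, hd⟩ := exists_units_conjTranspose_inv a
  obtain ⟨g, hg⟩ := exists_units_fromBlocks a d (a.val * c)
  rw [hd] at hg
  refine ⟨g, hg, ?_⟩
  have h1 : (a⁻¹).valᴴ * a.valᴴ = 1 := by rw [← conjTranspose_mul]; simp
  rw [hg, fromBlocks_mul_hermForm_mul, conjTranspose_mul, conjTranspose_conjTranspose, hc,
    a.mul_inv, h1, hermForm]
  simp [Matrix.mul_assoc, smul_smul, hε]

end Parabolic

/-! ### Parity of the corank in the special orthogonal group. -/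

section Orthogonal

variable {n : ℕ} {K : Type} [Field K] [Algebra ℝ K] [StarRing K] [StarModule ℝ K]

lemma hermForm_neg_one : hermForm n K (-1) = splitForm n K := by
  simp [hermForm, splitForm]

lemma conjTranspose_eq_transpose_of_star {ι κ : Type} (hstar : ∀ a : K, star a = a)
    (x : Matrix ι κ K) : xᴴ = xᵀ := by
  ext i j
  rw [conjTranspose_apply, hstar, transpose_apply]

lemma mem_SO2_iff (hstar : ∀ a : K, star a = a) (g : GL2 n K) : g ∈ SO2 n K ↔
    g.val * hermForm n K (-1) * g.valᴴ = hermForm n K (-1) ∧ g.val.det = 1 := by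
  rw [hermForm_neg_one, conjTranspose_eq_transpose_of_star hstar]
  rfl

/-- In the factorization at `x = 0` the diagonal blocks are `u` and `(u⁻¹)ᴴ`. Here the star is
trivial, so their determinants cancel. -/
lemma det_eq_one_of_isUnit_toBlocks₁₁ (hstar : ∀ a : K, star a = a)
    {g : Matrix (Fin n ⊕ Fin n) (Fin n ⊕ Fin n) K}
    (hg : g * hermForm n K (-1) * gᴴ = hermForm n K (-1)) (hu : IsUnit g.toBlocks₁₁) :
    g.det = 1 := by
  obtain ⟨u, hu⟩ := hu
  have hul : u.val = leftBlock g 0 := by rw [hu, leftBlock, Matrix.zero_mul, add_zero]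
  have huy : u.val * ((u⁻¹).val * rightBlock g 0) = rightBlock g 0 := by
    rw [← Matrix.mul_assoc, u.mul_inv, Matrix.one_mul]
  have hw := conjTranspose_lowerBlock (ε := -1) (by norm_num) (by simp) hg u hul huy
  have h := congrArg Matrix.det (fromBlocks_one_mul_eq (g := g) (x := 0)
    (y := (u⁻¹).val * rightBlock g 0) (by rw [← hul, huy]))
  rw [hw, det_mul, det_mul, det_fromBlocks_zero₂₁, det_fromBlocks_zero₂₁, det_fromBlocks_zero₁₂,
    det_one, one_mul, one_mul, mul_one, ← hul, conjTranspose_eq_transpose_of_star hstar,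
    det_transpose, ← det_mul, u.mul_inv, det_one] at h
  exact h

lemma det_partialSwap (D : Finset (Fin n)) :
    (fromBlocks (coordProj K D) (1 - coordProj K D) (1 - coordProj K D) (coordProj K D)).det =
      (-1) ^ (Dᶜ).card := by
  set E := coordProj K D with hE
  have h : fromBlocks 1 (-1) 0 1 * fromBlocks E (1 - E) (1 - E) E * fromBlocks 1 1 0 1 =
      fromBlocks (E - (1 - E)) 0 (1 - E) 1 := by
    rw [fromBlocks_multiply, fromBlocks_multiply]
    congr 1 <;> noncomm_ring
  have h2 := congrArg Matrix.det h
  rw [det_mul, det_mul, det_fromBlocks_zero₂₁, det_fromBlocks_zero₂₁, det_fromBlocks_zero₁₂,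
    det_one, one_mul, one_mul, mul_one, mul_one] at h2
  rw [h2]
  have : E - (1 - E) = diagonal fun i => if i ∈ D then (1 : K) else -1 := by
    rw [hE, coordProj, ← diagonal_one, diagonal_sub, diagonal_sub]
    congr 1
    ext i
    split_ifs <;> simp
  rw [this, det_diagonal, Finset.prod_ite, Finset.prod_const_one, one_mul, Finset.prod_const]
  congr 2
  ext i
  simp

lemma partialSwap_preserves (D : Finset (Fin n)) :
    fromBlocks (coordProj K D) (1 - coordProj K D) (1 - coordProj K D) (coordProj K D) *
      hermForm n K (-1) *
      (fromBlocks (coordProj K D) (1 - coordProj K D) (1 - coordProj K D) (coordProj K D))ᴴ =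
      hermForm n K (-1) := by
  have hE : coordProj K D * coordProj K D = coordProj K D := coordProj_mul_self D
  rw [fromBlocks_mul_hermForm_mul, conjTranspose_sub, conjTranspose_one, conjTranspose_coordProj,
    hermForm]
  set E := coordProj K D
  congr 1 <;> simp [mul_sub, sub_mul, hE]

lemma preserves_mul {ε : ℝ} {g h : Matrix (Fin n ⊕ Fin n) (Fin n ⊕ Fin n) K}
    (hg : g * hermForm n K ε * gᴴ = hermForm n K ε)
    (hh : h * hermForm n K ε * hᴴ = hermForm n K ε) :
    (g * h) * hermForm n K ε * (g * h)ᴴ = hermForm n K ε := by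
  conv_rhs => rw [← hg, ← hh]
  rw [conjTranspose_mul]
  simp only [Matrix.mul_assoc]

/-- Exchanging the coordinate pairs outside `D` preserves the form and has determinant `(-1)^|Dᶜ|`.
Applied to the normalized `g`, it makes the upper left block invertible, which forces determinant
`1`. As `det g = 1`, the sign must be `1`. -/
lemma even_card_compl_of_mem_SO2 (hstar : ∀ a : K, star a = a) {g : GL2 n K} (hg : g ∈ SO2 n K)
    {l m : (Matrix (Fin n) (Fin n) K)ˣ} {D : Finset (Fin n)}
    (hD : l.val * g.val.toBlocks₁₁ * m.val = coordProj K D) : Even (Dᶜ).card := by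
  obtain ⟨hgS, hdet⟩ := (mem_SO2_iff hstar g).mp hg
  have hε : (-1 : ℝ) * (-1) = 1 := by norm_num
  obtain ⟨L₁, hL, hLS⟩ := exists_parabolic_preserves (n := n) (K := K) hε l (c := 0) (by simp)
  obtain ⟨R₁, hR, hRS⟩ := exists_parabolic_preserves (n := n) (K := K) hε m (c := 0) (by simp)
  have hdet' : ∀ a : (Matrix (Fin n) (Fin n) K)ˣ,
      (fromBlocks a.val (a.val * 0) 0 (a⁻¹).valᴴ).det = 1 := fun a => by
    rw [det_fromBlocks_zero₂₁, conjTranspose_eq_transpose_of_star hstar, det_transpose, ← det_mul,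
      a.mul_inv, det_one]
  set E := coordProj K D with hE
  set s := fromBlocks E (1 - E) (1 - E) E with hs
  have hEE : E * E = E := coordProj_mul_self D
  have hS := preserves_mul (partialSwap_preserves (K := K) D)
    (preserves_mul (preserves_mul hLS hgS) hRS)
  rw [← hE, ← hs] at hS
  have hu : (s * (L₁.val * g.val * R₁.val)).toBlocks₁₁ =
      E + (1 - E) * ((l⁻¹).valᴴ * g.val.toBlocks₂₁ * m.val) := by
    conv_lhs => rw [← fromBlocks_toBlocks g.val]
    rw [hs, hL, hR, fromBlocks_multiply, fromBlocks_multiply, fromBlocks_multiply,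
      toBlocks_fromBlocks₁₁]
    simp only [Matrix.mul_zero, Matrix.zero_mul, add_zero, zero_add, hD, hEE]
  have hunit : IsUnit (s * (L₁.val * g.val * R₁.val)).toBlocks₁₁ := by
    rw [hu]
    refine isUnit_coordProj_add hε g hgS hD (x' := 1 - E) ?_ ?_ ?_
    · rw [mul_sub, ← hE, hEE, mul_one, sub_self]
    · rw [sub_mul, ← hE, hEE, one_mul, sub_self]
    · rw [← hE, show (1 - E) * (1 - E) = 1 - E - E + E * E by noncomm_ring, hEE, sub_add_cancel]
  have h1 := det_eq_one_of_isUnit_toBlocks₁₁ hstar hS hunit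
  rw [det_mul, det_mul, det_mul, hdet, hL, hR, hdet', hdet', mul_one, mul_one, mul_one, hs, hE,
    det_partialSwap] at h1
  have : CharZero K := charZero_of_injective_algebraMap (algebraMap ℝ K).injective
  exact (neg_one_pow_eq_one_iff_even (by
    intro h
    have h2 : (2 : K) = 0 := by linear_combination -h
    exact two_ne_zero h2)).mp h1

end Orthogonal

/-! ### Skew-symmetric matrices and the special orthogonal group. -/

section SkewSymmetric

variable {n : ℕ} {K : Type} [NormedField K] [NormedAlgebra ℝ K] [FiniteDimensional ℝ K]

theorem isAdmissible_skewMatrices {t : K →ₗ[ℝ] ℝ} (ht : t 1 ≠ 0) :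
    IsAdmissible (skewMatrices (2 * n) K).subtype (SO2 (2 * n) K)
      (hExp (skewMatrices (2 * n) K)) := by
  -- With the trivial involution, transposes are conjugate transposes and skew-symmetry is the case
  -- `ε = -1`, also over ℂ.
  let _ : StarRing K := starRingOfComm
  have hstar : ∀ a : K, star a = a := fun _ => rfl
  have : StarModule ℝ K := ⟨fun _ _ => rfl⟩
  have : ContinuousStar K := ⟨continuous_id⟩
  have hε : (-1 : ℝ) * (-1) = 1 := by norm_num
  let e : Fin n ⊕ Fin n ≃ Fin (2 * n) := finSumFinEquiv.trans (finCongr (two_mul n).symm)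
  have hinv : ∀ {x : Matrix (Fin (2 * n)) (Fin (2 * n)) K}, xᴴ = -x ↔ xᴴ = (-1 : ℝ) • x := by
    intro x
    rw [neg_one_smul]
  have hsub : ∀ a b : Matrix (Fin n ⊕ Fin n) (Fin n ⊕ Fin n) K,
      (a * b).submatrix e.symm e.symm = a.submatrix e.symm e.symm * b.submatrix e.symm e.symm :=
    fun a b => (submatrix_mul_equiv a b e.symm e.symm e.symm).symm
  have hsub' : ∀ a b : Matrix (Fin (2 * n)) (Fin (2 * n)) K,
      (a * b).submatrix e e = a.submatrix e e * b.submatrix e e :=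
    fun a b => (submatrix_mul_equiv a b e e e).symm
  refine isAdmissible_of_hermitian (ε := -1) ht (fun p q => by rw [mul_comm]) (fun _ => rfl) hε
    (fun x => ?_) (fun g hg => ((mem_SO2_iff hstar g).mp hg).1) (fun a c hc => ?_)
    (fun g hg => ?_) (κ := (skewUnit (Fin n) K).submatrix e.symm e.symm) ?_ ?_ (fun y hy hyu => ?_)
  · rw [← hinv, conjTranspose_eq_transpose_of_star hstar]
    rfl
  · obtain ⟨g, hg, hgS⟩ := exists_parabolic_preserves hε a hc
    refine ⟨g, (mem_SO2_iff hstar g).mpr ⟨hgS, ?_⟩, hg⟩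
    rw [hg, det_fromBlocks_zero₂₁, conjTranspose_eq_transpose_of_star hstar, det_transpose,
      ← det_mul, a.mul_inv, det_one]
  · obtain ⟨l, m, D, hD⟩ := exists_units_mul_mul_eq_coordProj g.val.toBlocks₁₁
    -- A skew matrix invertible on the complement of `D` exists because the corank is even. Its
    -- square is minus the projection, so `x' = -x`.
    obtain ⟨x, hx, hxx, hxA⟩ := exists_skew_of_even (K := K) (even_card_compl_of_mem_SO2 hstar hg hD)
    have hA : coordProj K Dᶜ = 1 - coordProj K D := by
      rw [eq_sub_iff_add_eq', ← coordProj_union disjoint_compl_right, Finset.union_compl,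
        coordProj_univ]
    have hxE : x * coordProj K D = 0 := by
      rw [← hxA, Matrix.mul_assoc, coordProj_mul_coordProj, Finset.inter_comm,
        Finset.inter_compl, coordProj_empty, Matrix.mul_zero]
    refine isUnit_leftBlock_of_projection hε g ((mem_SO2_iff hstar g).mp hg).1 hD (x := x)
      (x' := -x) (hinv.mp hx) ?_ ?_ ?_
    · rw [← conjTranspose_coordProj, ← neg_neg x, ← hx, ← conjTranspose_neg, ← conjTranspose_mul,
        Matrix.neg_mul, hxE, neg_zero, conjTranspose_zero]
    · rw [Matrix.neg_mul, hxE, neg_zero]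
    · rw [Matrix.neg_mul, hxx, neg_neg, hA]
  · rw [conjTranspose_submatrix, conjTranspose_skewUnit, neg_one_smul]
    rfl
  · refine IsUnit.of_mul_eq_one (-(skewUnit (Fin n) K).submatrix e.symm e.symm) ?_
    rw [Matrix.mul_neg, ← hsub, skewUnit_mul_self]
    ext i j
    simp [one_apply]
  · have hyu' : IsUnit (y.submatrix e e) := by
      obtain ⟨u, rfl⟩ := hyu
      refine IsUnit.of_mul_eq_one ((u⁻¹).val.submatrix e e) ?_
      rw [← hsub', u.mul_inv, submatrix_one_equiv]
    obtain ⟨b, hb⟩ := exists_units_congr_eq_skewUnit hstar (y := y.submatrix e e) (by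
      rw [conjTranspose_submatrix, hinv.mpr hy]
      rfl) hyu'
    refine ⟨⟨b.val.submatrix e.symm e.symm, (b⁻¹).val.submatrix e.symm e.symm, ?_, ?_⟩, ?_⟩
    · rw [← hsub, b.mul_inv, submatrix_one_equiv]
    · rw [← hsub, b.inv_mul, submatrix_one_equiv]
    · change (b.val.submatrix e.symm e.symm)ᴴ * y * b.val.submatrix e.symm e.symm = _
      rw [← hb, hsub, hsub, conjTranspose_submatrix, submatrix_submatrix]
      simp

end SkewSymmetric

/-! ### Symmetric matrices and the symplectic group. -/

section Symmetric

variable {n : ℕ} {K : Type} [NormedField K] [NormedAlgebra ℝ K] [FiniteDimensional ℝ K]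

/-- Square roots in `K` make all invertible symmetric matrices congruent to `1`. -/
theorem isAdmissible_symMatrices {t : K →ₗ[ℝ] ℝ} (ht : t 1 ≠ 0) (hsq : ∀ p : K, ∃ s, p = s * s) :
    IsAdmissible (symMatrices n K).subtype (Sp2 n K) (hExp (symMatrices n K)) := by
  let _ : StarRing K := starRingOfComm
  have hstar : ∀ a : K, star a = a := fun _ => rfl
  have : StarModule ℝ K := ⟨fun _ _ => rfl⟩
  have : ContinuousStar K := ⟨continuous_id⟩
  have hε : (1 : ℝ) * 1 = 1 := by norm_num
  have hform : J (Fin n) K = hermForm n K 1 := by simp [hermForm, J]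
  have hG : ∀ g : GL2 n K, g ∈ Sp2 n K ↔
      g.val * hermForm n K 1 * g.valᴴ = hermForm n K 1 := by
    intro g
    rw [← hform, conjTranspose_eq_transpose_of_star hstar]
    exact SymplecticGroup.mem_iff
  refine isAdmissible_of_hermitian (ε := 1) ht (fun p q => by rw [mul_comm]) (fun _ => rfl) hε
    (fun x => ?_) (fun g hg => (hG g).mp hg) (fun a c hc => ?_)
    (fun g hg => ?_) (κ := 1) (by simp) isUnit_one (fun y hy hyu => ?_)
  · rw [one_smul, conjTranspose_eq_transpose_of_star hstar]
    rfl
  · obtain ⟨g, hg, hgS⟩ := exists_parabolic_preserves hε a hc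
    exact ⟨g, (hG g).mpr hgS, hg⟩
  · obtain ⟨l, m, D, hD⟩ := exists_units_mul_mul_eq_coordProj g.val.toBlocks₁₁
    have hEE : coordProj K D * coordProj K D = coordProj K D := coordProj_mul_self D
    refine isUnit_leftBlock_of_projection hε g ((hG g).mp hg) hD (x := 1 - coordProj K D)
      (x' := 1 - coordProj K D) ?_ ?_ ?_ ?_
    · rw [conjTranspose_sub, conjTranspose_one, conjTranspose_coordProj, one_smul]
    · rw [mul_sub, hEE, mul_one, sub_self]
    · rw [sub_mul, hEE, one_mul, sub_self]
    · rw [mul_sub, mul_one, sub_mul, hEE, one_mul, sub_self, sub_zero]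
  · obtain ⟨b, hb⟩ := exists_units_congr_eq_diagonal hε (k₀ := (1 : K)) one_ne_zero (by simp)
      (fun p hp _ => by
        obtain ⟨s, hs⟩ := hsq p⁻¹
        have hs0 : s ≠ 0 := by
          rintro rfl
          rw [mul_zero] at hs
          exact inv_ne_zero hp hs
        refine ⟨s, hs0, ?_⟩
        rw [hstar, mul_right_comm, ← hs, inv_mul_cancel₀ hp]) hy hyu
    exact ⟨b, by rw [hb, diagonal_one]⟩

end Symmetric

/-! ### Quaternionic anti-Hermitian matrices. -/

section QuaternionAntiHermitian

/-- The quaternion with the given components. -/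
def quaternionMk (a b c d : ℝ) : Quaternion ℝ := ⟨a, b, c, d⟩

section

variable (a b c d : ℝ)

@[simp]
lemma re_quaternionMk : (quaternionMk a b c d).re = a := rfl

@[simp]
lemma imI_quaternionMk : (quaternionMk a b c d).imI = b := rfl

@[simp]
lemma imJ_quaternionMk : (quaternionMk a b c d).imJ = c := rfl

@[simp]
lemma imK_quaternionMk : (quaternionMk a b c d).imK = d := rfl

end

/-- The real part of a quaternion. -/
noncomputable def quaternionRe : Quaternion ℝ →ₗ[ℝ] ℝ where
  toFun q := q.re
  map_add' p q := by simp
  map_smul' r q := by simp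

lemma quaternionRe_one : quaternionRe 1 ≠ 0 := by
  change (1 : ℝ) ≠ 0
  exact one_ne_zero

/-- Let `r = |p|`. If `s` is a real multiple of `r - p i`, then `p² = -r²` gives `p s = r s i`, so
`star s * p * s = r |s|² i`. Only the scale remains to be chosen. -/
lemma exists_star_mul_mul_eq_i {p : Quaternion ℝ} (hp : p ≠ 0) (hps : star p = -p) :
    ∃ s : Quaternion ℝ, s ≠ 0 ∧ star s * p * s = quaternionMk 0 1 0 0 := by
  obtain ⟨a, b, c, d, rfl⟩ : ∃ a b c d, p = quaternionMk a b c d :=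
    ⟨p.re, p.imI, p.imJ, p.imK, rfl⟩
  have ha : a = 0 := by
    have := congrArg QuaternionAlgebra.re hps
    rw [Quaternion.re_star, Quaternion.re_neg, re_quaternionMk] at this
    linarith
  subst ha
  set r := √(b ^ 2 + c ^ 2 + d ^ 2) with hrdef
  have hr : r ^ 2 = b ^ 2 + c ^ 2 + d ^ 2 := Real.sq_sqrt (by positivity)
  have hr0 : 0 ≤ r := Real.sqrt_nonneg _
  have hrpos : 0 < r := by
    refine lt_of_le_of_ne hr0 fun h => hp ?_
    rw [← h] at hr
    have hb : b = 0 := by nlinarith [sq_nonneg b, sq_nonneg c, sq_nonneg d]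
    have hc : c = 0 := by nlinarith [sq_nonneg b, sq_nonneg c, sq_nonneg d]
    have hd : d = 0 := by nlinarith [sq_nonneg b, sq_nonneg c, sq_nonneg d]
    rw [hb, hc, hd]
    rfl
  have hrb : 0 ≤ r + b := by
    have : |b| ≤ r := Real.abs_le_sqrt (by nlinarith [sq_nonneg c, sq_nonneg d])
    linarith [neg_abs_le b]
  rcases hrb.eq_or_lt with h | h
  · have hb : b = -r := by linarith
    have hcd : c ^ 2 + d ^ 2 = 0 := by rw [hb] at hr; linarith
    have hc : c = 0 := by nlinarith [sq_nonneg c, sq_nonneg d]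
    have hd : d = 0 := by nlinarith [sq_nonneg c, sq_nonneg d]
    have hσ : (√r)⁻¹ ^ 2 * r = 1 := by
      rw [inv_pow, Real.sq_sqrt hr0, inv_mul_cancel₀ hrpos.ne']
    have hσ0 : (√r)⁻¹ ≠ 0 := by positivity
    set σ := (√r)⁻¹
    -- In the degenerate case `p = -r i` the element `r - p i` vanishes, and conjugation by `j` is
    -- used.
    refine ⟨quaternionMk 0 0 σ 0, fun h0 => hσ0 (congrArg QuaternionAlgebra.imJ h0), ?_⟩
    rw [hb, hc, hd]
    apply Quaternion.ext <;> simp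
    linear_combination hσ
  · have hlam : 0 < 2 * r ^ 2 * (r + b) := by positivity
    have hσ : (√(2 * r ^ 2 * (r + b)))⁻¹ ^ 2 * (2 * r ^ 2 * (r + b)) = 1 := by
      rw [inv_pow, Real.sq_sqrt hlam.le, inv_mul_cancel₀ hlam.ne']
    have hσ0 : (√(2 * r ^ 2 * (r + b)))⁻¹ ≠ 0 := by positivity
    set σ := (√(2 * r ^ 2 * (r + b)))⁻¹
    -- These are the components of `σ (r - p i)`. Its squared norm is `2 σ² r (r + b)`, which
    -- explains the choice of `σ`.
    refine ⟨quaternionMk (σ * (r + b)) 0 (-(σ * d)) (σ * c),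
      fun h0 => (mul_ne_zero hσ0 h.ne') (congrArg QuaternionAlgebra.re h0), ?_⟩
    apply Quaternion.ext <;> simp
    · ring
    · linear_combination σ ^ 2 * (b - 2 * (r + b)) * hr + hσ
    · linear_combination σ ^ 2 * c * hr
    · linear_combination σ ^ 2 * d * hr

theorem isAdmissible_antiHermMatrices (n : ℕ) :
    IsAdmissible (antiHermMatrices n).subtype (SpSplit n) (hExp (antiHermMatrices n)) := by
  have : StarModule ℝ (Quaternion ℝ) := ⟨fun r q => by ext <;> simp⟩
  have hε : (-1 : ℝ) * (-1) = 1 := by norm_num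
  have hii : (quaternionMk 0 1 0 0 : Quaternion ℝ) * quaternionMk 0 1 0 0 = -1 := by
    apply Quaternion.ext <;> simp <;> rfl
  have hi0 : (quaternionMk 0 1 0 0 : Quaternion ℝ) ≠ 0 := by
    intro h
    rw [h, mul_zero] at hii
    exact one_ne_zero (neg_eq_zero.mp hii.symm)
  have his : star (quaternionMk 0 1 0 0 : Quaternion ℝ) = -quaternionMk 0 1 0 0 := by
    apply Quaternion.ext <;> simp
  set i : Quaternion ℝ := quaternionMk 0 1 0 0
  have hform : splitForm n (Quaternion ℝ) = hermForm n (Quaternion ℝ) (-1) := by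
    simp [hermForm, splitForm]
  have hG : ∀ g : GL2 n (Quaternion ℝ), g ∈ SpSplit n ↔
      g.val * hermForm n (Quaternion ℝ) (-1) * g.valᴴ = hermForm n (Quaternion ℝ) (-1) := by
    intro g
    rw [← hform]
    rfl
  refine isAdmissible_of_hermitian (ε := -1) (t := quaternionRe) quaternionRe_one
    (fun p q => ?_) (fun p => ?_) hε (fun x => ?_) (fun g hg => (hG g).mp hg) (fun a c hc => ?_)
    (fun g hg => ?_) (κ := diagonal fun _ => i) ?_ ?_ (fun y hy hyu => ?_)
  · change (p * q).re = (q * p).re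
    simp
    ring
  · change (star p).re = p.re
    simp
  · rw [neg_one_smul]
    rfl
  · obtain ⟨g, hg, hgS⟩ := exists_parabolic_preserves hε a hc
    exact ⟨g, (hG g).mpr hgS, hg⟩
  · obtain ⟨l, m, D, hD⟩ := exists_units_mul_mul_eq_coordProj g.val.toBlocks₁₁
    have hcomm : (diagonal fun _ => i) * coordProj (Quaternion ℝ) D =
        coordProj (Quaternion ℝ) D * diagonal fun _ => i := by
      rw [coordProj, diagonal_mul_diagonal, diagonal_mul_diagonal]
      congr 1
      ext1 k
      split_ifs <;> simp
    have hdd : (diagonal fun _ : Fin n => i) * (diagonal fun _ => i) = -1 := by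
      rw [diagonal_mul_diagonal, hii, ← diagonal_one, diagonal_neg]
    have hds : (diagonal fun _ : Fin n => i)ᴴ = -diagonal fun _ => i := by
      rw [diagonal_conjTranspose, diagonal_neg]
      congr 1
      ext1 k
      exact his
    have hEE : coordProj (Quaternion ℝ) D * coordProj (Quaternion ℝ) D = coordProj (Quaternion ℝ) D :=
      coordProj_mul_self D
    have hEs := conjTranspose_coordProj (K := Quaternion ℝ) D
    set E := coordProj (Quaternion ℝ) D
    set d : Matrix (Fin n) (Fin n) (Quaternion ℝ) := diagonal fun _ => i
    have hE0 : E * (1 - E) = 0 := by rw [mul_sub, hEE, mul_one, sub_self]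
    have hE0' : (1 - E) * E = 0 := by rw [sub_mul, hEE, one_mul, sub_self]
    -- The scalar matrix `i` commutes with the real projection `1 - E`, so `i (1 - E)` is
    -- anti-Hermitian with square `-(1 - E)`.
    refine isUnit_leftBlock_of_projection hε g ((hG g).mp hg) hD (x := d * (1 - E))
      (x' := -(d * (1 - E))) ?_ ?_ ?_ ?_
    · rw [conjTranspose_mul, conjTranspose_sub, hEs, hds, conjTranspose_one, neg_one_smul, mul_neg,
        mul_sub, sub_mul, mul_one, one_mul, hcomm]
    · rw [← mul_assoc, ← hcomm, mul_assoc, hE0, mul_zero]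
    · rw [neg_mul, mul_assoc, hE0', mul_zero, neg_zero]
    · have h1 : (1 - E) * d = d * (1 - E) := by rw [mul_sub, sub_mul, hcomm, one_mul, mul_one]
      calc -(d * (1 - E)) * (d * (1 - E)) = -(d * ((1 - E) * d) * (1 - E)) := by noncomm_ring
        _ = -(d * d * (1 - E - E + E * E)) := by rw [h1]; noncomm_ring
        _ = 1 - E := by rw [hdd, hEE, sub_add_cancel]; simp
  · rw [diagonal_conjTranspose, neg_one_smul, diagonal_neg]
    congr 1
    ext1 k
    exact his
  · exact isUnit_diagonal fun _ => hi0
  · exact exists_units_congr_eq_diagonal hε hi0 (by rw [neg_one_smul]; exact his)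
      (fun p hp hps => exists_star_mul_mul_eq_i hp (by rwa [neg_one_smul] at hps)) hy hyu

end QuaternionAntiHermitian

end SteinSahi

theorem corollary4p2 (n : ℕ) :
    -- all complex matrices, `GL(2n, ℂ)`
    SteinSahi.PrincipalSeriesIrreducible
      (⊤ : Submodule ℝ (Matrix (Fin n) (Fin n) ℂ)) (⊤ : Subgroup (SteinSahi.GL2 n ℂ)) ∧
    -- symmetric complex matrices, `Sp(2n, ℂ)`
    SteinSahi.PrincipalSeriesIrreducible
      (SteinSahi.symMatrices n ℂ) (SteinSahi.Sp2 n ℂ) ∧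
    -- skew-symmetric complex matrices of size `2n`, `SO(4n, ℂ)`
    SteinSahi.PrincipalSeriesIrreducible
      (SteinSahi.skewMatrices (2 * n) ℂ) (SteinSahi.SO2 (2 * n) ℂ) ∧
    -- all real matrices, `GL(2n, ℝ)`
    SteinSahi.PrincipalSeriesIrreducible
      (⊤ : Submodule ℝ (Matrix (Fin n) (Fin n) ℝ)) (⊤ : Subgroup (SteinSahi.GL2 n ℝ)) ∧
    -- skew-symmetric real matrices of size `2n`, `SO(2n, 2n)`
    SteinSahi.PrincipalSeriesIrreducible
      (SteinSahi.skewMatrices (2 * n) ℝ) (SteinSahi.SO2 (2 * n) ℝ) ∧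
    -- all quaternionic matrices, `GL(2n, ℍ)`
    SteinSahi.PrincipalSeriesIrreducible
      (⊤ : Submodule ℝ (Matrix (Fin n) (Fin n) (Quaternion ℝ)))
      (⊤ : Subgroup (SteinSahi.GL2 n (Quaternion ℝ))) ∧
    -- anti-Hermitian quaternionic matrices, `Sp(n, n)`
    SteinSahi.PrincipalSeriesIrreducible
      (SteinSahi.antiHermMatrices n) (SteinSahi.SpSplit n) := by
  have hre : Complex.reLm 1 ≠ 0 := by simp
  have hid : (LinearMap.id : ℝ →ₗ[ℝ] ℝ) 1 ≠ 0 := by simp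
  exact ⟨(SteinSahi.isAdmissible_top hre).principalSeriesIrreducible,
    (SteinSahi.isAdmissible_symMatrices hre IsAlgClosed.exists_eq_mul_self).principalSeriesIrreducible,
    (SteinSahi.isAdmissible_skewMatrices hre).principalSeriesIrreducible,
    (SteinSahi.isAdmissible_top hid).principalSeriesIrreducible,
    (SteinSahi.isAdmissible_skewMatrices hid).principalSeriesIrreducible,
    (SteinSahi.isAdmissible_top SteinSahi.quaternionRe_one).principalSeriesIrreducible,
    (SteinSahi.isAdmissible_antiHermMatrices n).principalSeriesIrreducible⟩
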